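/- Let $k$ be an algebraically closed field of characteristic zero, $X$ an irreducible smooth projective curve over $k$, $V$ a vector bundle on $X$, and $\mathbb D\subset X$ a finite set of closed points. A parabolic structure on $V$ over $\mathbb D$ consists, for each $t\in\mathbb D$, of a filtration $V_t=V_{t,1}\supset\cdots\supset V_{t,l_t}\supset V_{t,l_t+1}=0$ of the fibre of $V$ at $t$ and rational numbers $0\le\alpha_{t,1}<\cdots<\alpha_{t,l_t}<1$. For a subbundle $F\subset V$, let $F_*$ denote $F$ with the induced parabolic structure, given by the subspaces $F_t\cap V_{t,j}$ with the numbers $\alpha_{t,j}$; its parabolic weights at $t$ are those $\alpha_{t,j}$ for which $F_t\cap V_{t,j+1}\ne F_t\cap V_{t,j}$. For $F\neq 0$ put $$\text{par-}\mu(F_*)=\frac{1}{\operatorname{rank}F}\Big(\deg F+\sum_{t\in\mathbb D}\sum_{j=1}^{l_t}\alpha_{t,j}\dim\frac{F_t\cap V_{t,j}}{F_t\cap V_{t,j+1}}\Big).$$ Assume that $V_*$ is parabolic semistable, i.e. $\text{par-}\mu(F_*)\le\text{par-}\mu(V_*)$ for every subbundle $0\ne F\subsetneq V$. For each $t\in\mathbb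 D$ fix an integer $N_t\ge 1$. Call a nonzero subbundle $F\subset V$ admissible if 1. all parabolic weights of $F_*$ at every $t\in\mathbb D$ are integral multiples of $\frac1{N_t}$, and 2. $\text{par-}\mu(F_*)=\text{par-}\mu(V_*)$. Assume that an admissible subbundle exists. Then there is a unique maximal admissible subbundle $\mathcal F\subset V$, and it contains every admissible subbundle. Moreover, if $F^1$ and $F^2$ are admissible, then the subsheaf $F^1+F^2\subset V$ is again an admissible subbundle (in particular $V/(F^1+F^2)$ is torsion-free). -/

import Mathlib

open CategoryTheory AlgebraicGeometry TensorProduct TopologicalSpace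

universe u

/-- An irreducible smooth projective curve over the field `k`: an integral scheme that is proper and
smooth of relative dimension one over `Spec k`. (A smooth irreducible scheme over a field is
integral, and a curve over a field is projective if and only if it is proper.) -/
structure SmoothProjectiveCurve (k : Type u) [Field k] where
  /-- the underlying scheme -/
  X : Scheme.{u}
  /-- the structure morphism -/
  hom : X ⟶ Spec (.of k)
  isIntegral : IsIntegral X
  isProper : IsProper hom
  isSmooth : SmoothOfRelativeDimension 1 hom

namespace SmoothProjectiveCurve

variable {k : Type u} [Field k] (C : SmoothProjectiveCurve k)

instance : IsIntegral C.X := C.isIntegral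

instance : IsProper C.hom := C.isProper

instance : SmoothOfRelativeDimension 1 C.hom := C.isSmooth

instance : IsLocallyNoetherian C.X := LocallyOfFiniteType.isLocallyNoetherian C.hom

end SmoothProjectiveCurve

/-! ### The module structure on stalks -/

/-- The stalk of an `𝒪_X`-module is a module over the local ring. -/
noncomputable instance stalkModule {X : Scheme.{u}} (V : X.Modules) (x : X) :
    Module (X.presheaf.stalk x) ↑(V.presheaf.stalk x) :=
  PresheafOfModules.instModuleCarrierStalkCommRingCatCarrierAbPresheafOpensCarrier
    (R := X.presheaf) V.val x

/-- Taking germs is compatible with scalar multiplication. -/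
lemma germ_smul_section {X : Scheme.{u}} (V : X.Modules) (x : X) (U : X.Opens) (hx : x ∈ U)
    (r : Γ(X, U)) (s : Γ(V, U)) :
    V.presheaf.germ U x hx (r • s) = X.presheaf.germ U x hx r • V.presheaf.germ U x hx s :=
  PresheafOfModules.germ_smul (R := X.presheaf) V.val x U hx r s

/-! ### Subsheaves, frames, vector bundles and subbundles -/

/-- A subsheaf of `𝒪_X`-modules of the `𝒪_X`-module `V`. -/
@[ext]
structure Subsheaf {X : Scheme.{u}} (V : X.Modules) where
  /-- the sections of the subsheaf over an open set -/
  sections : ∀ U : X.Opens, Submodule Γ(X, U) Γ(V, U)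
  map_mem : ∀ {U W : X.Opens} (h : W ≤ U) (s : Γ(V, U)), s ∈ sections U →
    V.presheaf.map (homOfLE h).op s ∈ sections W
  mem_of_local : ∀ (U : X.Opens) (s : Γ(V, U)),
    (∀ x ∈ U, ∃ (W : X.Opens) (h : W ≤ U), x ∈ W ∧
      V.presheaf.map (homOfLE h).op s ∈ sections W) → s ∈ sections U

namespace Subsheaf

variable {X : Scheme.{u}} {V : X.Modules}

/-- Subsheaves are ordered by inclusion. -/
noncomputable instance : PartialOrder (Subsheaf V) :=
  PartialOrder.lift Subsheaf.sections fun _ _ h => Subsheaf.ext h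

/-- The whole of `V`. -/
noncomputable instance : OrderTop (Subsheaf V) where
  top :=
    { sections := fun _ => ⊤
      map_mem := fun _ _ _ => Submodule.mem_top
      mem_of_local := fun _ _ _ => Submodule.mem_top }
  le_top := fun _ _ _ _ => Submodule.mem_top

/-- The sum `F + G` of two subsheaves: its sections are the sections of `V` that are locally the sum
of a section of `F` and a section of `G`. -/
noncomputable instance : Add (Subsheaf V) where
  add F G :=
    { sections := fun U =>
        { carrier := {s | ∀ x ∈ U, ∃ (W : X.Opens) (h : W ≤ U), x ∈ W ∧
            V.presheaf.map (homOfLE h).op s ∈ F.sections W ⊔ G.sections W}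
          zero_mem' := fun x hx => ⟨U, le_rfl, hx, by rw [map_zero]; exact zero_mem _⟩
          add_mem' := by
            intro a b ha hb x hx
            obtain ⟨W₁, h₁, hx₁, m₁⟩ := ha x hx
            obtain ⟨W₂, h₂, hx₂, m₂⟩ := hb x hx
            have key : ∀ {W W' : X.Opens} (h : W ≤ U) (h' : W' ≤ W) (s : Γ(V, U)),
                V.presheaf.map (homOfLE h).op s ∈ F.sections W ⊔ G.sections W →
                V.presheaf.map (homOfLE (h'.trans h)).op s ∈ F.sections W' ⊔ G.sections W' := by
              intro W W' h h' s hs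
              obtain ⟨y, hy, z, hz, e⟩ := Submodule.mem_sup.1 hs
              have e' : V.presheaf.map (homOfLE (h'.trans h)).op s =
                  V.presheaf.map (homOfLE h').op (V.presheaf.map (homOfLE h).op s) := by
                rw [← ConcreteCategory.comp_apply, ← Functor.map_comp]
                rfl
              rw [e', ← e, map_add]
              exact Submodule.add_mem_sup (F.map_mem h' y hy) (G.map_mem h' z hz)
            refine ⟨W₁ ⊓ W₂, inf_le_left.trans h₁, ⟨hx₁, hx₂⟩, ?_⟩
            rw [map_add]
            exact add_mem (key h₁ inf_le_left a m₁) (key h₂ inf_le_right b m₂)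
          smul_mem' := by
            intro c a ha x hx
            obtain ⟨W, h, hxW, m⟩ := ha x hx
            refine ⟨W, h, hxW, ?_⟩
            rw [Scheme.Modules.map_smul]
            exact Submodule.smul_mem _ _ m }
      map_mem := by
        intro U W h s hs x hx
        obtain ⟨W', h', hx', m⟩ := hs x (h hx)
        refine ⟨W ⊓ W', inf_le_left, ⟨hx, hx'⟩, ?_⟩
        obtain ⟨y, hy, z, hz, e⟩ := Submodule.mem_sup.1 m
        have e' : V.presheaf.map (homOfLE (inf_le_left : W ⊓ W' ≤ W)).op
              (V.presheaf.map (homOfLE h).op s) =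
            V.presheaf.map (homOfLE (inf_le_right : W ⊓ W' ≤ W')).op
              (V.presheaf.map (homOfLE h').op s) := by
          rw [← ConcreteCategory.comp_apply, ← ConcreteCategory.comp_apply, ← Functor.map_comp,
            ← Functor.map_comp]
          rfl
        rw [e', ← e, map_add]
        exact Submodule.add_mem_sup (F.map_mem _ y hy) (G.map_mem _ z hz)
      mem_of_local := by
        intro U s hs x hx
        obtain ⟨W, h, hxW, m⟩ := hs x hx
        obtain ⟨W', h', hx', m'⟩ := m x hxW
        refine ⟨W', h'.trans h, hx', ?_⟩
        have e' : V.presheaf.map (homOfLE (h'.trans h)).op s =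
            V.presheaf.map (homOfLE h').op (V.presheaf.map (homOfLE h).op s) := by
          rw [← ConcreteCategory.comp_apply, ← Functor.map_comp]
          rfl
        rw [e']
        exact m' }

/-- The subsheaf `F` is not the zero sheaf. -/
def Nonzero (F : Subsheaf V) : Prop := ∃ U : X.Opens, F.sections U ≠ ⊥

/-- The sections `e i` of `V` over `U` are a frame of `F` over `U`: over every open `W ⊆ U` their
restrictions form a basis of the `𝒪_X(W)`-module `F(W)`. So `e` is the same thing as an isomorphism
from a free `𝒪_U`-module to `F|_U`. -/
def IsFrame (F : Subsheaf V) (U : X.Opens) {ι : Type} (e : ι → Γ(V, U)) : Prop :=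
  ∀ (W : X.Opens) (h : W ≤ U),
    LinearIndependent Γ(X, W) (fun i => V.presheaf.map (homOfLE h).op (e i)) ∧
    Submodule.span Γ(X, W) (Set.range fun i => V.presheaf.map (homOfLE h).op (e i)) = F.sections W

/-- `F` is a subbundle of `V`: locally there is a frame of `V` of which a part is a frame of `F`
(so that both `F` and `V / F` are locally free of finite rank). -/
def IsSubbundle (F : Subsheaf V) : Prop :=
  ∀ x : X, ∃ (U : X.Opens) (r m : ℕ) (e : Fin r ⊕ Fin m → Γ(V, U)), x ∈ U ∧
    (⊤ : Subsheaf V).IsFrame U e ∧ F.IsFrame U (fun i => e (Sum.inl i))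

/-- The stalk of `F` at `x`, as a submodule of the stalk of `V` at `x`: it consists of the germs of
the sections of `F`. -/
noncomputable def stalk (F : Subsheaf V) (x : X) :
    Submodule (X.presheaf.stalk x) ↑(V.presheaf.stalk x) :=
  Submodule.span _ {v | ∃ (U : X.Opens) (hx : x ∈ U) (s : Γ(V, U)), s ∈ F.sections U ∧
    V.presheaf.germ U x hx s = v}

lemma stalk_mono {F G : Subsheaf V} (h : F ≤ G) (x : X) : F.stalk x ≤ G.stalk x := by
  refine Submodule.span_mono ?_
  rintro v ⟨U, hx, s, hs, rfl⟩
  exact ⟨U, hx, s, h U hs, rfl⟩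

end Subsheaf

/-- `V` is a vector bundle: it is locally free of finite rank. -/
def IsVectorBundle {X : Scheme.{u}} (V : X.Modules) : Prop :=
  ∀ x : X, ∃ (U : X.Opens) (n : ℕ) (e : Fin n → Γ(V, U)), x ∈ U ∧ (⊤ : Subsheaf V).IsFrame U e

/-- The residue field of `X` at `x`. -/
abbrev residueFieldAt (X : Scheme.{u}) (x : X) : Type u :=
  IsLocalRing.ResidueField (X.presheaf.stalk x)

/-- The fibre `κ(x) ⊗ V_x` of `V` at `x`, a vector space over the residue field `κ(x)`. -/
def bundleFiber {X : Scheme.{u}} (V : X.Modules) (x : X) : Type u :=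
  residueFieldAt X x ⊗[X.presheaf.stalk x] ↑(V.presheaf.stalk x)

noncomputable instance {X : Scheme.{u}} (V : X.Modules) (x : X) : AddCommGroup (bundleFiber V x) :=
  inferInstanceAs (AddCommGroup (residueFieldAt X x ⊗[X.presheaf.stalk x] ↑(V.presheaf.stalk x)))

noncomputable instance {X : Scheme.{u}} (V : X.Modules) (x : X) :
    Module (residueFieldAt X x) (bundleFiber V x) :=
  inferInstanceAs (Module (residueFieldAt X x)
    (residueFieldAt X x ⊗[X.presheaf.stalk x] ↑(V.presheaf.stalk x)))

namespace Subsheaf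

variable {X : Scheme.{u}} {V : X.Modules}

/-- The fibre of `F` at `x` as a subspace of the fibre of `V`: the image of `κ(x) ⊗ F_x` in
`κ(x) ⊗ V_x`. For a subbundle the map from `κ(x) ⊗ F_x` to this image is an isomorphism. -/
noncomputable def fiber (F : Subsheaf V) (x : X) :
    Submodule (residueFieldAt X x) (bundleFiber V x) :=
  ((F.stalk x).baseChange (residueFieldAt X x) : Submodule (residueFieldAt X x)
    (residueFieldAt X x ⊗[X.presheaf.stalk x] ↑(V.presheaf.stalk x)))

lemma fiber_mono {F G : Subsheaf V} (h : F ≤ G) (x : X) : F.fiber x ≤ G.fiber x := by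
  unfold fiber
  rw [Submodule.baseChange_eq_span, Submodule.baseChange_eq_span]
  exact Submodule.span_mono (Submodule.map_mono (stalk_mono h x))

/-- The rank of `F`: the dimension of its generic stalk over the function field. -/
noncomputable def rank [IsIntegral X] (F : Subsheaf V) : ℕ :=
  Module.finrank X.functionField (F.stalk (genericPoint X))

variable [IsIntegral X] [IsLocallyNoetherian X]

/-- `d` is the degree of the divisor of a nonzero rational section of the determinant of `F`. The
rational section is `b₁ ∧ ⋯ ∧ b_r` for a basis `b` of the generic stalk. Its order at a closed point
`x` is the order of `det A`, where `b_j = ∑ i, A i j • g_i` for a frame `g` of `F` near `x`.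
(Closed points have degree one if the ground field is algebraically closed.) -/
def HasDegree (F : Subsheaf V) (d : ℤ) : Prop :=
  ∃ (r : ℕ) (b : Module.Basis (Fin r) X.functionField (F.stalk (genericPoint X))) (n : X → ℤ),
    (∀ x : X, IsClosed ({x} : Set X) →
      ∃ (W : X.Opens) (_ : x ∈ W) (hη : genericPoint X ∈ W) (g : Fin r → Γ(V, W))
        (A : Matrix (Fin r) (Fin r) X.functionField),
        F.IsFrame W g ∧
        (∀ j, (b j : ↑(V.presheaf.stalk (genericPoint X))) =
          ∑ i, A i j • V.presheaf.germ W (genericPoint X) hη (g i)) ∧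
        n x = Scheme.ord A.det x) ∧
    d = ∑ᶠ x ∈ {x : X | IsClosed ({x} : Set X)}, n x

open Classical in
/-- The degree of a locally free subsheaf. (On a smooth projective curve over an algebraically closed
field exactly one integer satisfies `HasDegree`.) -/
noncomputable def degree (F : Subsheaf V) : ℤ :=
  if h : ∃ d, F.HasDegree d then h.choose else 0

end Subsheaf

/-! ### Parabolic structures -/

/-- A parabolic structure over the finite set of points `D` on a subbundle `E` of `V` (the case
`E = ⊤` is that of `V` itself): at every `t ∈ D` a filtration
`E_t = E_{t,0} ⊇ E_{t,1} ⊇ ⋯ ⊇ E_{t,l} = 0` of the fibre, with rational numbers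
`0 ≤ α_{t,0} < ⋯ < α_{t,l-1} < 1`. Repeated subspaces are permitted; they affect neither the weights
(see `weights`) nor the parabolic degree. -/
structure ParabolicStructure {X : Scheme.{u}} {V : X.Modules} (E : Subsheaf V) (D : Finset X) where
  /-- the length of the filtration at `t` -/
  length : D → ℕ
  /-- the filtration of the fibre at `t` -/
  flag : ∀ t : D, Fin (length t + 1) → Submodule (residueFieldAt X t) (bundleFiber V t)
  flag_zero : ∀ t, flag t 0 = E.fiber t
  flag_last : ∀ t, flag t (Fin.last _) = ⊥
  flag_antitone : ∀ t, Antitone (flag t)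
  /-- the number attached to a step of the filtration -/
  weight : ∀ t : D, Fin (length t) → ℚ
  weight_strictMono : ∀ t, StrictMono (weight t)
  weight_nonneg : ∀ t j, 0 ≤ weight t j
  weight_lt_one : ∀ t j, weight t j < 1

namespace ParabolicStructure

variable {X : Scheme.{u}} {V : X.Modules} {D : Finset X} {E : Subsheaf V}

/-- The parabolic weights at `t`: the numbers `α_{t,j}` with `E_{t,j+1} ≠ E_{t,j}`. -/
def weights (P : ParabolicStructure E D) (t : D) : Set ℚ :=
  {a | ∃ j : Fin (P.length t), P.flag t j.succ ≠ P.flag t j.castSucc ∧ a = P.weight t j}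

/-- The parabolic structure induced on a subsheaf `F`: its filtration at `t` is `F_t ∩ E_{t,j}`, with
the number `α_{t,j}`. -/
noncomputable def induced (P : ParabolicStructure (⊤ : Subsheaf V) D) (F : Subsheaf V) :
    ParabolicStructure F D where
  length := P.length
  flag t j := F.fiber t ⊓ P.flag t j
  flag_zero t := by
    rw [P.flag_zero t]
    exact inf_eq_left.2 (Subsheaf.fiber_mono le_top _)
  flag_last t := by rw [P.flag_last t, inf_bot_eq]
  flag_antitone t _ _ h := inf_le_inf_left _ (P.flag_antitone t h)
  weight := P.weight
  weight_strictMono := P.weight_strictMono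
  weight_nonneg := P.weight_nonneg
  weight_lt_one := P.weight_lt_one

variable [IsIntegral X] [IsLocallyNoetherian X]

/-- The parabolic degree `deg E + ∑ t, ∑ j, α_{t,j} * dim (E_{t,j} / E_{t,j+1})`. -/
noncomputable def parDeg (P : ParabolicStructure E D) : ℚ :=
  E.degree + ∑ t : D, ∑ j : Fin (P.length t), P.weight t j *
    (Module.finrank (residueFieldAt X t)
      (P.flag t j.castSucc ⧸ (P.flag t j.succ).submoduleOf (P.flag t j.castSucc)) : ℚ)

/-- The parabolic slope `par-μ = par-deg / rank` (meaningful only for nonzero bundles). -/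
noncomputable def parSlope (P : ParabolicStructure E D) : ℚ := P.parDeg / E.rank

/-- Semistability of the parabolic bundle `V_*`: `par-μ(F_*) ≤ par-μ(V_*)` for all subbundles
`0 ≠ F ⊊ V`. -/
def IsSemistable (P : ParabolicStructure (⊤ : Subsheaf V) D) : Prop :=
  ∀ F : Subsheaf V, F.IsSubbundle → F.Nonzero → F ≠ ⊤ → (P.induced F).parSlope ≤ P.parSlope

/-- `F` is a nonzero subbundle of `V` such that all parabolic weights of `F_*` at every `t ∈ D` are
integral multiples of `1 / N t` and such that `par-μ(F_*) = par-μ(V_*)`. -/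
structure IsAdmissible (P : ParabolicStructure (⊤ : Subsheaf V) D) (N : D → ℕ)
    (F : Subsheaf V) : Prop where
  isSubbundle : F.IsSubbundle
  nonzero : F.Nonzero
  weights_integral : ∀ t : D, ∀ a ∈ (P.induced F).weights t, ∃ m : ℤ, a = m * (1 / (N t : ℚ))
  parSlope_eq : (P.induced F).parSlope = P.parSlope

end ParabolicStructure

/-! A subbundle is determined by its generic stalk: by `Subsheaf.IsSubbundle.eq_sat` it is `sat W`
for a subspace `W` of the generic stalk of `V`, and every `sat W` is a subbundle because the local
rings of the curve are principal ideal domains. For F₁ = `sat W₁` and F₂ = `sat W₂` let I = `sat (W₁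
⊓ W₂)`, the intersection, and S = `sat (W₁ ⊔ W₂)`, the saturation of F₁ + F₂.

The sequence 0 → I → F₁ ⊕ F₂ → F₁ + F₂ → 0 gives deg I + deg S = deg F₁ + deg F₂ + ∑ l(x), where
l(x) is the length of S/(F₁ + F₂) at x (`exists_latticeOrd_sup_inf`,
`exists_degree_sup_add_degree_inf`). The weights can work in the opposite direction: at t ∈ D the
fibres of F₁ and F₂ may span a proper subspace of the fibre of S, of codimension c ≤ l(t). Summation
by parts (`flagWeight_add_le`) bounds the loss of weight by a·c, where a < 1 bounds all the weights;
so the loss is at most l(t), with equality only if l(t) = 0. Hence par-deg I + par-deg S ≥ par-deg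
F₁ + par-deg F₂.

Semistability bounds par-deg I and par-deg S by slope times rank, and the ranks add up. If F₁ and F₂
have the slope of V, all inequalities become equalities (`IsSemistable.sup`): l vanishes, so F₁ + F₂
= S is saturated; S has the slope of V; and dimensions add up along each flag, so every weight of S
is a weight of F₁ or F₂. An admissible subbundle of greatest rank then contains all others, since
adding another one cannot raise its rank.

The degree is read off from a chosen rational section of the determinant, so these formulas need
principal divisors to have degree zero. A nonconstant f has [K : k(f)] zeros with multiplicity,
counted by the primes over f in the integral closure of k[f] (`IsPlaceSystem.finsum_zeros`), and 1/f
has equally many. That closed points are exactly the nontrivial valuation rings of K over k comes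
from the valuative criterion and from étale charts over the affine line
(`SmoothProjectiveCurve.isPlaceSystem`). -/

/-! ### Families of vectors related by matrices -/

section Families

variable {R N ι κ μ : Type*} [CommRing R] [AddCommGroup N] [Module R N]
  [Fintype ι] [Fintype κ] [Fintype μ]

/-- The family `v` is obtained from the family `w` by the matrix `A`. -/
def IsMatrixOf (A : Matrix ι κ R) (v : κ → N) (w : ι → N) : Prop :=
  ∀ j, v j = ∑ i, A i j • w i

omit [Fintype κ] in
lemma exists_isMatrixOf {v : κ → N} {w : ι → N}
    (h : ∀ j, v j ∈ Submodule.span R (Set.range w)) : ∃ A : Matrix ι κ R, IsMatrixOf A v w := by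
  choose c hc using fun j => (Submodule.mem_span_range_iff_exists_fun R).1 (h j)
  exact ⟨fun i j => c j i, fun j => (hc j).symm⟩

omit [Fintype κ] in
lemma IsMatrixOf.mem_span {A : Matrix ι κ R} {v : κ → N} {w : ι → N} (h : IsMatrixOf A v w)
    (j : κ) : v j ∈ Submodule.span R (Set.range w) := by
  rw [h j]
  exact Submodule.sum_mem _ fun i _ => Submodule.smul_mem _ _ (Submodule.subset_span ⟨i, rfl⟩)

omit [Fintype μ] in
lemma IsMatrixOf.mul {A : Matrix ι κ R} {B : Matrix κ μ R} {v : μ → N} {w : κ → N} {u : ι → N}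
    (hB : IsMatrixOf B v w) (hA : IsMatrixOf A w u) : IsMatrixOf (A * B) v u := by
  intro j
  rw [hB j]
  simp_rw [hA _, Finset.smul_sum, Matrix.mul_apply, Finset.sum_smul, smul_smul]
  rw [Finset.sum_comm]
  simp_rw [mul_comm]

omit [Fintype κ] in
lemma IsMatrixOf.unique {A B : Matrix ι κ R} {v : κ → N} {w : ι → N}
    (hw : LinearIndependent R w) (hA : IsMatrixOf A v w) (hB : IsMatrixOf B v w) : A = B := by
  ext i j
  have h : ∑ i, (A i j - B i j) • w i = 0 := by
    simp_rw [sub_smul, Finset.sum_sub_distrib]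
    rw [← hA j, ← hB j, sub_self]
  exact sub_eq_zero.1 (Fintype.linearIndependent_iff.1 hw _ h i)

lemma isMatrixOf_one [DecidableEq ι] (w : ι → N) : IsMatrixOf (1 : Matrix ι ι R) w w := by
  intro j
  simp [Matrix.one_apply]

omit [Fintype κ] in
lemma IsMatrixOf.map {S E : Type*} [CommRing S] [AddCommGroup E] [Module S E] {σ : R →+* S}
    (φ : N →ₛₗ[σ] E) {A : Matrix ι κ R} {v : κ → N} {w : ι → N} (h : IsMatrixOf A v w) :
    IsMatrixOf (A.map σ) (fun j => φ (v j)) (fun i => φ (w i)) := by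
  intro j
  simp only [h j, map_sum, map_smulₛₗ, Matrix.map_apply]

lemma IsMatrixOf.isUnit_det [DecidableEq ι] {A : Matrix ι ι R} {v w : ι → N}
    (hw : LinearIndependent R w) (h : IsMatrixOf A v w)
    (hs : ∀ j, w j ∈ Submodule.span R (Set.range v)) : IsUnit A.det := by
  obtain ⟨B, hB⟩ := exists_isMatrixOf hs
  rw [← Matrix.isUnit_iff_isUnit_det]
  exact IsUnit.of_mul_eq_one B ((hB.mul h).unique hw (isMatrixOf_one w))

lemma IsMatrixOf.linearIndependent_of_isUnit [DecidableEq ι] {A : Matrix ι ι R} {v w : ι → N}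
    (hw : LinearIndependent R w) (h : IsMatrixOf A v w) (hA : IsUnit A.det) :
    LinearIndependent R v := by
  rw [Fintype.linearIndependent_iff]
  intro c hc
  have h1 : ∑ i, (A.mulVec c) i • w i = 0 := by
    rw [← hc]
    simp_rw [h _, Finset.smul_sum, Matrix.mulVec, dotProduct, Finset.sum_smul, smul_smul]
    rw [Finset.sum_comm]
    simp_rw [mul_comm]
  have h2 : A.mulVec c = 0 := funext (Fintype.linearIndependent_iff.1 hw _ h1)
  have h3 := congrArg (A⁻¹).mulVec h2
  rw [Matrix.mulVec_mulVec, Matrix.nonsing_inv_mul _ hA, Matrix.one_mulVec,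
    Matrix.mulVec_zero] at h3
  exact congrFun h3

lemma IsMatrixOf.symm_of_isUnit [DecidableEq ι] {A : Matrix ι ι R} {v w : ι → N}
    (h : IsMatrixOf A v w) (hA : IsUnit A.det) : IsMatrixOf A⁻¹ w v := by
  intro j
  simp_rw [h _, Finset.smul_sum, smul_smul]
  rw [Finset.sum_comm]
  have : ∀ i, ∑ x, (A⁻¹ x j * A i x) • w i = (1 : Matrix ι ι R) i j • w i := by
    intro i
    rw [← Finset.sum_smul, ← Matrix.mul_nonsing_inv _ hA, Matrix.mul_apply]
    simp_rw [mul_comm]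
  simp_rw [this]
  exact (isMatrixOf_one (R := R) w j)

end Families

/-- The family `g` is a basis of the submodule `P`. -/
structure IsBasisOf {R N ι : Type*} [CommRing R] [AddCommGroup N] [Module R N]
    (g : ι → N) (P : Submodule R N) : Prop where
  linearIndependent : LinearIndependent R g
  span_eq : Submodule.span R (Set.range g) = P

namespace IsBasisOf

variable {R N ι : Type*} [CommRing R] [AddCommGroup N] [Module R N] {g : ι → N}
  {P : Submodule R N}

lemma mem (h : IsBasisOf g P) (i : ι) : g i ∈ P :=
  h.span_eq ▸ Submodule.subset_span ⟨i, rfl⟩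

/-- The basis of `P` given by `g`. -/
noncomputable def basis (h : IsBasisOf g P) : Module.Basis ι R P :=
  (Module.Basis.span h.linearIndependent).map (LinearEquiv.ofEq _ _ h.span_eq)

lemma coe_basis (h : IsBasisOf g P) (i : ι) : (h.basis i : N) = g i := by
  simp [basis, Module.Basis.span_apply]

lemma of_basis (b : Module.Basis ι R P) : IsBasisOf (fun i => (b i : N)) P := by
  constructor
  · exact b.linearIndependent.map' P.subtype P.ker_subtype
  · have h := congrArg (Submodule.map P.subtype) b.span_eq
    rw [Submodule.map_span, Submodule.map_subtype_top, ← Set.range_comp] at h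
    exact h

lemma comp_equiv {κ : Type*} (h : IsBasisOf g P) (e : κ ≃ ι) : IsBasisOf (g ∘ e) P :=
  ⟨h.linearIndependent.comp e e.injective, by rw [Set.range_comp, e.range_eq_univ, Set.image_univ,
    h.span_eq]⟩

lemma finrank_eq [Nontrivial R] [Fintype ι] (h : IsBasisOf g P) :
    Module.finrank R P = Fintype.card ι :=
  Module.finrank_eq_card_basis h.basis

end IsBasisOf

/-! ### Saturated submodules over principal ideal domains -/

section Saturated

variable {O M : Type*} [CommRing O] [IsDomain O] [IsPrincipalIdealRing O]
  [AddCommGroup M] [Module O M] [Module.Finite O M]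

/-- A basis of a saturated submodule `P` extends to a basis of any larger submodule. -/
lemma exists_isBasisOf_extension {ι κ : Type*} [Fintype ι] [Fintype κ] {P Q : Submodule O M}
    (hPQ : P ≤ Q) (hP : ∀ (a : O) (m : M), a ≠ 0 → a • m ∈ P → m ∈ P) {g : ι → M}
    (hg : IsBasisOf g P) (hc : Fintype.card ι + Fintype.card κ = Module.finrank O Q) :
    ∃ h : κ → M, IsBasisOf (Sum.elim g h) Q := by
  classical
  let P' : Submodule O Q := P.comap Q.subtype
  have hg' : ∀ i, (⟨g i, hPQ (hg.mem i)⟩ : Q) ∈ P' := fun i => hg.mem i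
  have hbP : IsBasisOf (fun i => (⟨g i, hPQ (hg.mem i)⟩ : Q)) P' := by
    constructor
    · exact LinearIndependent.of_comp Q.subtype hg.linearIndependent
    · apply Submodule.map_injective_of_injective Q.subtype_injective
      rw [Submodule.map_span, ← Set.range_comp, Submodule.map_comap_subtype,
        inf_eq_right.2 hPQ]
      exact hg.span_eq
  -- Saturation of `P` makes `Q / P` torsion-free, hence free over a principal ideal domain, so the
  -- inclusion splits and a basis of the quotient lifts.
  have : Module.IsTorsionFree O (Q ⧸ P') := by
    rw [Module.isTorsionFree_iff_smul_eq_zero]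
    intro a z h
    obtain ⟨z, rfl⟩ := P'.mkQ_surjective z
    by_cases ha : a = 0
    · exact Or.inl ha
    · right
      rw [← map_smul, Submodule.mkQ_apply, Submodule.Quotient.mk_eq_zero] at h
      rw [Submodule.mkQ_apply, Submodule.Quotient.mk_eq_zero]
      exact hP a z ha h
  have hfr : Module.finrank O (Q ⧸ P') = Fintype.card κ := by
    have h := Submodule.finrank_quotient_add_finrank P'
    rw [hbP.finrank_eq] at h
    omega
  let bQ : Module.Basis κ O (Q ⧸ P') :=
    (Module.finBasis O (Q ⧸ P')).reindex (Fintype.equivOfCardEq (by simp [hfr]))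
  let b := Module.Basis.sumQuot hbP.basis bQ
  refine ⟨fun j => (b (Sum.inr j) : M), ?_⟩
  have hb := IsBasisOf.of_basis b
  convert hb using 1
  ext (i | j)
  · simp [b, Module.Basis.sumQuot_inl, hbP.coe_basis]
  · simp

end Saturated

/-! ### Lattices in a vector space over the fraction field -/

section Lattice

variable {O K M E : Type*} [CommRing O] [Field K] [Algebra O K]
  [AddCommGroup M] [Module O M] [AddCommGroup E] [Module K E]

/-- The semilinear map `φ : M → E` identifies `M` with a full lattice in `E`. -/
structure IsLatticeMap (φ : M →ₛₗ[algebraMap O K] E) : Prop where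
  injective : Function.Injective φ
  exists_smul : ∀ z : E, ∃ a : O, a ≠ 0 ∧ ∃ m, φ m = algebraMap O K a • z

variable {φ : M →ₛₗ[algebraMap O K] E}

variable [IsFractionRing O K]

lemma IsLatticeMap.linearIndependent {ι : Type*} (hφ : IsLatticeMap φ) {v : ι → M}
    (hv : LinearIndependent O v) : LinearIndependent K (fun i => φ (v i)) := by
  -- Viewing `E` as an `O`-module turns `φ` into a linear map, and independence over `O` and over
  -- its fraction field agree.
  let : Module O E := Module.compHom E (algebraMap O K)
  have : IsScalarTower O K E := ⟨fun a b c => by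
    change (a • b) • c = algebraMap O K a • (b • c)
    rw [Algebra.smul_def, mul_smul]⟩
  let φ' : M →ₗ[O] E :=
    { toFun := φ, map_add' := map_add φ, map_smul' := fun a m => map_smulₛₗ φ a m }
  rw [← LinearIndependent.iff_fractionRing O K]
  exact hv.map' φ' (LinearMap.ker_eq_bot.2 hφ.injective)

/-- Clearing denominators moves any vector of `W` into the lattice, so a basis of the lattice also
spans `W` over `K`. -/
lemma IsLatticeMap.isBasisOf {ι : Type*} (hφ : IsLatticeMap φ) {W : Submodule K E} {g : ι → M}
    (hg : IsBasisOf g (W.comap φ)) : IsBasisOf (fun i => φ (g i)) W := by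
  refine ⟨hφ.linearIndependent hg.linearIndependent, le_antisymm ?_ ?_⟩
  · rw [Submodule.span_le]
    rintro _ ⟨i, rfl⟩
    exact hg.mem i
  · intro z hz
    obtain ⟨a, ha, m, hm⟩ := hφ.exists_smul z
    have ha' : algebraMap O K a ≠ 0 := by
      simpa using (IsFractionRing.injective O K).ne ha
    have hmW : m ∈ W.comap φ := by
      change φ m ∈ W
      rw [hm]
      exact W.smul_mem _ hz
    rw [← hg.span_eq] at hmW
    have h1 : φ m ∈ Submodule.span K (Set.range fun i => φ (g i)) := by
      refine Submodule.span_induction (p := fun x _ => φ x ∈ _) ?_ ?_ ?_ ?_ hmW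
      · rintro _ ⟨i, rfl⟩
        exact Submodule.subset_span ⟨i, rfl⟩
      · simp
      · intro x y _ _ hx hy
        rw [map_add]
        exact add_mem hx hy
      · intro b x _ hx
        rw [map_smulₛₗ]
        exact Submodule.smul_mem _ _ hx
    rw [hm] at h1
    exact (Submodule.smul_mem_iff _ ha').1 h1

/-- Nonzero scalars become invertible in `K`. This saturation is what allows bases of `W.comap φ` to
be extended. -/
lemma mem_comap_of_smul_mem (W : Submodule K E) (a : O) (m : M) (ha : a ≠ 0)
    (h : a • m ∈ W.comap φ) : m ∈ W.comap φ := by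
  have ha' : algebraMap O K a ≠ 0 := by
    simpa using (IsFractionRing.injective O K).ne ha
  rw [Submodule.mem_comap, map_smulₛₗ] at h
  exact (W.smul_mem_iff ha').1 h

/-- The properties of the order function of a discrete valuation ring that are used for degrees. -/
structure IsOrder (O : Type*) {K : Type*} [CommRing O] [Field K] [Algebra O K] (ord : K → ℤ) :
    Prop where
  map_mul : ∀ {x y : K}, x ≠ 0 → y ≠ 0 → ord (x * y) = ord x + ord y
  of_isUnit : ∀ {a : O}, IsUnit a → ord (algebraMap O K a) = 0
  of_not_isUnit : ∀ {a : O}, a ≠ 0 → ¬ IsUnit a → 1 ≤ ord (algebraMap O K a)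

omit [IsFractionRing O K] in
lemma IsOrder.map_prod {ord : K → ℤ} (h : IsOrder O ord) {ι : Type*} (s : Finset ι) (f : ι → K)
    (hf : ∀ i, f i ≠ 0) : ord (∏ i ∈ s, f i) = ∑ i ∈ s, ord (f i) := by
  classical
  induction s using Finset.induction_on with
  | empty => simpa using h.of_isUnit (a := (1 : O)) isUnit_one
  | insert i s hi ih =>
    rw [Finset.prod_insert hi, Finset.sum_insert hi,
      h.map_mul (hf i) (Finset.prod_ne_zero_iff.2 fun j _ => hf j), ih]

/-- `n` is the order of the determinant of the family `b` with respect to a basis of the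
lattice `L`. -/
def HasLatticeOrd (φ : M →ₛₗ[algebraMap O K] E) (ord : K → ℤ) {ι : Type*} [Fintype ι]
    [DecidableEq ι] (L : Submodule O M) (b : ι → E) (n : ℤ) : Prop :=
  ∃ (g : ι → M) (A : Matrix ι ι K), IsBasisOf g L ∧ IsMatrixOf A b (fun i => φ (g i)) ∧
    n = ord A.det

variable {ord : K → ℤ} {ι : Type*} [Fintype ι] [DecidableEq ι]

omit [IsFractionRing O K] in
lemma ne_zero_det_of_isMatrixOf {A : Matrix ι ι K} {v w : ι → E} {W : Submodule K E}
    (hv : IsBasisOf v W) (hw : IsBasisOf w W) (h : IsMatrixOf A v w) : A.det ≠ 0 :=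
  (h.isUnit_det hw.1 fun j => by rw [hv.2]; exact hw.mem j).ne_zero

/-- The order does not depend on the basis of the lattice. -/
lemma HasLatticeOrd.eq_of_isBasisOf (hφ : IsLatticeMap φ) (hord : IsOrder O ord)
    {W : Submodule K E} {b : ι → E} {n : ℤ} (hb : IsBasisOf b W)
    (h : HasLatticeOrd φ ord (W.comap φ) b n) {g : ι → M} {A : Matrix ι ι K}
    (hg : IsBasisOf g (W.comap φ)) (hA : IsMatrixOf A b (fun i => φ (g i))) : n = ord A.det := by
  obtain ⟨g', A', hg', hA', rfl⟩ := h
  obtain ⟨U, hU⟩ := exists_isMatrixOf (v := g') (w := g) (R := O)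
    fun j => by rw [hg.span_eq]; exact hg'.mem j
  have hUd := hU.isUnit_det hg.1 fun j => by rw [hg'.span_eq]; exact hg.mem j
  have hgE := hφ.isBasisOf hg
  have hgE' := hφ.isBasisOf hg'
  have e := hA.unique hgE.1 (hA'.mul (hU.map φ))
  have hd : A.det = algebraMap O K U.det * A'.det := by
    rw [e, Matrix.det_mul, ← RingHom.mapMatrix_apply, ← RingHom.map_det]
  rw [hd, hord.map_mul (hUd.map _).ne_zero (ne_zero_det_of_isMatrixOf hb hgE' hA'),
    hord.of_isUnit hUd, zero_add]

/-- The effect of a change of the basis of the vector space. -/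
lemma HasLatticeOrd.of_isMatrixOf (hφ : IsLatticeMap φ) (hord : IsOrder O ord)
    {W : Submodule K E} {b c : ι → E} {m n : ℤ} (hb : IsBasisOf b W) (hc : IsBasisOf c W)
    {T : Matrix ι ι K} (hT : IsMatrixOf T c b)
    (hm : HasLatticeOrd φ ord (W.comap φ) b m) (hn : HasLatticeOrd φ ord (W.comap φ) c n) :
    n = m + ord T.det := by
  obtain ⟨g, A, hg, hA, rfl⟩ := hm
  rw [hn.eq_of_isBasisOf hφ hord hc hg (hT.mul hA), Matrix.det_mul,
    hord.map_mul (ne_zero_det_of_isMatrixOf hb (hφ.isBasisOf hg) hA)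
      (ne_zero_det_of_isMatrixOf hc hb hT)]

variable [IsDomain O] [IsPrincipalIdealRing O] [Module.Free O M] [Module.Finite O M]

lemma exists_isBasisOf_comap (hφ : IsLatticeMap φ) {W : Submodule K E} {ι : Type*} [Fintype ι]
    (hι : Module.finrank K W = Fintype.card ι) : ∃ g : ι → M, IsBasisOf g (W.comap φ) := by
  have hb := IsBasisOf.of_basis (Module.finBasis O (W.comap φ))
  have h := (hφ.isBasisOf hb).finrank_eq
  exact ⟨_, hb.comp_equiv (Fintype.equivOfCardEq (h.symm.trans hι).symm)⟩

lemma finrank_comap (hφ : IsLatticeMap φ) (W : Submodule K E) :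
    Module.finrank O (W.comap φ) = Module.finrank K W := by
  have hb := IsBasisOf.of_basis (Module.finBasis O (W.comap φ))
  rw [(hφ.isBasisOf hb).finrank_eq, Fintype.card_fin]

omit [Module.Free O M] in
/-- A basis of the lattice of a subspace is part of a basis of the whole lattice. -/
lemma exists_isBasisOf_top (W : Submodule K E) {ι : Type*} [Fintype ι] {g : ι → M}
    (hg : IsBasisOf g (W.comap φ)) :
    ∃ (m : ℕ) (h : Fin m → M), IsBasisOf (Sum.elim g h) (⊤ : Submodule O M) := by
  have hle : Fintype.card ι ≤ Module.finrank O (⊤ : Submodule O M) := by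
    rw [finrank_top]
    exact hg.linearIndependent.fintype_card_le_finrank
  obtain ⟨h, hh⟩ := exists_isBasisOf_extension (κ := Fin (Module.finrank O (⊤ : Submodule O M) -
    Fintype.card ι)) le_top (mem_comap_of_smul_mem W) hg
    (by rw [Fintype.card_fin]; omega)
  exact ⟨_, h, hh⟩

variable (κ : Type*) [Field κ] [Algebra O κ]

omit [Module.Free O M] in
/-- The fibres of a saturated sublattice have the expected dimension. -/
lemma isBasisOf_baseChange (W : Submodule K E) {ι : Type*} [Fintype ι] {g : ι → M}
    (hg : IsBasisOf g (W.comap φ)) :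
    IsBasisOf (fun i => (1 : κ) ⊗ₜ[O] g i) ((W.comap φ).baseChange κ) := by
  -- Independence of the tensors is inherited from a basis of all of `M`; it can fail for a
  -- sublattice that is not saturated.
  obtain ⟨m, h, hh⟩ := exists_isBasisOf_top W hg
  constructor
  · let b : Module.Basis (ι ⊕ Fin m) O M := Module.Basis.mk hh.1 hh.2.ge
    have h1 := (b.baseChange κ).linearIndependent.comp Sum.inl Sum.inl_injective
    have h2 : (b.baseChange κ) ∘ Sum.inl = fun i => (1 : κ) ⊗ₜ[O] g i := by
      ext i
      simp [b]
    rwa [h2] at h1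
  · rw [← hg.span_eq, Submodule.baseChange_span, ← Set.range_comp]
    rfl

lemma finrank_baseChange (hφ : IsLatticeMap φ) (W : Submodule K E) :
    Module.finrank κ ((W.comap φ).baseChange κ) = Module.finrank K W := by
  have hb := IsBasisOf.of_basis (Module.finBasis O (W.comap φ))
  rw [(isBasisOf_baseChange κ W hb).finrank_eq, Fintype.card_fin, finrank_comap hφ]

end Lattice

/-! ### The sum of two saturated lattices -/

section LatticeSum

variable {O K M E : Type*} [CommRing O] [Field K] [Algebra O K]
  [AddCommGroup M] [Module O M] [AddCommGroup E] [Module K E]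
  {φ : M →ₛₗ[algebraMap O K] E} [IsFractionRing O K]
  {ord : K → ℤ} [IsDomain O] [IsPrincipalIdealRing O] [Module.Free O M] [Module.Finite O M]

lemma IsOrder.nonneg {O K : Type*} [CommRing O] [Field K] [Algebra O K] {ord : K → ℤ}
    (hord : IsOrder O ord) {a : O} (ha : a ≠ 0) : 0 ≤ ord (algebraMap O K a) := by
  by_cases h : IsUnit a
  · exact (hord.of_isUnit h).ge
  · exact zero_le_one.trans (hord.of_not_isUnit ha h)

/-- The order of the determinant of a full sublattice `N` of a saturated lattice bounds the corank
of `N` in the fibre. -/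
lemma IsOrder.det_sublattice (hord : IsOrder O ord) {ι : Type*} [Fintype ι] [DecidableEq ι]
    (W : Submodule K E) {N : Submodule O M} (hNQ : N ≤ W.comap φ) {v w : ι → M}
    (hv : IsBasisOf v N) (hw : IsBasisOf w (W.comap φ)) {B : Matrix ι ι O}
    (hB : IsMatrixOf B v w) (κ : Type*) [Field κ] [Algebra O κ] :
    0 ≤ ord (algebraMap O K B.det) ∧
    (Module.finrank κ ((W.comap φ).baseChange κ) : ℤ) ≤
      Module.finrank κ (N.baseChange κ) + ord (algebraMap O K B.det) ∧
    (ord (algebraMap O K B.det) = 0 → N = W.comap φ) := by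
  let N' : Submodule O (W.comap φ) := N.comap (W.comap φ).subtype
  have hN' : IsBasisOf (fun i => (⟨v i, hNQ (hv.mem i)⟩ : W.comap φ)) N' := by
    constructor
    · exact LinearIndependent.of_comp (W.comap φ).subtype hv.linearIndependent
    · apply Submodule.map_injective_of_injective (W.comap φ).subtype_injective
      rw [Submodule.map_span, ← Set.range_comp, Submodule.map_comap_subtype, inf_eq_right.2 hNQ]
      exact hv.span_eq
  -- Smith normal form: a basis `b` of the saturated lattice such that the multiples `a i • b i`
  -- form a basis of `N`.
  obtain ⟨b, a, ab, hab⟩ := Submodule.exists_smith_normal_form_of_rank_eq hw.basis (N := N')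
    (by rw [hN'.finrank_eq, hw.finrank_eq])
  have ha : ∀ i, a i ≠ 0 := by
    intro i h0
    have h1 := hab i
    rw [h0, zero_smul, Submodule.coe_eq_zero] at h1
    exact ab.ne_zero i h1
  have hb := IsBasisOf.of_basis b
  have hab' : IsBasisOf (fun i => a i • (b i : M)) N := by
    have h1 := IsBasisOf.of_basis ab
    simp_rw [hab] at h1
    refine ⟨h1.1.map' (W.comap φ).subtype (Submodule.ker_subtype _), ?_⟩
    have h2 := congrArg (Submodule.map (W.comap φ).subtype) h1.2
    rw [Submodule.map_span, ← Set.range_comp, Submodule.map_comap_subtype,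
      inf_eq_right.2 hNQ] at h2
    exact h2
  obtain ⟨U, hU⟩ := exists_isMatrixOf (v := v) (w := fun i => a i • (b i : M)) (R := O)
    fun j => by rw [hab'.span_eq]; exact hv.mem j
  obtain ⟨T, hT⟩ := exists_isMatrixOf (v := fun i => (b i : M)) (w := w) (R := O)
    fun j => by rw [hw.span_eq]; exact hb.mem j
  have hUd := hU.isUnit_det hab'.1 fun j => by rw [hv.span_eq]; exact hab'.mem j
  have hTd := hT.isUnit_det hw.1 fun j => by rw [hb.span_eq]; exact hw.mem j
  have hD : IsMatrixOf (Matrix.diagonal a) (fun i => a i • (b i : M)) (fun i => (b i : M)) := by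
    intro j
    simp [Matrix.diagonal_apply]
  -- `T` and `U` are invertible over `O`, so only the elementary divisors `a i` contribute to the
  -- order of the determinant.
  have hBe : B = T * (Matrix.diagonal a * U) := hB.unique hw.1 ((hU.mul hD).mul hT)
  have hordB : ord (algebraMap O K B.det) = ∑ i, ord (algebraMap O K (a i)) := by
    have hinj := IsFractionRing.injective O K
    have ha' : ∀ i, algebraMap O K (a i) ≠ 0 := fun i => by simpa using hinj.ne (ha i)
    have hp : algebraMap O K (∏ i, a i) ≠ 0 := by
      rw [_root_.map_prod]
      exact Finset.prod_ne_zero_iff.2 fun i _ => ha' i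
    rw [hBe, Matrix.det_mul, Matrix.det_mul, Matrix.det_diagonal, _root_.map_mul, _root_.map_mul,
      hord.map_mul (hTd.map _).ne_zero (mul_ne_zero hp (hUd.map _).ne_zero),
      hord.map_mul hp (hUd.map _).ne_zero, hord.of_isUnit hTd, hord.of_isUnit hUd, _root_.map_prod,
      hord.map_prod _ _ ha']
    ring
  have hnn : ∀ i, 0 ≤ ord (algebraMap O K (a i)) := fun i => hord.nonneg (ha i)
  have hmem : ∀ i, IsUnit (a i) → (b i : M) ∈ N := by
    intro i hi
    obtain ⟨u, hu⟩ := hi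
    have h1 := N.smul_mem ((u⁻¹ : Oˣ) : O) (hab'.mem i)
    rwa [smul_smul, ← hu, Units.inv_mul, one_smul] at h1
  rw [hordB]
  refine ⟨Finset.sum_nonneg fun i _ => hnn i, ?_, ?_⟩
  · classical
    have hκ := isBasisOf_baseChange κ W hb
    rw [hκ.finrank_eq]
    let s : Type _ := {i // IsUnit (a i)}
    -- Each unit `a i` puts `b i` into `N` and so gives one dimension in the fibre; each of the
    -- other indices adds at least one to the order.
    have h1 : Fintype.card s ≤ Module.finrank κ (N.baseChange κ) := by
      have hli : LinearIndependent κ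
          (fun i : s => (1 : κ) ⊗ₜ[O] (b i.1 : M)) := hκ.1.comp _ Subtype.val_injective
      have hmem' : ∀ i : s, (1 : κ) ⊗ₜ[O] (b i.1 : M) ∈ N.baseChange κ := fun i =>
        Submodule.tmul_mem_baseChange_of_mem _ (hmem i.1 i.2)
      have h2 : LinearIndependent κ (fun i : s => (⟨_, hmem' i⟩ : N.baseChange κ)) :=
        LinearIndependent.of_comp (N.baseChange κ).subtype hli
      exact h2.fintype_card_le_finrank
    have h3 : (Fintype.card ι : ℤ) ≤ Fintype.card s + ∑ i, ord (algebraMap O K (a i)) := by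
      have h4 : (Fintype.card s : ℤ) = ∑ i, if IsUnit (a i) then (1 : ℤ) else 0 := by
        rw [Finset.sum_boole, Fintype.card_subtype]
      have h5 : (Fintype.card ι : ℤ) = ∑ _i : ι, (1 : ℤ) := by simp
      rw [h4, h5, ← Finset.sum_add_distrib]
      refine Finset.sum_le_sum fun i _ => ?_
      split_ifs with h
      · linarith [hnn i]
      · linarith [hord.of_not_isUnit (ha i) h]
    have : (Fintype.card s : ℤ) ≤ Module.finrank κ (N.baseChange κ) := by exact_mod_cast h1
    linarith
  · intro h0
    refine le_antisymm hNQ ?_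
    rw [← hb.span_eq, Submodule.span_le]
    rintro _ ⟨i, rfl⟩
    refine hmem i ?_
    by_contra hu
    have := hord.of_not_isUnit (ha i) hu
    have := (Finset.sum_eq_zero_iff_of_nonneg fun i _ => hnn i).1 h0 i (Finset.mem_univ _)
    omega

lemma IsBasisOf.elim_sup {R N ι κ μ : Type*} [CommRing R] [AddCommGroup N] [Module R N]
    {f : ι → N} {g : κ → N} {h : μ → N} {P Q : Submodule R N}
    (hP : Submodule.span R (Set.range (Sum.elim f g)) = P)
    (hQ : Submodule.span R (Set.range (Sum.elim f h)) = Q) :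
    Submodule.span R (Set.range (Sum.elim (Sum.elim f g) h)) = P ⊔ Q := by
  subst hP hQ
  simp only [Set.Sum.elim_range, Submodule.span_union]
  rw [sup_sup_sup_comm, sup_idem, sup_assoc]

/-- Compatible bases of the intersection and the sum of two subspaces. -/
lemma linearIndependent_elim_elim {k N ι κ μ : Type*} [Field k] [AddCommGroup N] [Module k N]
    [Fintype ι] [Fintype κ] [Fintype μ]
    {f : ι → N} {g : κ → N} {h : μ → N} {P Q : Submodule k N}
    (hP : IsBasisOf (Sum.elim f g) P) (hQ : IsBasisOf (Sum.elim f h) Q)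
    (hI : IsBasisOf f (P ⊓ Q)) :
    LinearIndependent k (Sum.elim (Sum.elim f g) h) := by
  have : Module.Finite k P := Module.Finite.of_basis hP.basis
  have : Module.Finite k Q := Module.Finite.of_basis hQ.basis
  rw [linearIndependent_iff_card_eq_finrank_span]
  have h1 := Submodule.finrank_sup_add_finrank_inf_eq P Q
  rw [hP.finrank_eq, hQ.finrank_eq, hI.finrank_eq] at h1
  rw [Set.finrank, IsBasisOf.elim_sup hP.2 hQ.2]
  simp only [Fintype.card_sum] at h1 ⊢
  omega

/-- The comparison of the four lattices given by two subspaces, their intersection and their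
sum. -/
theorem exists_latticeOrd_sup_inf (hφ : IsLatticeMap φ) (hord : IsOrder O ord)
    (W₁ W₂ : Submodule K E) {ι μ ν : Type*} [Fintype ι] [Fintype μ] [Fintype ν]
    [DecidableEq ι] [DecidableEq μ] [DecidableEq ν] {f : ι → E} {c₁ : μ → E} {c₂ : ν → E}
    (h₁ : IsBasisOf (Sum.elim f c₁) W₁) (h₂ : IsBasisOf (Sum.elim f c₂) W₂)
    (hI : IsBasisOf f (W₁ ⊓ W₂)) (κ : Type*) [Field κ] [Algebra O κ] :
    ∃ nI n₁ n₂ nS l : ℤ, HasLatticeOrd φ ord ((W₁ ⊓ W₂).comap φ) f nI ∧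
      HasLatticeOrd φ ord (W₁.comap φ) (Sum.elim f c₁) n₁ ∧
      HasLatticeOrd φ ord (W₂.comap φ) (Sum.elim f c₂) n₂ ∧
      HasLatticeOrd φ ord ((W₁ ⊔ W₂).comap φ) (Sum.elim (Sum.elim f c₁) c₂) nS ∧
      0 ≤ l ∧ nS + nI = n₁ + n₂ + l ∧
      (Module.finrank κ (((W₁ ⊔ W₂).comap φ).baseChange κ) : ℤ) ≤
        Module.finrank κ ((W₁.comap φ ⊔ W₂.comap φ).baseChange κ) + l ∧
      (l = 0 → W₁.comap φ ⊔ W₂.comap φ = (W₁ ⊔ W₂).comap φ) := by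
  -- A basis of the intersection lattice is extended separately to both lattices, so that all the
  -- coordinate matrices below share the block `AI`.
  obtain ⟨gI, hgI⟩ := exists_isBasisOf_comap hφ (ι := ι) hI.finrank_eq
  have hsat := mem_comap_of_smul_mem (φ := φ) (W₁ ⊓ W₂)
  obtain ⟨g₁, hg₁⟩ := exists_isBasisOf_extension (κ := μ)
    (Submodule.comap_mono (f := φ) inf_le_left : _ ≤ W₁.comap φ) hsat hgI
    (by rw [finrank_comap hφ, h₁.finrank_eq, Fintype.card_sum])
  obtain ⟨g₂, hg₂⟩ := exists_isBasisOf_extension (κ := ν)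
    (Submodule.comap_mono (f := φ) inf_le_right : _ ≤ W₂.comap φ) hsat hgI
    (by rw [finrank_comap hφ, h₂.finrank_eq, Fintype.card_sum])
  have hgIE := hφ.isBasisOf hgI
  have hg₁E := hφ.isBasisOf hg₁
  have hg₂E := hφ.isBasisOf hg₂
  have hel₁ : (fun i => φ (Sum.elim gI g₁ i)) =
      Sum.elim (fun i => φ (gI i)) (fun i => φ (g₁ i)) := by ext (i | i) <;> rfl
  have hel₂ : (fun i => φ (Sum.elim gI g₂ i)) =
      Sum.elim (fun i => φ (gI i)) (fun i => φ (g₂ i)) := by ext (i | i) <;> rfl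
  have helS : (fun i => φ (Sum.elim (Sum.elim gI g₁) g₂ i)) =
      Sum.elim (Sum.elim (fun i => φ (gI i)) (fun i => φ (g₁ i))) (fun i => φ (g₂ i)) := by
    ext ((i | i) | i) <;> rfl
  rw [hel₁] at hg₁E
  rw [hel₂] at hg₂E
  obtain ⟨AI, hAI⟩ := exists_isMatrixOf (v := f) (w := fun i => φ (gI i)) (R := K)
    fun j => by rw [hgIE.span_eq]; exact hI.mem j
  obtain ⟨A₁, hA₁⟩ := exists_isMatrixOf (v := c₁) (w := Sum.elim (fun i => φ (gI i))
    (fun i => φ (g₁ i))) (R := K) fun j => by rw [hg₁E.span_eq]; exact h₁.mem (Sum.inr j)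
  obtain ⟨A₂, hA₂⟩ := exists_isMatrixOf (v := c₂) (w := Sum.elim (fun i => φ (gI i))
    (fun i => φ (g₂ i))) (R := K) fun j => by rw [hg₂E.span_eq]; exact h₂.mem (Sum.inr j)
  let B₁ : Matrix (ι ⊕ μ) (ι ⊕ μ) K := Matrix.fromBlocks AI A₁.toRows₁ 0 A₁.toRows₂
  let B₂ : Matrix (ι ⊕ ν) (ι ⊕ ν) K := Matrix.fromBlocks AI A₂.toRows₁ 0 A₂.toRows₂
  -- The vectors `c₂` involve only `gI` and `g₂`, hence the zero rows at the position of `g₁`.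
  let BS : Matrix ((ι ⊕ μ) ⊕ ν) ((ι ⊕ μ) ⊕ ν) K :=
    Matrix.fromBlocks B₁ (Matrix.fromRows A₂.toRows₁ 0) 0 A₂.toRows₂
  have hB₁ : IsMatrixOf B₁ (Sum.elim f c₁) (fun i => φ (Sum.elim gI g₁ i)) := by
    rw [hel₁]
    rintro (j | j)
    · simpa [B₁] using hAI j
    · simpa [B₁] using hA₁ j
  have hB₂ : IsMatrixOf B₂ (Sum.elim f c₂) (fun i => φ (Sum.elim gI g₂ i)) := by
    rw [hel₂]
    rintro (j | j)
    · simpa [B₂] using hAI j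
    · simpa [B₂] using hA₂ j
  have hBS : IsMatrixOf BS (Sum.elim (Sum.elim f c₁) c₂)
      (fun i => φ (Sum.elim (Sum.elim gI g₁) g₂ i)) := by
    rw [helS]
    rintro ((j | j) | j)
    · simpa [BS, B₁] using hAI j
    · simpa [BS, B₁] using hA₁ j
    · simpa [BS] using hA₂ j
  have hdet : BS.det * AI.det = B₁.det * B₂.det := by
    simp only [BS, B₂, Matrix.det_fromBlocks_zero₂₁]
    ring
  have hbS : IsBasisOf (Sum.elim (Sum.elim f c₁) c₂) (W₁ ⊔ W₂) :=
    ⟨linearIndependent_elim_elim h₁ h₂ hI, IsBasisOf.elim_sup h₁.2 h₂.2⟩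
  have hgSE : IsBasisOf (fun i => φ (Sum.elim (Sum.elim gI g₁) g₂ i)) (W₁ ⊔ W₂) := by
    rw [helS]
    exact ⟨linearIndependent_elim_elim hg₁E hg₂E hgIE, IsBasisOf.elim_sup hg₁E.2 hg₂E.2⟩
  have hv : IsBasisOf (Sum.elim (Sum.elim gI g₁) g₂) (W₁.comap φ ⊔ W₂.comap φ) := by
    refine ⟨?_, IsBasisOf.elim_sup hg₁.2 hg₂.2⟩
    rw [Fintype.linearIndependent_iff]
    intro a ha i
    have h0 := congrArg φ ha
    simp only [map_sum, map_smulₛₗ, map_zero] at h0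
    have := Fintype.linearIndependent_iff.1 hgSE.1 _ h0 i
    exact (map_eq_zero_iff _ (IsFractionRing.injective O K)).1 this
  obtain ⟨w, hw⟩ := exists_isBasisOf_comap hφ (ι := (ι ⊕ μ) ⊕ ν) hbS.finrank_eq
  have hNQ : W₁.comap φ ⊔ W₂.comap φ ≤ (W₁ ⊔ W₂).comap φ :=
    sup_le (Submodule.comap_mono le_sup_left) (Submodule.comap_mono le_sup_right)
  -- `B` compares the sum of the two lattices with its saturation; the number `l` is the order of
  -- its determinant.
  obtain ⟨B, hB⟩ := exists_isMatrixOf (v := Sum.elim (Sum.elim gI g₁) g₂) (w := w) (R := O)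
    fun j => by rw [hw.span_eq]; exact hNQ (hv.mem j)
  obtain ⟨hl, hrank, heq⟩ := hord.det_sublattice _ hNQ hv hw hB κ
  refine ⟨_, _, _, _, ord (algebraMap O K B.det), ⟨gI, AI, hgI, hAI, rfl⟩,
    ⟨_, B₁, hg₁, hB₁, rfl⟩, ⟨_, B₂, hg₂, hB₂, rfl⟩, ⟨w, _, hw, hBS.mul (hB.map φ), rfl⟩, hl, ?_,
    hrank, heq⟩
  have hAI0 := ne_zero_det_of_isMatrixOf hI hgIE hAI
  have hB₁0 := ne_zero_det_of_isMatrixOf h₁ (hφ.isBasisOf hg₁) hB₁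
  have hB₂0 := ne_zero_det_of_isMatrixOf h₂ (hφ.isBasisOf hg₂) hB₂
  have hBS0 := ne_zero_det_of_isMatrixOf hbS hgSE hBS
  have hBd : algebraMap O K B.det ≠ 0 := by
    have := ne_zero_det_of_isMatrixOf hgSE (hφ.isBasisOf hw) (hB.map φ)
    rwa [← RingHom.mapMatrix_apply, ← RingHom.map_det] at this
  have h3 := congrArg ord hdet
  rw [hord.map_mul hBS0 hAI0, hord.map_mul hB₁0 hB₂0] at h3
  rw [Matrix.det_mul, ← RingHom.mapMatrix_apply, ← RingHom.map_det, hord.map_mul hBd hBS0]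
  linarith

end LatticeSum

/-! ### Weights of flags -/

section AbelSummation

/-- Summation by parts turns the right-hand side into a combination of the `δ j` with coefficients
`α 0` and the increments of `α`, all nonnegative, apart from the last `δ`, whose coefficient is
minus the greatest `α`. The induction peels off the last term. -/
lemma neg_mul_last_le_sum {l : ℕ} (α : Fin l → ℚ) (δ : Fin (l + 1) → ℚ) (c : ℚ)
    (hα : ∀ j, 0 ≤ α j) (hmono : Monotone α) (hc : ∀ j, α j ≤ c) (hc0 : 0 ≤ c)
    (hδ : ∀ j, 0 ≤ δ j) :
    -(c * δ (Fin.last l)) ≤ ∑ j, α j * (δ j.castSucc - δ j.succ) := by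
  induction l generalizing c with
  | zero =>
    have := mul_nonneg hc0 (hδ (Fin.last 0))
    simpa using this
  | succ l ih =>
    rw [Fin.sum_univ_castSucc]
    have h1 := ih (fun j => α j.castSucc) (fun j => δ j.castSucc) (α (Fin.last l))
      (fun j => hα _) (fun i j h => hmono (Fin.castSucc_le_castSucc_iff.2 h))
      (fun j => hmono (Fin.le_last _)) (hα _) (fun j => hδ _)
    simp only [Fin.succ_last, ← Fin.succ_castSucc] at h1 ⊢
    have h2 := mul_le_mul_of_nonneg_right (hc (Fin.last l)) (hδ (Fin.last (l + 1)))
    linarith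

/-- After summation by parts every `δ j` beyond the first has a strictly positive coefficient. The
first has coefficient `α 0` when there is a step, and this may be zero; hence the separate
hypothesis on `δ 0`. -/
lemma eq_zero_of_sum_le {l : ℕ} (α : Fin l → ℚ) (δ : Fin (l + 1) → ℚ) (c : ℚ)
    (hα : ∀ j, 0 ≤ α j) (hmono : StrictMono α) (hc : ∀ j, α j < c)
    (hδ : ∀ j, 0 ≤ δ j) (hδ0 : δ 0 = 0)
    (h : ∑ j, α j * (δ j.castSucc - δ j.succ) + c * δ (Fin.last l) ≤ 0) : ∀ j, δ j = 0 := by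
  induction l generalizing c with
  | zero =>
    intro j
    rwa [Fin.fin_one_eq_zero j]
  | succ l ih =>
    rw [Fin.sum_univ_castSucc] at h
    have h1 := neg_mul_last_le_sum (fun j => α j.castSucc) (fun j => δ j.castSucc) (α (Fin.last l))
      (fun j => hα _) (fun i j h => hmono.monotone (Fin.castSucc_le_castSucc_iff.2 h))
      (fun j => hmono.monotone (Fin.le_last _)) (hα _) (fun j => hδ _)
    simp only [Fin.succ_last, ← Fin.succ_castSucc] at h1 h
    have h2 : 0 ≤ (c - α (Fin.last l)) * δ (Fin.last (l + 1)) :=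
      mul_nonneg (sub_nonneg.2 (hc _).le) (hδ _)
    have h3 := ih (fun j => α j.castSucc) (fun j => δ j.castSucc) (α (Fin.last l))
      (fun j => hα _) (fun i j h => hmono (Fin.castSucc_lt_castSucc_iff.2 h))
      (fun j => hmono (Fin.castSucc_lt_last _)) (fun j => hδ _) hδ0
      (by simp only [← Fin.succ_castSucc]; linarith)
    intro j
    refine Fin.lastCases ?_ h3 j
    have h4 : (c - α (Fin.last l)) * δ (Fin.last (l + 1)) = 0 := by linarith
    exact (mul_eq_zero.1 h4).resolve_left (sub_pos.2 (hc _)).ne'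

end AbelSummation

section FlagWeight

variable {k U : Type*} [Field k] [AddCommGroup U] [Module k U]

open Module

/-- The contribution of one point to the parabolic degree of a subspace `X`. -/
noncomputable def flagWeight {l : ℕ} (F : Fin (l + 1) → Submodule k U) (α : Fin l → ℚ)
    (X : Submodule k U) : ℚ :=
  ∑ j : Fin l, α j * (finrank k (↥(X ⊓ F j.castSucc) ⧸
    (X ⊓ F j.succ).submoduleOf (X ⊓ F j.castSucc)) : ℚ)

variable [FiniteDimensional k U]

lemma finrank_quotient_submoduleOf {A B : Submodule k U} (h : A ≤ B) :
    (finrank k (↥B ⧸ A.submoduleOf B) : ℚ) = finrank k B - finrank k A := by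
  have h1 := Submodule.finrank_quotient_add_finrank (A.submoduleOf B)
  rw [(Submodule.submoduleOfEquivOfLe h).finrank_eq] at h1
  rw [← h1]
  push_cast
  ring

lemma flagWeight_eq {l : ℕ} {F : Fin (l + 1) → Submodule k U} (hF : Antitone F) (α : Fin l → ℚ)
    (X : Submodule k U) : flagWeight F α X = ∑ j : Fin l, α j *
      ((finrank k ↥(X ⊓ F j.castSucc) : ℚ) - finrank k ↥(X ⊓ F j.succ)) := by
  refine Finset.sum_congr rfl fun j _ => ?_
  rw [finrank_quotient_submoduleOf (inf_le_inf_left _ (hF (Fin.castSucc_lt_succ).le))]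

/-- Intersecting with a subspace does not increase codimension. -/
lemma finrank_inf_add_finrank_le {I B : Submodule k U} (h : I ≤ B) (F : Submodule k U) :
    finrank k ↥(B ⊓ F) + finrank k I ≤ finrank k B + finrank k ↥(I ⊓ F) := by
  have h1 := Submodule.finrank_sup_add_finrank_inf_eq (B ⊓ F) I
  have h2 : finrank k ↥(B ⊓ F ⊔ I) ≤ finrank k B :=
    Submodule.finrank_mono (sup_le inf_le_left h)
  have h3 : finrank k ↥(B ⊓ F ⊓ I) ≤ finrank k ↥(I ⊓ F) :=
    Submodule.finrank_mono (le_inf inf_le_right (inf_le_left.trans inf_le_right))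
  omega

variable {A₁ A₂ I S : Submodule k U} {l : ℕ} {F : Fin (l + 1) → Submodule k U} {α : Fin l → ℚ}
  {n : ℤ}

/-- By `hdim` the codimension of `I` in `A₁ ⊓ A₂` equals that of `A₁ ⊔ A₂` in `S`, and intersecting
with `G` does not increase the former. The rest is the dimension formula for `A₁ ⊓ G` and `A₂ ⊓ G`,
whose sum lies in `S ⊓ G`. -/
lemma finrank_inf_add_finrank_inf_le (hI : I ≤ A₁ ⊓ A₂) (hS : A₁ ⊔ A₂ ≤ S)
    (hdim : finrank k I + finrank k S = finrank k A₁ + finrank k A₂) (G : Submodule k U) :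
    finrank k ↥(A₁ ⊓ G) + finrank k ↥(A₂ ⊓ G) + finrank k ↥(A₁ ⊔ A₂) ≤
      finrank k ↥(I ⊓ G) + finrank k ↥(S ⊓ G) + finrank k S := by
  have h1 := Submodule.finrank_sup_add_finrank_inf_eq (A₁ ⊓ G) (A₂ ⊓ G)
  have h2 := Submodule.finrank_sup_add_finrank_inf_eq A₁ A₂
  have h3 := finrank_inf_add_finrank_le hI G
  have h4 : finrank k ↥(A₁ ⊓ G ⊔ A₂ ⊓ G) ≤ finrank k ↥(S ⊓ G) :=
    Submodule.finrank_mono (sup_le (inf_le_inf_right _ (le_sup_left.trans hS))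
      (inf_le_inf_right _ (le_sup_right.trans hS)))
  rw [← inf_inf_distrib_right] at h1
  omega

/-- The inequality of the weights of two subspaces `A₁`, `A₂` and of approximations `I`, `S` of
their intersection and their sum. -/
theorem flagWeight_add_le (hF : Antitone F) (hF0 : F 0 = ⊤) (hFl : F (Fin.last l) = ⊥)
    (hα : ∀ j, 0 ≤ α j) (hα1 : ∀ j, α j < 1) (hmono : StrictMono α)
    (hI : I ≤ A₁ ⊓ A₂) (hS : A₁ ⊔ A₂ ≤ S)
    (hdim : finrank k I + finrank k S = finrank k A₁ + finrank k A₂)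
    (hSn : (finrank k S : ℤ) ≤ finrank k ↥(A₁ ⊔ A₂) + n) :
    flagWeight F α A₁ + flagWeight F α A₂ ≤ flagWeight F α I + flagWeight F α S + n ∧
    (flagWeight F α A₁ + flagWeight F α A₂ = flagWeight F α I + flagWeight F α S + n → n = 0 ∧
      ∀ j, finrank k ↥(I ⊓ F j) + finrank k ↥(S ⊓ F j) =
        finrank k ↥(A₁ ⊓ F j) + finrank k ↥(A₂ ⊓ F j)) := by
  set c : ℚ := (finrank k S : ℚ) - finrank k ↥(A₁ ⊔ A₂) with hc
  have hc0 : 0 ≤ c := sub_nonneg.2 (by exact_mod_cast Submodule.finrank_mono hS)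
  have hcn : c ≤ n := by
    have : (finrank k S : ℚ) ≤ finrank k ↥(A₁ ⊔ A₂) + n := by exact_mod_cast hSn
    linarith
  -- The shift by `c` makes the defect of dimensions nonnegative and cancels in the differences. At
  -- both ends of the flag the unshifted defect is zero, so `δ` equals `c` there.
  let δ : Fin (l + 1) → ℚ := fun j => finrank k ↥(I ⊓ F j) + finrank k ↥(S ⊓ F j) -
    finrank k ↥(A₁ ⊓ F j) - finrank k ↥(A₂ ⊓ F j) + c
  have hδ : ∀ j, 0 ≤ δ j := by
    intro j
    have h : (finrank k ↥(A₁ ⊓ F j) + finrank k ↥(A₂ ⊓ F j) + finrank k ↥(A₁ ⊔ A₂) : ℚ) ≤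
      finrank k ↥(I ⊓ F j) + finrank k ↥(S ⊓ F j) + finrank k S := by
        exact_mod_cast finrank_inf_add_finrank_inf_le hI hS hdim (F j)
    simp only [δ, hc]
    linarith
  have hδ0 : δ 0 = c := by
    have h : (finrank k I + finrank k S : ℚ) = finrank k A₁ + finrank k A₂ := by
      exact_mod_cast hdim
    have e : ∀ X : Submodule k U, finrank k ↥(X ⊓ F 0) = finrank k X := fun X => by
      rw [hF0, inf_top_eq]
    simp only [δ, e]
    linarith
  have hδl : δ (Fin.last l) = c := by
    have e : ∀ X : Submodule k U, finrank k ↥(X ⊓ F (Fin.last l)) = 0 := fun X => by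
      rw [hFl, inf_bot_eq, finrank_bot]
    simp [δ, e]
  have hsum : ∑ j, α j * (δ j.castSucc - δ j.succ) = flagWeight F α I + flagWeight F α S -
      flagWeight F α A₁ - flagWeight F α A₂ := by
    simp only [flagWeight_eq hF, ← Finset.sum_add_distrib, ← Finset.sum_sub_distrib]
    refine Finset.sum_congr rfl fun j _ => ?_
    simp only [δ]
    ring
  -- A bound strictly below one is what makes equality force `c = 0`; for a flag without steps zero
  -- serves.
  obtain ⟨a, ha, ha0, ha1⟩ : ∃ a : ℚ, (∀ j, α j ≤ a) ∧ 0 ≤ a ∧ a < 1 := by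
    cases l with
    | zero => exact ⟨0, fun j => j.elim0, le_rfl, one_pos⟩
    | succ l => exact ⟨α (Fin.last l), fun j => hmono.monotone (Fin.le_last _), hα _, hα1 _⟩
  have h1 := neg_mul_last_le_sum α δ a hα hmono.monotone ha ha0 hδ
  rw [hδl, hsum] at h1
  have h2 : a * c ≤ c := mul_le_of_le_one_left hc0 ha1.le
  refine ⟨by linarith, fun heq => ?_⟩
  have hc' : c = n := by linarith
  -- Equality gives `n ≤ a * c ≤ c ≤ n`.
  have h3 : (1 - a) * c = 0 := by nlinarith
  have hcz : c = 0 := (mul_eq_zero.1 h3).resolve_left (sub_pos.2 ha1).ne'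
  have hnz : (n : ℚ) = 0 := hc' ▸ hcz
  refine ⟨by exact_mod_cast hnz, fun j => ?_⟩
  have h4 := eq_zero_of_sum_le α δ 1 hα hmono hα1 hδ (hδ0.trans hcz)
    (by rw [hsum, hδl]; linarith) j
  simp only [δ, hcz] at h4
  have h5 : (finrank k ↥(I ⊓ F j) + finrank k ↥(S ⊓ F j) : ℚ) =
      finrank k ↥(A₁ ⊓ F j) + finrank k ↥(A₂ ⊓ F j) := by linarith
  exact_mod_cast h5

/-- If the dimensions add up, then a jump of the flag of `S` is a jump of the flag of `A₁` or of
`A₂`. -/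
lemma inf_eq_inf_of_finrank_eq (hI : I ≤ A₁ ⊓ A₂) {G H : Submodule k U} (hGH : G ≤ H)
    (hG : finrank k ↥(I ⊓ G) + finrank k ↥(S ⊓ G) = finrank k ↥(A₁ ⊓ G) + finrank k ↥(A₂ ⊓ G))
    (hH : finrank k ↥(I ⊓ H) + finrank k ↥(S ⊓ H) = finrank k ↥(A₁ ⊓ H) + finrank k ↥(A₂ ⊓ H))
    (h₁ : A₁ ⊓ G = A₁ ⊓ H) (h₂ : A₂ ⊓ G = A₂ ⊓ H) : S ⊓ G = S ⊓ H := by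
  have h3 : I ⊓ G = I ⊓ H := by
    have hI1 : I ⊓ A₁ = I := inf_eq_left.2 (hI.trans inf_le_left)
    rw [← hI1, inf_assoc, h₁, inf_assoc]
  rw [h₁, h₂, h3] at hG
  exact Submodule.eq_of_le_of_finrank_eq (inf_le_inf_left _ hGH) (by omega)

end FlagWeight

/-! ### The product formula for one-dimensional function fields -/

section DedekindCount

open Ideal

/-- Over an algebraically closed residue field, the multiplicities of the primes over a principal
prime add up to the degree of the extension. -/
lemma sum_multiplicity_primesOver {R S : Type*} [CommRing R] [IsDedekindDomain R]
    [CommRing S] [IsDedekindDomain S] [Algebra R S] [Module.Finite R S]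
    [Module.IsTorsionFree R S] (t : R) (ht : t ≠ 0) [hp : (span {t}).IsMaximal]
    (hac : ∀ (q : Ideal S) [q.IsMaximal] [q.LiesOver (span {t})],
      Module.finrank (R ⧸ span {t}) (S ⧸ q) = 1) [Fintype ((span {t}).primesOver S)] :
    ∑ q : (span {t}).primesOver S, multiplicity q.1 (span {algebraMap R S t}) =
      Module.finrank R S := by
  -- The fundamental identity ∑ e·f = n, in which `hac` makes every inertia degree f equal to one.
  rw [← sum_ramification_inertia_eq_finrank (p := span {t}) (R := R) (S := S)]
  have hpS : (span {t}).map (algebraMap R S) ≠ ⊥ := by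
    rw [map_span, Set.image_singleton, Ne, span_singleton_eq_bot]
    simpa using ht
  refine Finset.sum_congr rfl fun q _ => ?_
  have hq := q.2.1
  have hqo : q.1.LiesOver (span {t}) := q.2.2
  have hqm : q.1.IsMaximal := hq.isMaximal
    (ne_bot_of_le_ne_bot hpS (map_le_of_le_comap (q.1.over_def (span {t})).le))
  rw [IsDedekindDomain.ramificationIdx_eq_multiplicity (span {t}) q.1 hpS, map_span,
    Set.image_singleton, inertiaDeg_eq_of_isMaximal (span {t}) q.1]
  rw [hac q.1, mul_one]

end DedekindCount

/-- The valuation rings of the points of a smooth projective curve with function field `K`: they are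
discrete valuation rings, and every nontrivial valuation ring of `K` over `k` occurs exactly
once. -/
structure IsPlaceSystem (k : Type*) {K X : Type*} [Field k] [Field K] [Algebra k K]
    (O : X → ValuationSubring K) (ord : X → K → ℤ) : Prop where
  algebraMap_mem : ∀ x (c : k), algebraMap k K c ∈ O x
  ne_top : ∀ x, O x ≠ ⊤
  exists_uniformizer : ∀ x, ∃ ϖ : K, ϖ ≠ 0 ∧ ϖ ∈ O x ∧ ϖ⁻¹ ∉ O x ∧
    ∀ z : K, z ≠ 0 → ∃ u : K, u ≠ 0 ∧ u ∈ O x ∧ u⁻¹ ∈ O x ∧ z = u * ϖ ^ ord x z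
  existsUnique : ∀ A : ValuationSubring K, (∀ c : k, algebraMap k K c ∈ A) → A ≠ ⊤ →
    ∃! x, O x = A

namespace IsPlaceSystem

variable {k K X : Type*} [Field k] [Field K] [Algebra k K] {O : X → ValuationSubring K}
  {ord : X → K → ℤ}

lemma mem_of_nonneg (h : IsPlaceSystem k O ord) {x : X} {z : K} (hz : z ≠ 0) (hn : 0 ≤ ord x z) :
    z ∈ O x := by
  obtain ⟨ϖ, _, hϖ, -, hu⟩ := h.exists_uniformizer x
  obtain ⟨u, _, hu, -, e⟩ := hu z hz
  obtain ⟨n, hn⟩ := Int.eq_ofNat_of_zero_le hn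
  rw [e, hn]
  exact mul_mem hu (by simpa using pow_mem hϖ n)

/-- Multiplying `u * ϖ ^ m` by `u⁻¹` and by a nonnegative power of `ϖ` leaves exactly `ϖ⁻¹`. -/
lemma inv_mem_of_zpow_mem {A : ValuationSubring K} {ϖ u : K} (hϖ0 : ϖ ≠ 0) (hϖ : ϖ ∈ A)
    (hu0 : u ≠ 0) (hu : u⁻¹ ∈ A) {m : ℤ} (hm : m < 0) (h : u * ϖ ^ m ∈ A) : ϖ⁻¹ ∈ A := by
  obtain ⟨n, rfl⟩ : ∃ n : ℕ, m = -(n + 1 : ℤ) := ⟨(-m - 1).toNat, by omega⟩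
  have e : ϖ⁻¹ = u⁻¹ * (u * ϖ ^ (-(n + 1 : ℤ))) * ϖ ^ n := by
    rw [inv_mul_cancel_left₀ hu0, ← zpow_natCast, ← zpow_add₀ hϖ0, ← zpow_neg_one]
    congr 1
    ring
  rw [e]
  exact mul_mem (mul_mem hu h) (pow_mem hϖ n)

lemma notMem_of_neg (h : IsPlaceSystem k O ord) {x : X} {z : K} (hz : z ≠ 0) (hn : ord x z < 0) :
    z ∉ O x := by
  intro hzO
  obtain ⟨ϖ, hϖ0, hϖ, hϖ', hu⟩ := h.exists_uniformizer x
  obtain ⟨u, hu0, hu, hu', e⟩ := hu z hz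
  exact hϖ' (inv_mem_of_zpow_mem hϖ0 hϖ hu0 hu' hn (e ▸ hzO))

/-- Multiplicativity of `ord` is not among the axioms. Multiplying the normal forms of `z` and `z⁻¹`
gives a unit times `ϖ ^ (a + b)` equal to one, and a nonzero exponent would make `ϖ` invertible in
`O x`. -/
lemma ord_inv (h : IsPlaceSystem k O ord) (x : X) {z : K} (hz : z ≠ 0) :
    ord x z⁻¹ = -ord x z := by
  obtain ⟨ϖ, hϖ0, hϖ, hϖ', hu⟩ := h.exists_uniformizer x
  obtain ⟨u, hu0, hu1, hu2, e⟩ := hu z hz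
  obtain ⟨w, hw0, hw1, hw2, e'⟩ := hu z⁻¹ (inv_ne_zero hz)
  set a := ord x z
  set b := ord x z⁻¹
  have h1 : (u * w) * ϖ ^ (a + b) = 1 := by
    rw [zpow_add₀ hϖ0]
    calc u * w * (ϖ ^ a * ϖ ^ b) = (u * ϖ ^ a) * (w * ϖ ^ b) := by ring
      _ = 1 := by rw [← e, ← e', mul_inv_cancel₀ hz]
  have h2 : (u * w)⁻¹ * ϖ ^ (-(a + b)) = 1 := by
    rw [zpow_neg, ← mul_inv, h1, inv_one]
  have h3 : (u * w)⁻¹ ∈ O x := by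
    rw [mul_inv]
    exact mul_mem hu2 hw2
  rcases lt_trichotomy (a + b) 0 with hab | hab | hab
  · exact absurd (inv_mem_of_zpow_mem hϖ0 hϖ (mul_ne_zero hu0 hw0) h3 hab
      (by rw [h1]; exact one_mem _)) hϖ'
  · omega
  · exact absurd (inv_mem_of_zpow_mem hϖ0 hϖ (inv_ne_zero (mul_ne_zero hu0 hw0))
      (by rw [inv_inv]; exact mul_mem hu1 hw1) (neg_neg_of_pos hab)
      (by rw [h2]; exact one_mem _)) hϖ'

/-- A discrete valuation ring is a maximal proper subring of its field: an element outside has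
negative order, so any larger ring contains `ϖ⁻¹` and with it every power of `ϖ`. -/
lemma eq_of_le (h : IsPlaceSystem k O ord) (x : X) {A : ValuationSubring K} (hA : A ≠ ⊤)
    (hle : O x ≤ A) : O x = A := by
  refine le_antisymm hle fun z hz => ?_
  by_contra hzO
  have hz0 : z ≠ 0 := by
    rintro rfl
    exact hzO (zero_mem _)
  have hneg : ord x z < 0 := by
    by_contra! hn
    exact hzO (h.mem_of_nonneg hz0 hn)
  apply hA
  rw [eq_top_iff]
  intro w _
  by_cases hw : w = 0
  · rw [hw]
    exact zero_mem _
  obtain ⟨ϖ, hϖ0, hϖ, hϖ', hu⟩ := h.exists_uniformizer x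
  obtain ⟨u, hu0, hu1, hu2, e⟩ := hu z hz0
  obtain ⟨v, hv0, hv1, hv2, e'⟩ := hu w hw
  have hϖA : ϖ⁻¹ ∈ A := inv_mem_of_zpow_mem hϖ0 (hle hϖ) hu0 (hle hu2) hneg (e ▸ hz)
  rw [e']
  refine mul_mem (hle hv1) ?_
  obtain ⟨n, hn | hn⟩ := (ord x w).eq_nat_or_neg
  · rw [hn, zpow_natCast]
    exact pow_mem (hle hϖ) n
  · rw [hn, zpow_neg, zpow_natCast, ← inv_pow]
    exact pow_mem hϖA n

open WithZero in
/-- A discrete valuation with the valuation ring of the point `x` is the order at `x`. -/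
lemma valuation_eq (h : IsPlaceSystem k O ord) (x : X) (v : Valuation K ℤᵐ⁰)
    (hv : Function.Surjective v) (hO : O x = v.valuationSubring) {z : K} (hz : z ≠ 0) :
    v z = exp (-ord x z) := by
  have hmem : ∀ w, w ∈ O x ↔ v w ≤ 1 := fun w => by rw [hO, Valuation.mem_valuationSubring_iff]
  obtain ⟨ϖ, hϖ0, hϖ, hϖ', hu⟩ := h.exists_uniformizer x
  have hvu : ∀ u, u ≠ 0 → u ∈ O x → u⁻¹ ∈ O x → v u = 1 := by
    intro u hu0 h1 h2
    rw [hmem] at h1 h2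
    rw [map_inv₀, inv_le_one₀ (zero_lt_iff.2 (v.ne_zero_iff.2 hu0))] at h2
    exact le_antisymm h1 h2
  have hvz : ∀ w : K, w ≠ 0 → v w = exp (ord x w * log (v ϖ)) := by
    intro w hw
    obtain ⟨u, hu0, h1, h2, e⟩ := hu w hw
    rw [← smul_eq_mul, exp_zsmul, exp_log (v.ne_zero_iff.2 hϖ0)]
    conv_lhs => rw [e]
    rw [map_mul, hvu u hu0 h1 h2, one_mul, map_zpow₀]
  have hneg : log (v ϖ) < 0 := by
    rw [hmem, map_inv₀, inv_le_one₀ (zero_lt_iff.2 (v.ne_zero_iff.2 hϖ0)), not_le] at hϖ'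
    rwa [← exp_lt_exp, exp_log (v.ne_zero_iff.2 hϖ0), exp_zero]
  obtain ⟨π, hπ⟩ := hv (exp (-1))
  have hπ0 : π ≠ 0 := by
    rintro rfl
    rw [map_zero] at hπ
    exact exp_ne_zero hπ.symm
  rw [hvz π hπ0, exp_inj] at hπ
  -- By surjectivity some integer multiple of `log (v ϖ)` is -1, and the logarithm is negative.
  have hone : log (v ϖ) = -1 := by
    rcases Int.eq_one_or_neg_one_of_mul_eq_neg_one' hπ with ⟨_, h⟩ | ⟨_, h⟩ <;> omega
  rw [hvz z hz, hone]
  congr 1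
  ring

end IsPlaceSystem

/-! ### The polynomial ring generated by a transcendental function. -/

section AdjoinTranscendental

variable {k K : Type*} [Field k] [Field K] [Algebra k K] {f : K}

lemma isPrincipalIdealRing_adjoin (hf : Transcendental k f) :
    IsPrincipalIdealRing (Algebra.adjoin k {f}) :=
  IsPrincipalIdealRing.of_surjective (Polynomial.algEquivOfTranscendental k f hf).toRingHom
    (Polynomial.algEquivOfTranscendental k f hf).surjective

/-- The generator of `k[f]`. -/
def adjoinGen (k : Type*) {K : Type*} [Field k] [Field K] [Algebra k K] (f : K) :
    Algebra.adjoin k {f} :=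
  ⟨f, Algebra.self_mem_adjoin_singleton k f⟩

/-- Since `f` is transcendental, k[f] is a polynomial ring, and modulo the variable a polynomial is
its constant coefficient. -/
lemma bijective_quotient_span_adjoinGen (hf : Transcendental k f) :
    Function.Bijective (algebraMap k (Algebra.adjoin k {f} ⧸ Ideal.span {adjoinGen k f})) := by
  have hne : Ideal.span {adjoinGen k f} ≠ ⊤ := by
    rw [Ne, Ideal.eq_top_iff_one, Ideal.mem_span_singleton']
    rintro ⟨a, ha⟩
    have ha' : (a : K) * f = 1 := congrArg Subtype.val ha
    obtain ⟨p, hp⟩ := (Polynomial.algEquivOfTranscendental k f hf).surjective a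
    have hp' : Polynomial.aeval f p = (a : K) := by
      rw [← hp]
      simp
    refine hf ⟨p * Polynomial.X - 1, ?_, ?_⟩
    · intro h0
      have := congrArg (Polynomial.eval 0) h0
      simp at this
    · simp [hp', ha']
  have : Nontrivial (Algebra.adjoin k {f} ⧸ Ideal.span {adjoinGen k f}) :=
    Ideal.Quotient.nontrivial_iff.2 hne
  refine ⟨RingHom.injective _, fun z => ?_⟩
  obtain ⟨a, rfl⟩ := Ideal.Quotient.mk_surjective z
  obtain ⟨p, rfl⟩ := (Polynomial.algEquivOfTranscendental k f hf).surjective a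
  refine ⟨p.coeff 0, ?_⟩
  rw [IsScalarTower.algebraMap_apply k (Algebra.adjoin k {f}), eq_comm]
  change Ideal.Quotient.mk _ _ = Ideal.Quotient.mk _ _
  rw [Ideal.Quotient.eq, Ideal.mem_span_singleton]
  have h1 : p - Polynomial.C (p.coeff 0) = Polynomial.X * p.divX := by
    rw [sub_eq_iff_eq_add, p.X_mul_divX_add]
  refine ⟨Polynomial.algEquivOfTranscendental k f hf p.divX, ?_⟩
  have h2 := congrArg (Polynomial.algEquivOfTranscendental k f hf) h1
  rw [map_sub, map_mul] at h2
  convert h2 using 2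
  · ext
    simp
  · ext
    simp [adjoinGen]

end AdjoinTranscendental

/-! ### Counting zeros and poles by primes of Dedekind domains. -/

namespace IsPlaceSystem

variable {k K X : Type*} [Field k] [Field K] [Algebra k K] {O : X → ValuationSubring K}
  {ord : X → K → ℤ}

open IsDedekindDomain in
/-- The zeros of a function correspond to the prime ideals that contain it, in a Dedekind domain
that is contained in all the valuation rings of the zeros. -/
theorem exists_zeros_equiv (h : IsPlaceSystem k O ord) {A : Type*} [CommRing A] [IsDedekindDomain A]
    [Algebra k A] [Algebra A K] [IsScalarTower k A K] [IsFractionRing A K] {f : A} (hf : f ≠ 0)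
    (hA : ∀ x, 0 < ord x (algebraMap A K f) → ∀ a : A, algebraMap A K a ∈ O x) :
    ∃ e : {q : HeightOneSpectrum A // f ∈ q.asIdeal} ≃ {x | 0 < ord x (algebraMap A K f)},
      ∀ q, ord (e q) (algebraMap A K f) = multiplicity q.1.asIdeal (Ideal.span {f}) := by
  have hfK : algebraMap A K f ≠ 0 := by simpa using hf
  have hVk : ∀ (q : HeightOneSpectrum A) (c : k),
      algebraMap k K c ∈ (q.valuation K).valuationSubring := by
    intro q c
    rw [Valuation.mem_valuationSubring_iff, IsScalarTower.algebraMap_apply k A K]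
    exact q.valuation_le_one _
  have hVtop : ∀ q : HeightOneSpectrum A, (q.valuation K).valuationSubring ≠ ⊤ := by
    intro q h0
    obtain ⟨π, hπ⟩ := q.valuation_surjective K (WithZero.exp 1)
    have h1 : π ∈ (q.valuation K).valuationSubring := by
      rw [h0]
      trivial
    rw [Valuation.mem_valuationSubring_iff, hπ, ← WithZero.exp_zero, WithZero.exp_le_exp] at h1
    omega
  -- The valuation ring of a prime `q` contains `k` and is nontrivial, so it belongs to a point.
  choose pt hpt using fun q => (h.existsUnique _ (hVk q) (hVtop q)).exists
  have hord : ∀ q, ord (pt q) (algebraMap A K f) = multiplicity q.asIdeal (Ideal.span {f}) := by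
    intro q
    have h1 := h.valuation_eq (pt q) (q.valuation K) (q.valuation_surjective K) (hpt q) hfK
    rw [q.valuation_of_algebraMap, q.intValuation_eq_exp_neg_multiplicity hf,
      WithZero.exp_inj] at h1
    omega
  have hpos : ∀ q, 0 < ord (pt q) (algebraMap A K f) ↔ f ∈ q.asIdeal := by
    intro q
    rw [← q.valuation_lt_one_iff_mem (K := K),
      h.valuation_eq (pt q) (q.valuation K) (q.valuation_surjective K) (hpt q) hfK,
      ← WithZero.exp_zero, WithZero.exp_lt_exp]
    omega
  have hinj : Function.Injective pt := by
    intro q q' e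
    have h1 : (q.valuation K).valuationSubring = (q'.valuation K).valuationSubring := by
      rw [← hpt, ← hpt, e]
    have h2 := (Valuation.isEquiv_iff_valuationSubring _ _).2 h1
    ext a
    rw [← q.valuation_lt_one_iff_mem (K := K), ← q'.valuation_lt_one_iff_mem (K := K),
      h2.lt_one_iff_lt_one]
  have hsurj : ∀ x, 0 < ord x (algebraMap A K f) → ∃ q, pt q = x := by
    intro x hx
    let φ : A →+* O x := (algebraMap A K).codRestrict (O x).toSubring (hA x hx)
    have hφ : ∀ a, ((φ a : O x) : K) = algebraMap A K a := fun a => rfl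
    -- The preimage of a zero `x` is the centre of its valuation ring on `A`, nonzero because it
    -- contains `f`.
    let P := (IsLocalRing.maximalIdeal (O x)).comap φ
    have hmem : ∀ a, a ∈ P ↔ (O x).valuation (algebraMap A K a) < 1 := by
      intro a
      rw [← hφ, ← ValuationSubring.valuation_lt_one_iff]
      rfl
    have hfP : f ∈ P := by
      rw [hmem, Valuation.val_lt_one_iff _ hfK]
      by_contra! h1
      rw [ValuationSubring.valuation_le_one_iff] at h1
      refine h.notMem_of_neg (inv_ne_zero hfK) ?_ h1
      rw [h.ord_inv x hfK]
      omega
    let q : HeightOneSpectrum A := ⟨P, Ideal.comap_isPrime _ _, fun h0 => hf (by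
      rwa [h0, Ideal.mem_bot] at hfP)⟩
    refine ⟨q, ?_⟩
    -- Denominators outside the centre are units in `O x`, so the localisation of `A` at `q` lies in
    -- `O x`; maximality of discrete valuation rings then gives equality.
    have hle : (q.valuation K).valuationSubring ≤ O x := by
      intro z hz
      rw [Valuation.mem_valuationSubring_iff] at hz
      obtain ⟨n, d, e⟩ := q.exists_primeCompl_mul_eq_of_integer z hz
      have hd : (d : A) ∉ P := d.2
      rw [hmem, not_lt] at hd
      have hn : (O x).valuation (algebraMap A K n) ≤ 1 :=
        ((O x).valuation_le_one_iff _).2 (hA x hx n)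
      rw [← ValuationSubring.valuation_le_one_iff]
      rw [← e, map_mul] at hn
      exact (le_mul_of_one_le_right' hd).trans hn
    have h1 := h.eq_of_le (pt q) (h.ne_top x) (by rw [hpt]; exact hle)
    obtain ⟨y, -, hy⟩ := h.existsUnique (O x) (h.algebraMap_mem x) (h.ne_top x)
    rw [hy _ h1, ← hy x rfl]
  refine ⟨Equiv.ofBijective (fun q => ⟨pt q.1, (hpos q.1).2 q.2⟩) ⟨?_, ?_⟩, fun q => hord q.1⟩
  · intro q q' e
    exact Subtype.ext (hinj (congrArg Subtype.val e))
  · rintro ⟨x, hx⟩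
    obtain ⟨q, rfl⟩ := hsurj x hx
    exact ⟨⟨q, (hpos q).1 hx⟩, rfl⟩

end IsPlaceSystem

open scoped IntermediateField

/-- The residue extension is algebraic over an algebraically closed field, hence trivial. -/
lemma finrank_quotient_eq_one_of_isAlgClosed {k : Type u} [Field k] [IsAlgClosed k] {R A : Type u}
    [CommRing R] [CommRing A] [Algebra R A] [Algebra.IsIntegral R A] (p : Ideal R) [p.IsMaximal]
    (e : k ≃+* R ⧸ p) (q : Ideal A) [q.IsMaximal] [q.LiesOver p] :
    Module.finrank (R ⧸ p) (A ⧸ q) = 1 := by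
  let : Field (R ⧸ p) := Ideal.Quotient.field _
  let : Field (A ⧸ q) := Ideal.Quotient.field _
  have : IsAlgClosed (R ⧸ p) := IsAlgClosed.of_ringEquiv _ _ e
  have hb := IsAlgClosed.algebraMap_bijective_of_isIntegral (k := R ⧸ p) (K := A ⧸ q)
  have := (LinearEquiv.ofBijective (Algebra.linearMap (R ⧸ p) (A ⧸ q)) hb).finrank_eq
  rw [← this, Module.finrank_self]

namespace IsPlaceSystem

variable {k K : Type u} {X : Type*} [Field k] [Field K] [Algebra k K] {O : X → ValuationSubring K}
  {ord : X → K → ℤ}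

open IsDedekindDomain Ideal in
-- The primes of `A` containing `t` are those over the maximal ideal `(t)`. The orders at the
-- corresponding points are the multiplicities, which add up to the rank since residue degrees are
-- one.
theorem finsum_zeros_of_dedekind [IsAlgClosed k] (h : IsPlaceSystem k O ord) {R A : Type u}
    [CommRing R] [IsDedekindDomain R] [CommRing A] [IsDedekindDomain A] [Algebra R A]
    [Module.Finite R A] [Module.IsTorsionFree R A]
    [Algebra k A] [Algebra A K] [IsScalarTower k A K] [IsFractionRing A K] (t : R) (ht : t ≠ 0)
    [hmax : (span {t}).IsMaximal] (e : k ≃+* R ⧸ span {t})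
    (hA : ∀ x, 0 < ord x (algebraMap A K (algebraMap R A t)) → ∀ a : A, algebraMap A K a ∈ O x) :
    {x | 0 < ord x (algebraMap A K (algebraMap R A t))}.Finite ∧
      ∑ᶠ x ∈ {x | 0 < ord x (algebraMap A K (algebraMap R A t))},
        ord x (algebraMap A K (algebraMap R A t)) = Module.finrank R A := by
  have htA : algebraMap R A t ≠ 0 := by simpa using ht
  obtain ⟨E, hE⟩ := h.exists_zeros_equiv htA hA
  let E' : (span {t}).primesOver A ≃ {q : HeightOneSpectrum A // algebraMap R A t ∈ q.asIdeal} :=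
    { toFun := fun q =>
        have hq : algebraMap R A t ∈ q.1 := by
          have := q.2.2
          have h2 := mem_span_singleton_self t
          rwa [q.1.over_def (span {t})] at h2
        ⟨⟨q.1, q.2.1, fun h0 => htA (by rwa [h0, mem_bot] at hq)⟩, hq⟩
      invFun := fun q => ⟨q.1.asIdeal, q.1.isPrime, ⟨hmax.eq_of_le
        (comap_isPrime (algebraMap R A) q.1.asIdeal).ne_top (by
          rw [span_singleton_le_iff_mem]
          exact q.2)⟩⟩
      left_inv := fun q => rfl
      right_inv := fun q => rfl }
  have : Fintype ((span {t}).primesOver A) :=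
    (Algebra.QuasiFinite.finite_primesOver (span {t})).fintype
  let F := E'.trans E
  have hF : Finite {x | 0 < ord x (algebraMap A K (algebraMap R A t))} := Finite.of_equiv _ F
  refine ⟨hF, ?_⟩
  rw [← sum_multiplicity_primesOver (S := A) t ht
    (fun q _ _ => finrank_quotient_eq_one_of_isAlgClosed _ e q), Nat.cast_sum,
    finsum_mem_eq_finite_toFinset_sum _ hF, ← finsum_eq_sum_of_fintype]
  rw [← finsum_mem_eq_finite_toFinset_sum _ hF, ← finsum_set_coe_eq_finsum_mem,
    ← finsum_comp_equiv F]
  exact finsum_congr fun q => hE (E' q)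

open IntermediateField IntermediateField.algebraAdjoinAdjoin in
/-- The number of zeros of a transcendental function, counted with multiplicity, is the degree of
the function field over the field generated by the function. -/
theorem finsum_zeros [IsAlgClosed k] [CharZero k] (h : IsPlaceSystem k O ord) {f : K}
    (hf : Transcendental k f) [FiniteDimensional k⟮f⟯ K] :
    {x | 0 < ord x f}.Finite ∧ ∑ᶠ x ∈ {x | 0 < ord x f}, ord x f = Module.finrank k⟮f⟯ K := by
  have hPID := isPrincipalIdealRing_adjoin hf
  -- Characteristic zero makes the extension of k(f) separable, so the integral closure of k[f] is
  -- finite over k[f].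
  have : CharZero k⟮f⟯ := charZero_of_injective_algebraMap (algebraMap k k⟮f⟯).injective
  have : Module.Finite (Algebra.adjoin k {f}) (integralClosure (Algebra.adjoin k {f}) K) :=
    IsIntegralClosure.finite _ k⟮f⟯ K _
  have : IsDedekindDomain (integralClosure (Algebra.adjoin k {f}) K) :=
    integralClosure.isDedekindDomain _ k⟮f⟯ K
  have : IsFractionRing (integralClosure (Algebra.adjoin k {f}) K) K :=
    integralClosure.isFractionRing_of_finite_extension k⟮f⟯ K
  have hrank : Module.finrank (Algebra.adjoin k {f}) (integralClosure (Algebra.adjoin k {f}) K) =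
    Module.finrank k⟮f⟯ K := IsIntegralClosure.rank _ k⟮f⟯ K _
  have hf0 : f ≠ 0 := by
    rintro rfl
    exact hf (isAlgebraic_zero)
  have ht0 : adjoinGen k f ≠ 0 := fun h0 => hf0 (congrArg Subtype.val h0)
  let e : k ≃+* Algebra.adjoin k {f} ⧸ Ideal.span {adjoinGen k f} :=
    RingEquiv.ofBijective _ (bijective_quotient_span_adjoinGen hf)
  have hmax : (Ideal.span {adjoinGen k f}).IsMaximal :=
    Ideal.Quotient.maximal_of_isField _ (e.toMulEquiv.symm.isField (Field.toIsField k))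
  -- At a zero of `f` the valuation ring contains k[f], and, being integrally closed, the whole
  -- integral closure.
  have hA : ∀ x, 0 < ord x f → ∀ a : integralClosure (Algebra.adjoin k {f}) K,
      (a : K) ∈ O x := by
    intro x hx a
    have hR : ∀ r : Algebra.adjoin k {f}, (r : K) ∈ O x := by
      rintro ⟨r, hr⟩
      induction hr using Algebra.adjoin_induction with
      | mem z hz =>
        rw [Set.mem_singleton_iff] at hz
        subst hz
        exact h.mem_of_nonneg hf0 hx.le
      | algebraMap c => exact h.algebraMap_mem x c
      | add y z _ _ hy hz => exact add_mem hy hz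
      | mul y z _ _ hy hz => exact mul_mem hy hz
    obtain ⟨p, hp, hpa⟩ := a.2
    let ψ : Algebra.adjoin k {f} →+* O x := (Algebra.adjoin k {f}).val.toRingHom.codRestrict
      (O x).toSubring hR
    have hint : IsIntegral (O x) (a : K) := by
      refine ⟨p.map ψ, hp.map ψ, ?_⟩
      rw [Polynomial.eval₂_map]
      exact hpa
    obtain ⟨b, hb⟩ := IsIntegrallyClosed.isIntegral_iff.1 hint
    rw [← hb]
    exact b.2
  have := h.finsum_zeros_of_dedekind (A := integralClosure (Algebra.adjoin k {f}) K)
    (adjoinGen k f) ht0 e hA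
  rw [hrank] at this
  exact this

/-- Such an `f` is a constant because `k` is algebraically closed, and constants and their inverses
lie in every valuation ring. -/
lemma ord_eq_zero_of_isAlgebraic [IsAlgClosed k] (h : IsPlaceSystem k O ord) {f : K} (hf : f ≠ 0)
    (hf' : IsAlgebraic k f) (x : X) : ord x f = 0 := by
  have hmem : f ∈ (⊥ : IntermediateField k K) := by
    have := hf'.isIntegral
    have : Algebra.IsAlgebraic k k⟮f⟯ := IntermediateField.isAlgebraic_adjoin_simple this
    rw [← IntermediateField.eq_bot_of_isAlgClosed_of_isAlgebraic k⟮f⟯]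
    exact IntermediateField.mem_adjoin_simple_self k f
  obtain ⟨c, rfl⟩ := IntermediateField.mem_bot.1 hmem
  have h1 : 0 ≤ ord x (algebraMap k K c) := by
    by_contra! h0
    exact h.notMem_of_neg hf h0 (h.algebraMap_mem x c)
  have h2 : 0 ≤ ord x (algebraMap k K c)⁻¹ := by
    by_contra! h0
    refine h.notMem_of_neg (inv_ne_zero hf) h0 ?_
    rw [← map_inv₀]
    exact h.algebraMap_mem x c⁻¹
  rw [h.ord_inv x hf] at h2
  omega

/-- The sum of the orders of a nonzero function is zero. -/
theorem finsum_ord_eq_zero [IsAlgClosed k] [CharZero k] (h : IsPlaceSystem k O ord)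
    (hfin : ∀ f : K, Transcendental k f → FiniteDimensional k⟮f⟯ K) {f : K} (hf : f ≠ 0) :
    {x | ord x f ≠ 0}.Finite ∧ ∑ᶠ x, ord x f = 0 := by
  by_cases hf' : IsAlgebraic k f
  · simp [h.ord_eq_zero_of_isAlgebraic hf hf']
  have hf'' : Transcendental k f⁻¹ := fun h1 => hf' (by simpa using h1.inv)
  -- The poles of `f` are the zeros of `f⁻¹`, so this equality gives as many poles as zeros.
  have e : k⟮f⁻¹⟯ = k⟮f⟯ := by
    refine le_antisymm ?_ ?_
    · rw [IntermediateField.adjoin_simple_le_iff]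
      exact inv_mem (IntermediateField.mem_adjoin_simple_self k f)
    · rw [IntermediateField.adjoin_simple_le_iff]
      simpa using inv_mem (IntermediateField.mem_adjoin_simple_self k f⁻¹)
  have := hfin f hf'
  have := hfin f⁻¹ hf''
  obtain ⟨h1, h2⟩ := h.finsum_zeros hf'
  obtain ⟨h3, h4⟩ := h.finsum_zeros hf''
  have e1 : {x | 0 < ord x f⁻¹} = {x | ord x f < 0} := by
    ext x
    simp [h.ord_inv x hf]
  have e2 : ∑ᶠ x ∈ {x | ord x f < 0}, ord x f = -Module.finrank k⟮f⟯ K := by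
    rw [e1, finsum_mem_congr rfl (fun x _ => h.ord_inv x hf), e, finsum_mem_neg_distrib] at h4
    rw [← h4, neg_neg]
    rwa [← e1]
  have e3 : {x | ord x f ≠ 0} = {x | 0 < ord x f} ∪ {x | ord x f < 0} := by
    ext x
    simp only [Set.mem_ofPred_eq, Set.mem_union]
    omega
  rw [e1] at h3
  refine ⟨e3 ▸ h1.union h3, ?_⟩
  have e4 : ∑ᶠ x, ord x f = ∑ᶠ x ∈ {x | ord x f ≠ 0}, ord x f :=
    (finsum_mem_support (fun x => ord x f)).symm
  rw [e4, e3, finsum_mem_union _ h1 h3, h2, e2, add_neg_cancel]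
  rw [Set.disjoint_left]
  intro x hx hx'
  simp only [Set.mem_ofPred_eq] at hx hx'
  omega

end IsPlaceSystem

open scoped IntermediateField Polynomial

/-! ### Étale algebras over the affine line. -/

section EtaleOverLine

variable {k R : Type u} [Field k] [CommRing R] [IsDomain R] [Algebra k[X] R]
  [Algebra.Etale k[X] R]

lemma algebraMap_injective_of_etale_polynomial : Function.Injective (algebraMap k[X] R) := by
  have : Module.Flat k[X] R := inferInstance
  exact FaithfulSMul.algebraMap_injective _ _

variable (K : Type u) [Field K] [Algebra R K] [IsFractionRing R K]

/-- `K` is formally unramified and essentially of finite type over the rational function field,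
hence finite over it. -/
lemma isAlgebraic_of_etale_polynomial [Algebra k[X] K] [IsScalarTower k[X] R K] :
    Algebra.IsAlgebraic k[X] K := by
  have hinj : Function.Injective (algebraMap k[X] K) := by
    rw [IsScalarTower.algebraMap_eq k[X] R K]
    exact (IsFractionRing.injective R K).comp algebraMap_injective_of_etale_polynomial
  have : FaithfulSMul k[X] K := (faithfulSMul_iff_algebraMap_injective _ _).2 hinj
  let L := FractionRing k[X]
  let : Algebra L K := FractionRing.liftAlgebra _ _
  have : IsScalarTower k[X] L K := inferInstance
  have h1 : Algebra.FormallyUnramified R K :=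
    Algebra.FormallyUnramified.of_isLocalization (nonZeroDivisors R)
  have h2 : Algebra.FormallyUnramified k[X] K := .comp _ R _
  have h3 : Algebra.FormallyUnramified L K := .of_restrictScalars k[X] _ _
  have h4 : Algebra.EssFiniteType R K := .of_isLocalization _ (nonZeroDivisors R)
  have h5 : Algebra.EssFiniteType k[X] K := .comp _ R _
  have h6 : Algebra.EssFiniteType L K := .of_comp k[X] _ _
  have h7 : Module.Finite L K := Algebra.FormallyUnramified.finite_of_free _ _
  exact (IsFractionRing.comap_isAlgebraic_iff (A := k[X]) (K := L)).2 inferInstance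

variable [Algebra k R] [IsScalarTower k k[X] R]

include R in
-- `K` has transcendence degree one over `k`, so `f` alone is a transcendence basis; an algebraic
-- extension that is essentially of finite type is finite.
lemma finiteDimensional_of_etale_polynomial [Algebra k K] [IsScalarTower k R K] {f : K}
    (hf : Transcendental k f) :
    FiniteDimensional k⟮f⟯ K := by
  let : Algebra k[X] K := ((algebraMap R K).comp (algebraMap k[X] R)).toAlgebra
  have : IsScalarTower k[X] R K := .of_algebraMap_eq' rfl
  have : IsScalarTower k k[X] K := .to₁₂₄ k k[X] R K
  have hinj : Function.Injective (algebraMap k[X] K) := by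
    rw [IsScalarTower.algebraMap_eq k[X] R K]
    exact (IsFractionRing.injective R K).comp algebraMap_injective_of_etale_polynomial
  have : FaithfulSMul k[X] K := (faithfulSMul_iff_algebraMap_injective _ _).2 hinj
  have hal := isAlgebraic_of_etale_polynomial (R := R) (k := k) K
  have htr : Algebra.trdeg k K = 1 := by
    rw [← trdeg_add_eq k k[X], trdeg_eq_zero (R := k[X]) (A := K), add_zero,
      Polynomial.trdeg_of_isDomain]
  have hind : AlgebraicIndependent k (fun _ : Unit => f) := by
    rwa [algebraicIndependent_unique_type_iff]
  have hb := AlgebraicIndependent.isTranscendenceBasis_of_lift_trdeg_le_of_finite hind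
    (by simp [htr])
  have h1 := hb.isAlgebraic_field
  rw [Set.range_const] at h1
  have h4 : Algebra.EssFiniteType R K := .of_isLocalization _ (nonZeroDivisors R)
  have h5 : Algebra.EssFiniteType k[X] K := .comp _ R _
  have h5 : Algebra.EssFiniteType k K := .comp _ k[X] _
  have h6 : Algebra.EssFiniteType k⟮f⟯ K := .of_comp k _ _
  exact Algebra.finite_of_essFiniteType_of_isAlgebraic

/-- As the extension is unramified, the maximal ideal of the local ring is generated by the prime
`p` of `k[X]` below `q`, which is principal. It is nonzero, since by `hq` it contains `X - c` for
some constant `c`. -/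
lemma isDiscreteValuationRing_of_etale_polynomial (q : Ideal R) [q.IsPrime]
    (hq : ∀ a : R, ∃ c : k, a - algebraMap k R c ∈ q) (O : Type u) [CommRing O]
    [IsDomain O] [Algebra R O] [IsLocalization.AtPrime O q] :
    IsDiscreteValuationRing O := by
  have hinj := algebraMap_injective_of_etale_polynomial (k := k) (R := R)
  let p := q.under k[X]
  have hlo : q.LiesOver p := ⟨rfl⟩
  have hp : ∀ g : k[X], ∃ c : k, g - algebraMap k k[X] c ∈ p := by
    intro g
    obtain ⟨c, hc⟩ := hq (algebraMap k[X] R g)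
    refine ⟨c, ?_⟩
    rw [Ideal.mem_comap, map_sub, ← IsScalarTower.algebraMap_apply]
    exact hc
  have hppal : Submodule.IsPrincipal p := IsPrincipalIdealRing.principal p
  obtain ⟨π, hπ⟩ := hppal
  have hπ0 : π ≠ 0 := by
    rintro rfl
    obtain ⟨c, hc⟩ := hp Polynomial.X
    rw [hπ, Submodule.span_zero_singleton, Submodule.mem_bot, sub_eq_zero] at hc
    exact Polynomial.X_ne_C c hc
  have hnoeth : IsNoetherianRing R := Algebra.FiniteType.isNoetherianRing k[X] R
  let B := Localization.AtPrime q
  have : IsNoetherianRing B := IsLocalization.isNoetherianRing q.primeCompl _ hnoeth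
  have : IsDomain B := IsLocalization.isDomain_localization q.primeCompl_le_nonZeroDivisors
  have hunr : Algebra.FormallyUnramified k[X] B := by
    have : Algebra.FormallyUnramified R B := .of_isLocalization q.primeCompl
    exact .comp _ R _
  let := Localization.AtPrime.algebraOfLiesOver p q
  have hmap := ((Algebra.isUnramifiedAt_iff_map_eq k[X] p q).1 hunr).2
  have hinjB : Function.Injective (algebraMap k[X] B) := by
    rw [IsScalarTower.algebraMap_eq k[X] R B]
    exact (IsLocalization.injective B q.primeCompl_le_nonZeroDivisors).comp hinj
  have hprinc : (IsLocalRing.maximalIdeal B).IsPrincipal := by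
    rw [← hmap, hπ]
    refine ⟨algebraMap k[X] B π, ?_⟩
    exact (Ideal.map_span _ _).trans (by rw [Set.image_singleton])
  have hne : ¬ IsField B := by
    rw [IsLocalRing.isField_iff_maximalIdeal_eq, ← hmap]
    intro h0
    have : algebraMap k[X] B π ∈ p.map (algebraMap k[X] B) :=
      Ideal.mem_map_of_mem _ (hπ ▸ Submodule.mem_span_singleton_self π)
    rw [h0, Ideal.mem_bot] at this
    exact hπ0 (hinjB (by rw [this, map_zero]))
  have : IsDiscreteValuationRing B := ((IsDiscreteValuationRing.TFAE B hne).out 0 4).2 hprinc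
  exact IsDiscreteValuationRing.RingEquivClass.isDiscreteValuationRing
    (IsLocalization.algEquiv q.primeCompl B O)

end EtaleOverLine

/-! ### Étale charts and the local rings of the curve. -/

namespace SmoothProjectiveCurve

variable {k : Type u} [Field k] (C : SmoothProjectiveCurve k)

/-- The scalars as elements of the local ring at `x`. -/
noncomputable def scalarStalk (x : C.X) : CommRingCat.of k ⟶ C.X.presheaf.stalk x :=
  Spec.preimage (C.X.fromSpecStalk x ≫ C.hom)

/-- The scalars as sections over `U`. -/
noncomputable def scalarSection (U : C.X.Opens) : CommRingCat.of k ⟶ Γ(C.X, U) :=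
  (Scheme.ΓSpecIso (.of k)).inv ≫ C.hom.appLE ⊤ U le_top

lemma scalarStalk_specializes {x y : C.X} (h : x ⤳ y) :
    C.scalarStalk y ≫ C.X.presheaf.stalkSpecializes h = C.scalarStalk x := by
  apply Spec.map_injective
  rw [Spec.map_comp, scalarStalk, scalarStalk, Spec.map_preimage, Spec.map_preimage,
    Scheme.SpecMap_stalkSpecializes_fromSpecStalk_assoc]

lemma scalarSection_germ {U : C.X.Opens} (hU : IsAffineOpen U) (x : C.X) (hx : x ∈ U) :
    C.scalarSection U ≫ C.X.presheaf.germ U x hx = C.scalarStalk x := by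
  apply Spec.map_injective
  have h := IsAffineOpen.SpecMap_appLE_fromSpec C.hom (isAffineOpen_top (Spec (.of k))) hU le_top
  rw [IsAffineOpen.fromSpec_top, Scheme.isoSpec_Spec_inv] at h
  rw [scalarStalk, Spec.map_preimage, scalarSection, Spec.map_comp, Spec.map_comp, h,
    ← hU.fromSpecStalk_eq_fromSpecStalk hx, IsAffineOpen.fromSpecStalk, Category.assoc]

/-- A standard smooth algebra of relative dimension one is étale over a polynomial ring in one
variable. -/
lemma exists_etale_chart (x : C.X) : ∃ (U : C.X.Opens) (_ : IsAffineOpen U) (_ : x ∈ U)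
    (g : k[X] →+* Γ(C.X, U)), g.Etale ∧ g.comp Polynomial.C = (C.scalarSection U).hom := by
  obtain ⟨W, hW, U, hU, hx, e, h⟩ :=
    SmoothOfRelativeDimension.exists_isStandardSmoothOfRelativeDimension (n := 1) (f := C.hom) x
  -- The base is a single point.
  obtain rfl : W = ⊤ := by
    have : Subsingleton (Spec (.of k)) := inferInstanceAs (Subsingleton (PrimeSpectrum k))
    ext y
    simp only [SetLike.mem_coe, Opens.mem_top, iff_true]
    rw [Subsingleton.elim y (C.hom x)]
    exact e hx
  have h1 : (C.scalarSection U).hom.IsStandardSmoothOfRelativeDimension 1 := by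
    have := (RingHom.isStandardSmoothOfRelativeDimension_respectsIso (n := 1)).2
      (C.hom.appLE ⊤ U e).hom (Scheme.ΓSpecIso (.of k)).symm.commRingCatIsoToRingEquiv h
    exact this
  obtain ⟨g, hg, hg'⟩ := h1.exists_etale_mvPolynomial
  refine ⟨U, hU, hx, g.comp (MvPolynomial.uniqueAlgEquiv k (Fin 1)).symm.toRingHom, ?_, ?_⟩
  · exact RingHom.Etale.respectsIso.2 g
      (MvPolynomial.uniqueAlgEquiv k (Fin 1)).symm.toRingEquiv hg'
  · rw [← hg]
    ext c
    simp

/-- Nullstellensatz: the residue field at a closed point is `k` itself. -/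
lemma exists_sub_mem_maximalIdeal [IsAlgClosed k] (x : C.X) (hx : IsClosed ({x} : Set C.X))
    (a : C.X.presheaf.stalk x) :
    ∃ c : k, a - (C.scalarStalk x).hom c ∈ IsLocalRing.maximalIdeal (C.X.presheaf.stalk x) := by
  have h1 : C.scalarStalk x ≫ C.X.residue x = (residueFieldIsoBase C.hom x hx).inv := by
    apply Spec.map_injective
    rw [SpecMap_residueFieldIsoBase_inv, Spec.map_comp, scalarStalk, Spec.map_preimage]
    rfl
  have h2 : Function.Surjective (C.scalarStalk x ≫ C.X.residue x).hom := by
    rw [h1]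
    exact (residueFieldIsoBase C.hom x hx).symm.commRingCatIsoToRingEquiv.surjective
  obtain ⟨c, hc⟩ := h2 (C.X.residue x a)
  refine ⟨c, ?_⟩
  rw [← IsLocalRing.residue_eq_zero_iff, map_sub, sub_eq_zero]
  exact hc.symm

lemma isDiscreteValuationRing_stalk [IsAlgClosed k] (x : C.X) (hx : IsClosed ({x} : Set C.X)) :
    IsDiscreteValuationRing (C.X.presheaf.stalk x) := by
  obtain ⟨U, hU, hxU, g, hg, hgC⟩ := C.exists_etale_chart x
  have : Nonempty U := ⟨⟨x, hxU⟩⟩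
  let : Algebra k Γ(C.X, U) := (C.scalarSection U).hom.toAlgebra
  let : Algebra k[X] Γ(C.X, U) := g.toAlgebra
  have : IsScalarTower k k[X] Γ(C.X, U) := .of_algebraMap_eq' hgC.symm
  have : Algebra.Etale k[X] Γ(C.X, U) := hg
  let := TopCat.Presheaf.algebra_section_stalk C.X.presheaf (⟨x, hxU⟩ : U)
  have hloc := hU.isLocalization_stalk ⟨x, hxU⟩
  refine isDiscreteValuationRing_of_etale_polynomial (k := k) (R := Γ(C.X, U))
    (hU.primeIdealOf ⟨x, hxU⟩).asIdeal ?_ (C.X.presheaf.stalk x)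
  intro a
  obtain ⟨c, hc⟩ := C.exists_sub_mem_maximalIdeal x hx (C.X.presheaf.germ U x hxU a)
  refine ⟨c, ?_⟩
  rw [← IsLocalization.AtPrime.to_map_mem_maximal_iff (C.X.presheaf.stalk x)
    (hU.primeIdealOf ⟨x, hxU⟩).asIdeal (a - algebraMap k Γ(C.X, U) c), map_sub]
  rw [← C.scalarSection_germ hU x hxU] at hc
  exact hc

noncomputable instance : Algebra k C.X.functionField :=
  (C.scalarStalk (genericPoint C.X)).hom.toAlgebra

lemma finiteDimensional_functionField {f : C.X.functionField} (hf : Transcendental k f) :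
    FiniteDimensional k⟮f⟯ C.X.functionField := by
  obtain ⟨U, hU, hxU, g, hg, hgC⟩ := C.exists_etale_chart (genericPoint C.X)
  have : Nonempty U := ⟨⟨_, hxU⟩⟩
  let : Algebra k Γ(C.X, U) := (C.scalarSection U).hom.toAlgebra
  let : Algebra k[X] Γ(C.X, U) := g.toAlgebra
  have : IsScalarTower k k[X] Γ(C.X, U) := .of_algebraMap_eq' hgC.symm
  have : Algebra.Etale k[X] Γ(C.X, U) := hg
  have := functionField_isFractionRing_of_isAffineOpen C.X U hU
  have : IsScalarTower k Γ(C.X, U) C.X.functionField := by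
    refine .of_algebraMap_eq' ?_
    exact congrArg CommRingCat.Hom.hom (C.scalarSection_germ hU _ hxU).symm
  exact finiteDimensional_of_etale_polynomial (R := Γ(C.X, U)) C.X.functionField hf

end SmoothProjectiveCurve

lemma specMap_fromSpecStalk_closedPoint {X : Scheme.{u}} {x : X} {R : CommRingCat.{u}}
    [IsLocalRing R] (f : X.presheaf.stalk x ⟶ R) [IsLocalHom f.hom] :
    (Spec.map f ≫ X.fromSpecStalk x) (IsLocalRing.closedPoint R) = x :=
  (Scheme.Hom.comp_apply _ _ _).trans ((congrArg (X.fromSpecStalk x)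
    (Spec_closedPoint (f := f))).trans
    Scheme.fromSpecStalk_closedPoint)

/-! ### Orders of rational functions where the local ring is a discrete valuation ring. -/

section OrdStalk

variable {X : Scheme.{u}} [IsIntegral X] (x : X)
  [IsDiscreteValuationRing (X.presheaf.stalk x)]

lemma coheight_eq_one_of_isDiscreteValuationRing : Order.coheight x = 1 := by
  have h := ringKrullDim_stalk_eq_coheight x
  rw [IsDiscreteValuationRing.ringKrullDim_eq_one] at h
  exact_mod_cast h.symm

variable [IsLocallyNoetherian X]

lemma ord_algebraMap_of_isUnit {a : X.presheaf.stalk x} (ha : IsUnit a) :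
    Scheme.ord (algebraMap _ X.functionField a) x = 0 := by
  have hx := coheight_eq_one_of_isDiscreteValuationRing x
  have ha0 : algebraMap _ X.functionField a ≠ 0 := by simpa using ha.ne_zero
  rw [Scheme.ord_eq_iff hx ha0]
  exact Ring.ordFrac_of_isUnit ha

lemma ord_algebraMap_of_irreducible {a : X.presheaf.stalk x} (ha : Irreducible a) :
    Scheme.ord (algebraMap _ X.functionField a) x = 1 := by
  have hx := coheight_eq_one_of_isDiscreteValuationRing x
  have ha0 : algebraMap _ X.functionField a ≠ 0 := by simpa using ha.ne_zero
  rw [Scheme.ord_eq_iff hx ha0]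
  exact Ring.ordFrac_irreducible ha

lemma ord_algebraMap_mul_pow {a ϖ : X.presheaf.stalk x} (ha : IsUnit a) (hϖ : Irreducible ϖ)
    (n : ℕ) : Scheme.ord (algebraMap _ X.functionField (a * ϖ ^ n)) x = n := by
  have hϖ0 : algebraMap _ X.functionField ϖ ≠ 0 := by simpa using hϖ.ne_zero
  have ha0 : algebraMap _ X.functionField a ≠ 0 := by simpa using ha.ne_zero
  rw [map_mul, map_pow]
  induction n with
  | zero => simp [ord_algebraMap_of_isUnit x ha]
  | succ n ih =>
    rw [pow_succ, ← mul_assoc, Scheme.ord_mul (mul_ne_zero ha0 (pow_ne_zero _ hϖ0)) hϖ0, ih,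
      ord_algebraMap_of_irreducible x hϖ]
    push_cast
    rfl

lemma isOrder_ord : IsOrder (X.presheaf.stalk x) (fun f : X.functionField => Scheme.ord f x) where
  map_mul := Scheme.ord_mul
  of_isUnit := ord_algebraMap_of_isUnit x
  of_not_isUnit := by
    intro a ha0 ha
    obtain ⟨ϖ, hϖ⟩ := IsDiscreteValuationRing.exists_irreducible (X.presheaf.stalk x)
    obtain ⟨n, u, rfl⟩ := IsDiscreteValuationRing.eq_unit_mul_pow_irreducible ha0 hϖ
    rw [ord_algebraMap_mul_pow x u.isUnit hϖ]
    rcases n with - | n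
    · simp at ha
    · omega

lemma exists_eq_mul_uniformizer_zpow : ∃ ϖ : X.functionField, ϖ ≠ 0 ∧
    ϖ ∈ (algebraMap (X.presheaf.stalk x) X.functionField).range ∧
    ϖ⁻¹ ∉ (algebraMap (X.presheaf.stalk x) X.functionField).range ∧
    ∀ z : X.functionField, z ≠ 0 → ∃ u : X.functionField, u ≠ 0 ∧
      u ∈ (algebraMap (X.presheaf.stalk x) X.functionField).range ∧
      u⁻¹ ∈ (algebraMap (X.presheaf.stalk x) X.functionField).range ∧
      z = u * ϖ ^ Scheme.ord z x := by
  obtain ⟨ϖ, hϖ⟩ := IsDiscreteValuationRing.exists_irreducible (X.presheaf.stalk x)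
  have hϖ0 : algebraMap _ X.functionField ϖ ≠ 0 := by simpa using hϖ.ne_zero
  refine ⟨algebraMap _ _ ϖ, hϖ0, ⟨ϖ, rfl⟩, ?_, ?_⟩
  · rintro ⟨b, hb⟩
    have h1 : algebraMap _ X.functionField (ϖ * b) =
        algebraMap (X.presheaf.stalk x) X.functionField 1 := by
      rw [map_mul, hb, mul_inv_cancel₀ hϖ0, map_one]
    exact hϖ.not_isUnit (IsUnit.of_mul_eq_one _ (IsFractionRing.injective _ _ h1))
  · intro z hz
    obtain ⟨a, b, hb, rfl⟩ := IsFractionRing.div_surjective (A := X.presheaf.stalk x) z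
    have hb0 := nonZeroDivisors.ne_zero hb
    have ha0 : a ≠ 0 := by
      rintro rfl
      simp at hz
    obtain ⟨n, u, rfl⟩ := IsDiscreteValuationRing.eq_unit_mul_pow_irreducible ha0 hϖ
    obtain ⟨m, v, rfl⟩ := IsDiscreteValuationRing.eq_unit_mul_pow_irreducible hb0 hϖ
    have hord : Scheme.ord (algebraMap _ X.functionField (u * ϖ ^ n) /
        algebraMap _ X.functionField (v * ϖ ^ m)) x = n - m := by
      have h0 : algebraMap _ X.functionField (v * ϖ ^ m) ≠ 0 := by simpa using hb0
      have := Scheme.ord_mul (x := x) hz h0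
      rw [div_mul_cancel₀ _ h0, ord_algebraMap_mul_pow x u.isUnit hϖ,
        ord_algebraMap_mul_pow x v.isUnit hϖ] at this
      omega
    have hv0 : algebraMap _ X.functionField (v : X.presheaf.stalk x) ≠ 0 := by simp
    have hu0 : algebraMap _ X.functionField (u : X.presheaf.stalk x) ≠ 0 := by simp
    have hinv : ∀ w : (X.presheaf.stalk x)ˣ,
        algebraMap (X.presheaf.stalk x) X.functionField
          ((w⁻¹ : (X.presheaf.stalk x)ˣ) : X.presheaf.stalk x) =
        (algebraMap _ X.functionField (w : X.presheaf.stalk x))⁻¹ := by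
      intro w
      rw [eq_comm, inv_eq_iff_eq_inv, eq_comm, inv_eq_of_mul_eq_one_left]
      rw [← map_mul, Units.mul_inv, map_one]
    refine ⟨algebraMap _ _ ((u * v⁻¹ : (X.presheaf.stalk x)ˣ) : X.presheaf.stalk x), by simp,
      ⟨_, rfl⟩, ⟨((u * v⁻¹)⁻¹ : (X.presheaf.stalk x)ˣ), hinv _⟩, ?_⟩
    rw [hord, zpow_sub₀ hϖ0, Units.val_mul, map_mul, map_mul, map_mul, hinv]
    simp only [zpow_natCast, map_pow]
    field_simp

end OrdStalk

/-! ### Closed points as places of the function field. -/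

namespace SmoothProjectiveCurve

variable {k : Type u} [Field k] [IsAlgClosed k] (C : SmoothProjectiveCurve k)

/-- By quasi-compactness `x` specialises to a closed point `y`. It therefore comes from the spectrum
of the local ring at `y`, a discrete valuation ring, which has only two primes. -/
lemma eq_genericPoint_or_isClosed (x : C.X) : x = genericPoint C.X ∨ IsClosed ({x} : Set C.X) := by
  have : CompactSpace C.X := by
    exact QuasiCompact.compactSpace_of_compactSpace C.hom
  obtain ⟨y, hy, hyc⟩ := IsClosed.exists_closed_singleton (S := closure {x}) isClosed_closure
    ⟨x, subset_closure rfl⟩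
  have hxy : x ⤳ y := specializes_iff_mem_closure.2 hy
  have := C.isDiscreteValuationRing_stalk y hyc
  have hx : x ∈ Set.range (C.X.fromSpecStalk y) := by
    rw [Scheme.range_fromSpecStalk]
    exact hxy
  have hη : genericPoint C.X ∈ Set.range (C.X.fromSpecStalk y) := by
    rw [Scheme.range_fromSpecStalk]
    exact (genericPoint_spec C.X).specializes trivial
  obtain ⟨p, rfl⟩ := hx
  obtain ⟨q, hq⟩ := hη
  by_cases hp : p.asIdeal = ⊥
  · left
    have h1 : p ⤳ q := by
      refine (PrimeSpectrum.le_iff_specializes _ _).1 ?_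
      change p.asIdeal ≤ q.asIdeal
      rw [hp]
      exact bot_le
    have h2 := h1.map (C.X.fromSpecStalk y).continuous
    rw [hq] at h2
    exact (h2.antisymm ((genericPoint_spec C.X).specializes trivial)).eq
  · right
    have h1 : p = IsLocalRing.closedPoint _ := by
      apply PrimeSpectrum.ext
      exact IsLocalRing.eq_maximalIdeal (p.isPrime.isMaximal hp)
    rw [h1, Scheme.fromSpecStalk_closedPoint]
    exact hyc

/-- The valuation ring of the function field of a curve at a closed point. -/
noncomputable def placeRing (x : {x : C.X // IsClosed ({x} : Set C.X)}) :
    ValuationSubring C.X.functionField where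
  __ := (algebraMap (C.X.presheaf.stalk x.1) C.X.functionField).range
  mem_or_inv_mem' z := by
    have := C.isDiscreteValuationRing_stalk x.1 x.2
    exact ValuationRing.isInteger_or_isInteger (C.X.presheaf.stalk x.1) z

omit [IsAlgClosed k] in
/-- A valuation ring over `k` that dominates the local ring at `x` determines a lift of the
valuative criterion. -/
lemma spec_lift_comp_hom {A : ValuationSubring C.X.functionField} (hA : ∀ c : k,
    algebraMap k C.X.functionField c ∈ A) (x : C.X) (ψ : C.X.presheaf.stalk x →+* A)
    (hψ : ∀ a, (ψ a : C.X.functionField) = algebraMap _ _ a) :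
    Spec.map (CommRingCat.ofHom ψ) ≫ C.X.fromSpecStalk x ≫ C.hom =
      Spec.map (CommRingCat.ofHom
        ((algebraMap k C.X.functionField).codRestrict A.toSubring hA)) := by
  rw [← Spec.map_preimage (C.X.fromSpecStalk x ≫ C.hom), ← Spec.map_comp]
  congr 1
  ext c
  have := C.scalarStalk_specializes ((genericPoint_spec C.X).specializes (trivial : x ∈ ⊤))
  have h1 := congrArg (fun f => f.hom c) this
  exact (hψ _).trans h1

omit [IsAlgClosed k] in
lemma spec_lift_generic {A : ValuationSubring C.X.functionField} (x : C.X)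
    (ψ : C.X.presheaf.stalk x →+* A)
    (hψ : ∀ a, (ψ a : C.X.functionField) = algebraMap _ _ a) :
    Spec.map (CommRingCat.ofHom (algebraMap A C.X.functionField)) ≫
      Spec.map (CommRingCat.ofHom ψ) ≫ C.X.fromSpecStalk x =
      C.X.fromSpecStalk (genericPoint C.X) := by
  rw [← Spec.map_comp_assoc, ← Scheme.SpecMap_stalkSpecializes_fromSpecStalk
    ((genericPoint_spec C.X).specializes (trivial : x ∈ ⊤))]
  congr 2
  ext a
  exact hψ a

/-- The commutative square of the valuative criterion for a valuation ring of the function field. -/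
noncomputable def valuativeCommSq (A : ValuationSubring C.X.functionField) (hA : ∀ c : k,
    algebraMap k C.X.functionField c ∈ A) : ValuativeCommSq C.hom where
  R := A
  K := C.X.functionField
  i₁ := C.X.fromSpecStalk (genericPoint C.X)
  i₂ := Spec.map (CommRingCat.ofHom ((algebraMap k C.X.functionField).codRestrict A.toSubring hA))
  commSq := ⟨by
    rw [← Spec.map_preimage (C.X.fromSpecStalk _ ≫ C.hom), ← Spec.map_comp]
    rfl⟩

omit [IsAlgClosed k] in
lemma valuativeCriterion : ValuativeCriterion C.hom := by
  have h : IsProper C.hom := inferInstance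
  rw [IsProper.eq_valuativeCriterion] at h
  exact h.1.1.1

/-- Existence and uniqueness mirror those in the valuative criterion: the lift of the generic point
to Spec A sends the closed point to a point whose local ring is dominated by `A`, and any point with
valuation ring `A` produces such a lift. -/
lemma existsUnique_placeRing_eq (A : ValuationSubring C.X.functionField) (hA : ∀ c : k,
    algebraMap k C.X.functionField c ∈ A) (hA' : A ≠ ⊤) : ∃! x, C.placeRing x = A := by
  obtain ⟨⟨⟨⟨l, hl₁, hl₂⟩⟩, huniq⟩⟩ := C.valuativeCriterion (C.valuativeCommSq A hA)
  let l' : Spec (.of A) ⟶ C.X := l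
  let x := l' (IsLocalRing.closedPoint A)
  let ψ : C.X.presheaf.stalk x →+* A := (Scheme.stalkClosedPointTo l').hom
  have hloc : IsLocalHom ψ := Scheme.isLocalHom_stalkClosedPointTo' l'
  have hl₁' : Spec.map (CommRingCat.ofHom (algebraMap A C.X.functionField)) ≫ l' =
      C.X.fromSpecStalk (genericPoint C.X) := hl₁
  have hψ : ∀ a, (ψ a : C.X.functionField) = algebraMap _ _ a := by
    have h1 : Scheme.stalkClosedPointTo l' ≫
        CommRingCat.ofHom (algebraMap A C.X.functionField) =
        C.X.presheaf.stalkSpecializes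
          ((genericPoint_spec C.X).specializes (trivial : x ∈ ⊤)) := by
      apply Spec.map_injective
      rw [← cancel_mono (C.X.fromSpecStalk x), Spec.map_comp, Category.assoc,
        Scheme.SpecMap_stalkSpecializes_fromSpecStalk, Scheme.Spec_stalkClosedPointTo_fromSpecStalk,
        hl₁']
    intro a
    exact congrArg (fun f => f.hom a) h1
  -- At the generic point the local ring is the whole function field, which `ψ` would embed in `A`.
  have hx : IsClosed ({x} : Set C.X) := by
    refine (C.eq_genericPoint_or_isClosed x).resolve_left fun hx => hA' ?_
    rw [eq_top_iff]
    intro z _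
    have h1 := TopCat.Presheaf.stalkSpecializes_comp C.X.presheaf
      ((genericPoint_spec C.X).specializes (trivial : x ∈ ⊤)) (specializes_of_eq hx)
    have h2 := congrArg (fun f => f.hom z) h1
    rw [TopCat.Presheaf.stalkSpecializes_refl] at h2
    have h3 := hψ (C.X.presheaf.stalkSpecializes (specializes_of_eq hx) z)
    have h4 : algebraMap (C.X.presheaf.stalk x) C.X.functionField
      (C.X.presheaf.stalkSpecializes (specializes_of_eq hx) z) = z := h2
    rw [← h4, ← h3]
    exact (ψ _).2
  refine ⟨⟨x, hx⟩, ?_, ?_⟩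
  · refine le_antisymm ?_ ?_
    · rintro _ ⟨a, rfl⟩
      rw [← hψ]
      exact (ψ a).2
    · intro z hz
      by_cases hz0 : z = 0
      · rw [hz0]
        exact zero_mem _
      -- If only `z⁻¹` lies in the local ring, it is a unit in `A`; as `ψ` is local, it is already a
      -- unit at `x`.
      rcases (C.placeRing ⟨x, hx⟩).mem_or_inv_mem z with h | ⟨b, hb⟩
      · exact h
      have hb' : (ψ b : C.X.functionField) = z⁻¹ := (hψ b).trans hb
      have hu : IsUnit (ψ b) := IsUnit.of_mul_eq_one ⟨z, hz⟩ (Subtype.ext (by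
        simp [hb', hz0]))
      obtain ⟨u, rfl⟩ := hloc.map_nonunit b hu
      refine ⟨(u⁻¹ : (C.X.presheaf.stalk x)ˣ), ?_⟩
      rw [map_units_inv]
      exact inv_eq_iff_eq_inv.2 hb
  · intro y hy
    have hmem : ∀ a : C.X.presheaf.stalk y.1, algebraMap _ C.X.functionField a ∈ A := by
      intro a
      rw [← hy]
      exact ⟨a, rfl⟩
    let χ : C.X.presheaf.stalk y.1 →+* A :=
      (algebraMap _ C.X.functionField).codRestrict A.toSubring hmem
    have hχ : ∀ a, (χ a : C.X.functionField) = algebraMap _ _ a := fun a => rfl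
    have hχloc : IsLocalHom χ := by
      refine ⟨fun a ha => ?_⟩
      obtain ⟨u, hu⟩ := ha
      have hb : ((u⁻¹ : Aˣ) : C.X.functionField) ∈ C.placeRing y := by
        rw [hy]
        exact (u⁻¹ : Aˣ).1.2
      obtain ⟨b, hb⟩ := hb
      refine IsUnit.of_mul_eq_one b (IsFractionRing.injective _ C.X.functionField ?_)
      rw [map_mul, map_one, hb, ← hχ, ← hu]
      exact congrArg Subtype.val (u.mul_inv)
    have hlift := huniq ⟨Spec.map (CommRingCat.ofHom χ) ≫ C.X.fromSpecStalk y.1,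
      C.spec_lift_generic _ χ hχ, by
        rw [Category.assoc]
        exact C.spec_lift_comp_hom hA _ χ hχ⟩
    have hl' : Spec.map (CommRingCat.ofHom χ) ≫ C.X.fromSpecStalk y.1 = l' :=
      congrArg CommSq.LiftStruct.l hlift
    apply Subtype.ext
    change y.1 = l' _
    rw [← hl']
    have hloc' : IsLocalHom (CommRingCat.ofHom χ).hom := hχloc
    exact (specMap_fromSpecStalk_closedPoint (R := .of A) (CommRingCat.ofHom χ)).symm

lemma isPlaceSystem : IsPlaceSystem k C.placeRing (fun x f => Scheme.ord f x.1) where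
  algebraMap_mem x c := by
    refine ⟨(C.scalarStalk x.1).hom c, ?_⟩
    have := C.scalarStalk_specializes ((genericPoint_spec C.X).specializes (trivial : x.1 ∈ ⊤))
    exact congrArg (fun f => f.hom c) this
  ne_top x h := by
    have := C.isDiscreteValuationRing_stalk x.1 x.2
    obtain ⟨ϖ, -, -, hϖ, -⟩ := exists_eq_mul_uniformizer_zpow x.1
    apply hϖ
    change ϖ⁻¹ ∈ C.placeRing x
    rw [h]
    trivial
  exists_uniformizer x := by
    have := C.isDiscreteValuationRing_stalk x.1 x.2
    exact exists_eq_mul_uniformizer_zpow x.1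
  existsUnique := C.existsUnique_placeRing_eq

/-- A nonzero rational function on a curve has finitely many zeros and poles, and the sum of its
orders is zero. -/
theorem finsum_ord_eq_zero [CharZero k] {f : C.X.functionField} (hf : f ≠ 0) :
    {x : C.X | IsClosed ({x} : Set C.X) ∧ Scheme.ord f x ≠ 0}.Finite ∧
      ∑ᶠ x ∈ {x : C.X | IsClosed ({x} : Set C.X)}, Scheme.ord f x = 0 := by
  obtain ⟨h1, h2⟩ := C.isPlaceSystem.finsum_ord_eq_zero
    (fun f hf => C.finiteDimensional_functionField hf) hf
  constructor
  · refine (h1.image Subtype.val).subset ?_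
    rintro x ⟨hx, hx'⟩
    exact ⟨⟨x, hx⟩, hx', rfl⟩
  · rw [← h2]
    exact (finsum_set_coe_eq_finsum_mem {x : C.X | IsClosed ({x} : Set C.X)}).symm

end SmoothProjectiveCurve

/-! ### Sections and germs of modules -/

lemma exists_opens_forall {Y : Type*} [TopologicalSpace Y] {ι : Type*} [Finite ι]
    {P : ι → Opens Y → Prop} (hP : ∀ i U W, W ≤ U → P i U → P i W) {x : Y} {U : Opens Y}
    (hx : x ∈ U) (h : ∀ i, ∃ W ≤ U, x ∈ W ∧ P i W) : ∃ W ≤ U, x ∈ W ∧ ∀ i, P i W := by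
  choose W hWU hxW hW using h
  have := Fintype.ofFinite ι
  refine ⟨U ⊓ Finset.univ.inf W, inf_le_left, ⟨hx, ?_⟩, fun i =>
    hP i _ _ (inf_le_right.trans (Finset.inf_le (Finset.mem_univ i))) (hW i)⟩
  rw [SetLike.mem_coe, ← SetLike.mem_coe, Opens.coe_finset_inf]
  simpa using hxW

namespace AlgebraicGeometry.Scheme.Modules

variable {X : Scheme.{u}} (V : X.Modules)

lemma map_map {U W W' : X.Opens} (h : W ≤ U) (h' : W' ≤ W) (s : Γ(V, U)) :
    V.presheaf.map (homOfLE h').op (V.presheaf.map (homOfLE h).op s) =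
      V.presheaf.map (homOfLE (h'.trans h)).op s := by
  rw [← ConcreteCategory.comp_apply, ← Functor.map_comp]
  rfl

lemma map_self {U : X.Opens} (h : U ≤ U) (s : Γ(V, U)) : V.presheaf.map (homOfLE h).op s = s := by
  have : (homOfLE h).op = 𝟙 (Opposite.op U) := rfl
  rw [this, V.presheaf.map_id]
  rfl

lemma germ_map {U W : X.Opens} (h : W ≤ U) {x : X} (hx : x ∈ W) (s : Γ(V, U)) :
    V.presheaf.germ W x hx (V.presheaf.map (homOfLE h).op s) = V.presheaf.germ U x (h hx) s :=
  TopCat.Presheaf.germ_res_apply V.presheaf (homOfLE h) x hx s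

lemma exists_germ_eq {x : X} {U : X.Opens} (hx : x ∈ U) (v : ↑(V.presheaf.stalk x)) :
    ∃ (W : X.Opens) (_ : W ≤ U) (hxW : x ∈ W) (s : Γ(V, W)), V.presheaf.germ W x hxW s = v := by
  obtain ⟨W, hW, s, rfl⟩ := TopCat.Presheaf.exists_germ_eq V.presheaf v
  exact ⟨U ⊓ W, inf_le_left, ⟨hx, hW⟩, V.presheaf.map (homOfLE inf_le_right).op s,
    V.germ_map _ _ _⟩

lemma exists_map_eq {x : X} {U : X.Opens} (hx : x ∈ U) (s t : Γ(V, U))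
    (h : V.presheaf.germ U x hx s = V.presheaf.germ U x hx t) :
    ∃ (W : X.Opens) (h : W ≤ U), x ∈ W ∧
      V.presheaf.map (homOfLE h).op s = V.presheaf.map (homOfLE h).op t := by
  obtain ⟨W, hW, i, j, e⟩ := TopCat.Presheaf.germ_eq V.presheaf x hx hx s t h
  exact ⟨W, i.le, hW, e⟩

end AlgebraicGeometry.Scheme.Modules

section RingGerms

variable {X : Scheme.{u}}

lemma exists_ring_germ_eq_family {ι : Type*} [Finite ι] {x : X} {U : X.Opens} (hx : x ∈ U)
    (v : ι → X.presheaf.stalk x) :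
    ∃ (W : X.Opens) (_ : W ≤ U) (hxW : x ∈ W) (s : ι → Γ(X, W)),
      ∀ i, X.presheaf.germ W x hxW (s i) = v i := by
  obtain ⟨W, hWU, hxW, h⟩ := exists_opens_forall
    (P := fun i W => ∀ hx : x ∈ W, ∃ s : Γ(X, W), X.presheaf.germ W x hx s = v i)
    (fun i U W hWU hU hx => by
      obtain ⟨s, hs⟩ := hU (hWU hx)
      exact ⟨X.presheaf.map (homOfLE hWU).op s,
        (TopCat.Presheaf.germ_res_apply X.presheaf (homOfLE hWU) x hx s).trans hs⟩) hx
    (fun i => by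
      obtain ⟨W, hW, s, hs⟩ := TopCat.Presheaf.exists_germ_eq X.presheaf (v i)
      exact ⟨U ⊓ W, inf_le_left, ⟨hx, hW⟩, fun _ =>
        ⟨X.presheaf.map (homOfLE inf_le_right).op s,
          (TopCat.Presheaf.germ_res_apply X.presheaf (homOfLE _) x _ s).trans hs⟩⟩)
  choose s hs using fun i => h i hxW
  exact ⟨W, hWU, hxW, s, hs⟩

lemma germ_map_ring {U W : X.Opens} (h : W ≤ U) {x : X} (hx : x ∈ W) (s : Γ(X, U)) :
    X.presheaf.germ W x hx (X.presheaf.map (homOfLE h).op s) = X.presheaf.germ U x (h hx) s :=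
  TopCat.Presheaf.germ_res_apply X.presheaf (homOfLE h) x hx s

end RingGerms

namespace Subsheaf

variable {X : Scheme.{u}} {V : X.Modules}

lemma germ_mem_stalk (F : Subsheaf V) {U : X.Opens} {x : X} (hx : x ∈ U) {s : Γ(V, U)}
    (hs : s ∈ F.sections U) : V.presheaf.germ U x hx s ∈ F.stalk x :=
  Submodule.subset_span ⟨U, hx, s, hs, rfl⟩

/-- The span in the definition of the stalk adds nothing: sums and multiples of germs of sections
are realised on smaller neighbourhoods. -/
lemma exists_mem_sections_of_mem_stalk (F : Subsheaf V) {x : X} {U : X.Opens} (hx : x ∈ U)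
    {v : ↑(V.presheaf.stalk x)} (hv : v ∈ F.stalk x) :
    ∃ (W : X.Opens) (_ : W ≤ U) (hxW : x ∈ W) (s : Γ(V, W)), s ∈ F.sections W ∧
      V.presheaf.germ W x hxW s = v := by
  unfold stalk at hv
  induction hv using Submodule.span_induction with
  | mem v hv =>
    obtain ⟨W, hW, s, hs, rfl⟩ := hv
    exact ⟨U ⊓ W, inf_le_left, ⟨hx, hW⟩, _, F.map_mem inf_le_right s hs, V.germ_map _ _ _⟩
  | zero => exact ⟨U, le_rfl, hx, 0, zero_mem _, map_zero _⟩
  | add v w _ _ hv hw =>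
    obtain ⟨W₁, h₁, hx₁, s₁, hs₁, rfl⟩ := hv
    obtain ⟨W₂, h₂, hx₂, s₂, hs₂, rfl⟩ := hw
    refine ⟨W₁ ⊓ W₂, inf_le_left.trans h₁, ⟨hx₁, hx₂⟩, _,
      add_mem (F.map_mem inf_le_left s₁ hs₁) (F.map_mem inf_le_right s₂ hs₂), ?_⟩
    exact (map_add _ _ _).trans (congrArg₂ _ (V.germ_map _ _ _) (V.germ_map _ _ _))
  | smul a v _ hv =>
    obtain ⟨W₁, h₁, hx₁, s₁, hs₁, rfl⟩ := hv
    obtain ⟨W₂, h₂, hx₂, r, hr⟩ := exists_ring_germ_eq_family (ι := Unit) hx₁ (fun _ => a)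
    refine ⟨W₂, h₂.trans h₁, hx₂, _, Submodule.smul_mem _ (r ()) (F.map_mem h₂ s₁ hs₁), ?_⟩
    rw [germ_smul_section, V.germ_map, hr]

lemma IsFrame.mono {F : Subsheaf V} {U W : X.Opens} {ι : Type} {e : ι → Γ(V, U)}
    (he : F.IsFrame U e) (h : W ≤ U) :
    F.IsFrame W (fun i => V.presheaf.map (homOfLE h).op (e i)) := by
  intro W' h'
  simp_rw [V.map_map]
  exact he W' (h'.trans h)

lemma IsFrame.isBasisOf {F : Subsheaf V} {U : X.Opens} {ι : Type} {e : ι → Γ(V, U)}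
    (he : F.IsFrame U e) : IsBasisOf e (F.sections U) := by
  have := he U le_rfl
  simp_rw [V.map_self] at this
  exact ⟨this.1, this.2⟩

/-- The germs of a frame form a basis of the stalk. -/
lemma IsFrame.isBasisOf_germ {F : Subsheaf V} {U : X.Opens} {ι : Type} [Fintype ι] {e : ι → Γ(V, U)}
    (he : F.IsFrame U e) {x : X} (hx : x ∈ U) :
    IsBasisOf (fun i => V.presheaf.germ U x hx (e i)) (F.stalk x) := by
  constructor
  · rw [Fintype.linearIndependent_iff]
    intro c hc
    obtain ⟨W, hW, hxW, r, hr⟩ := exists_ring_germ_eq_family hx c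
    have h1 : V.presheaf.germ W x hxW (∑ i, r i • V.presheaf.map (homOfLE hW).op (e i)) =
        V.presheaf.germ W x hxW 0 := by
      rw [map_sum, map_zero, ← hc]
      refine Finset.sum_congr rfl fun i _ => ?_
      rw [germ_smul_section, hr, V.germ_map]
    obtain ⟨W', hW', hxW', h2⟩ := V.exists_map_eq hxW _ _ h1
    rw [map_sum, map_zero] at h2
    simp_rw [Scheme.Modules.map_smul, V.map_map] at h2
    intro i
    have h3 := Fintype.linearIndependent_iff.1 (he W' (hW'.trans hW)).1 _ h2 i
    rw [← hr, ← germ_map_ring hW' hxW']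
    rw [h3, map_zero]
  · refine le_antisymm ?_ ?_
    · rw [Submodule.span_le]
      rintro _ ⟨i, rfl⟩
      exact F.germ_mem_stalk hx (he.isBasisOf.mem i)
    · intro v hv
      obtain ⟨W, hW, hxW, s, hs, rfl⟩ := F.exists_mem_sections_of_mem_stalk hx hv
      rw [← (he W hW).2] at hs
      obtain ⟨c, rfl⟩ := (Submodule.mem_span_range_iff_exists_fun _).1 hs
      rw [map_sum]
      refine Submodule.sum_mem _ fun i _ => ?_
      rw [germ_smul_section, V.germ_map]
      exact Submodule.smul_mem _ _ (Submodule.subset_span ⟨i, rfl⟩)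

lemma stalk_top (x : X) : (⊤ : Subsheaf V).stalk x = ⊤ := by
  rw [eq_top_iff]
  intro v _
  obtain ⟨W, hW, s, rfl⟩ := TopCat.Presheaf.exists_germ_eq V.presheaf v
  exact germ_mem_stalk _ hW Submodule.mem_top

end Subsheaf

namespace Subsheaf

variable {X : Scheme.{u}} {V : X.Modules}

lemma IsFrame.comp_equiv {F : Subsheaf V} {U : X.Opens} {ι κ : Type} {e : ι → Γ(V, U)}
    (he : F.IsFrame U e) (σ : κ ≃ ι) : F.IsFrame U (e ∘ σ) := by
  intro W h
  have h1 : IsBasisOf (fun i => V.presheaf.map (homOfLE h).op (e i)) (F.sections W) :=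
    ⟨(he W h).1, (he W h).2⟩
  exact ⟨(h1.comp_equiv σ).1, (h1.comp_equiv σ).2⟩

lemma isBasisOf_of_isMatrixOf {R N ι : Type*} [CommRing R] [AddCommGroup N] [Module R N]
    [Fintype ι] [DecidableEq ι] {A : Matrix ι ι R} {v w : ι → N} {P : Submodule R N}
    (hw : IsBasisOf w P) (h : IsMatrixOf A v w) (hA : IsUnit A.det) : IsBasisOf v P := by
  have hB := h.symm_of_isUnit hA
  refine ⟨h.linearIndependent_of_isUnit hw.1 hA, ?_⟩
  rw [← hw.span_eq]
  refine le_antisymm ?_ ?_ <;> rw [Submodule.span_le] <;> rintro _ ⟨j, rfl⟩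
  · exact h.mem_span j
  · exact hB.mem_span j

/-- A family of sections that is obtained from a frame by an invertible matrix is a frame. -/
lemma IsFrame.of_isMatrixOf {F : Subsheaf V} {U : X.Opens} {ι : Type} [Fintype ι] [DecidableEq ι]
    {e g : ι → Γ(V, U)} (he : F.IsFrame U e) {A : Matrix ι ι Γ(X, U)} (hA : IsMatrixOf A g e)
    (hdet : IsUnit A.det) : F.IsFrame U g := by
  intro W h
  have h1 : IsBasisOf (fun i => V.presheaf.map (homOfLE h).op (e i)) (F.sections W) :=
    ⟨(he W h).1, (he W h).2⟩
  have h2 : IsMatrixOf (A.map (X.presheaf.map (homOfLE h).op).hom)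
      (fun i => V.presheaf.map (homOfLE h).op (g i))
      (fun i => V.presheaf.map (homOfLE h).op (e i)) := by
    intro j
    have h3 := congrArg (V.presheaf.map (homOfLE h).op) (hA j)
    rw [map_sum] at h3
    simp_rw [Scheme.Modules.map_smul] at h3
    exact h3
  have h3 : IsUnit (A.map (X.presheaf.map (homOfLE h).op).hom).det := by
    have := hdet.map (X.presheaf.map (homOfLE h).op).hom
    rwa [RingHom.map_det] at this
  have h4 := isBasisOf_of_isMatrixOf h1 h2 h3
  exact ⟨h4.1, h4.2⟩

/-- A basis of the stalk of a vector bundle extends to a frame. -/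
lemma exists_isFrame_of_isBasisOf {x : X} {n : ℕ} {U : X.Opens} (hx : x ∈ U)
    {e : Fin n → Γ(V, U)}
    {F : Subsheaf V} (he : F.IsFrame U e) {ι : Type} [Fintype ι] {g : ι → ↑(V.presheaf.stalk x)}
    (hg : IsBasisOf g (F.stalk x)) :
    ∃ (W : X.Opens) (_ : W ≤ U) (hx : x ∈ W) (s : ι → Γ(V, W)),
      (∀ i, V.presheaf.germ W x hx (s i) = g i) ∧ F.IsFrame W s := by
  classical
  have hcard : Fintype.card ι = Fintype.card (Fin n) := by
    rw [← hg.finrank_eq, (he.isBasisOf_germ hx).finrank_eq]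
  let σ : ι ≃ Fin n := Fintype.equivOfCardEq hcard
  have he' := he.comp_equiv σ
  have hb := he'.isBasisOf_germ hx
  obtain ⟨A, hA⟩ := exists_isMatrixOf (R := X.presheaf.stalk x) (v := g)
    (w := fun i => V.presheaf.germ U x hx ((e ∘ σ) i)) fun j => by
      rw [hb.span_eq]
      exact hg.mem j
  have hdet := hA.isUnit_det hb.1 fun j => by
    rw [hg.span_eq]
    exact hb.mem j
  obtain ⟨W, hW, hxW, a, ha⟩ := exists_ring_germ_eq_family hx (fun p : ι × ι => A p.1 p.2)
  let a' : Matrix ι ι Γ(X, W) := fun i j => a (i, j)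
  have ha' : a'.map (X.presheaf.germ W x hxW).hom = A := by
    ext i j
    exact ha (i, j)
  -- The transition matrix is invertible at `x`, hence on the neighbourhood where its determinant is
  -- a unit.
  have hxD : x ∈ X.basicOpen a'.det := by
    rw [Scheme.mem_basicOpen _ _ _ hxW]
    have : X.presheaf.germ W x hxW a'.det = A.det := by
      rw [← ha']
      exact RingHom.map_det _ _
    rw [this]
    exact hdet
  let D := X.basicOpen a'.det
  have hD : D ≤ W := X.basicOpen_le _
  let s : ι → Γ(V, D) := fun j => ∑ i, X.presheaf.map (homOfLE hD).op (a' i j) •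
    V.presheaf.map (homOfLE (hD.trans hW)).op ((e ∘ σ) i)
  refine ⟨D, hD.trans hW, hxD, s, ?_, ?_⟩
  · intro j
    rw [hA j, map_sum]
    refine Finset.sum_congr rfl fun i _ => ?_
    rw [germ_smul_section, germ_map_ring, V.germ_map]
    congr 1
    exact ha (i, j)
  · refine (he'.mono (hD.trans hW)).of_isMatrixOf (A := a'.map (X.presheaf.map (homOfLE hD).op).hom)
      (fun j => rfl) ?_
    have h1 := RingedSpace.isUnit_res_basicOpen X.toRingedSpace a'.det
    have h2 : IsUnit ((X.presheaf.map (homOfLE hD).op).hom a'.det) := h1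
    rwa [RingHom.map_det] at h2

end Subsheaf

/-! ### The stalk at a point as a lattice in the generic stalk. -/

section GenericMap

variable {X : Scheme.{u}} [IsIntegral X] (V : X.Modules)

lemma genericPoint_mem {x : X} {U : X.Opens} (hx : x ∈ U) : genericPoint X ∈ U :=
  (genericPoint_specializes x).mem_open U.2 hx

lemma algebraMap_germ {x : X} {U : X.Opens} (hx : x ∈ U) (r : Γ(X, U)) :
    algebraMap (X.presheaf.stalk x) X.functionField (X.presheaf.germ U x hx r) =
      X.presheaf.germ U (genericPoint X) (genericPoint_mem hx) r :=
  TopCat.Presheaf.germ_stalkSpecializes_apply X.presheaf hx (genericPoint_specializes x) r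

lemma stalkSpecializes_germ {x : X} {U : X.Opens} (hx : x ∈ U) (s : Γ(V, U)) :
    V.presheaf.stalkSpecializes (genericPoint_specializes x) (V.presheaf.germ U x hx s) =
      V.presheaf.germ U (genericPoint X) (genericPoint_mem hx) s :=
  TopCat.Presheaf.germ_stalkSpecializes_apply V.presheaf hx (genericPoint_specializes x) s

/-- The map from the stalk at `x` to the generic stalk. -/
noncomputable def genericMap (x : X) : ↑(V.presheaf.stalk x) →ₛₗ[algebraMap (X.presheaf.stalk x)
    X.functionField] ↑(V.presheaf.stalk (genericPoint X)) where
  toFun := V.presheaf.stalkSpecializes (genericPoint_specializes x)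
  map_add' := map_add _
  map_smul' r v := by
    obtain ⟨U, -, hx, s, rfl⟩ := V.exists_germ_eq (U := ⊤) trivial v
    obtain ⟨W, hW, hxW, r, hr⟩ := exists_ring_germ_eq_family (ι := Unit) hx (fun _ => r)
    rw [← hr (), ← V.germ_map hW hxW, ← germ_smul_section, stalkSpecializes_germ,
      stalkSpecializes_germ, germ_smul_section]
    congr 1
    exact (algebraMap_germ hxW _).symm

lemma genericMap_germ {x : X} {U : X.Opens} (hx : x ∈ U) (s : Γ(V, U)) :
    genericMap V x (V.presheaf.germ U x hx s) =
      V.presheaf.germ U (genericPoint X) (genericPoint_mem hx) s :=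
  stalkSpecializes_germ V hx s

variable {V}

/-- A frame near `x` gives bases of both stalks, in which the map is the inclusion of `Oⁿ` into
`Kⁿ`. -/
lemma isLatticeMap_genericMap (hV : IsVectorBundle V) (x : X) : IsLatticeMap (genericMap V x) := by
  obtain ⟨U, n, e, hx, he⟩ := hV x
  have hb := he.isBasisOf_germ hx
  have hη := he.isBasisOf_germ (genericPoint_mem hx)
  constructor
  · rw [injective_iff_map_eq_zero]
    intro v hv
    have hv' : v ∈ Submodule.span (X.presheaf.stalk x)
        (Set.range fun i => V.presheaf.germ U x hx (e i)) := by
      rw [hb.span_eq, Subsheaf.stalk_top]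
      trivial
    obtain ⟨c, rfl⟩ := (Submodule.mem_span_range_iff_exists_fun _).1 hv'
    simp_rw [map_sum, map_smulₛₗ, genericMap_germ] at hv
    have h0 := Fintype.linearIndependent_iff.1 hη.1 _ hv
    refine Finset.sum_eq_zero fun i _ => ?_
    have : c i = 0 := by simpa using h0 i
    rw [this, zero_smul]
  · intro z
    have hz : z ∈ Submodule.span X.functionField
        (Set.range fun i => V.presheaf.germ U (genericPoint X) (genericPoint_mem hx) (e i)) := by
      have := hη.span_eq
      rw [Subsheaf.stalk_top] at this
      exact this ▸ Submodule.mem_top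
    obtain ⟨c, rfl⟩ := (Submodule.mem_span_range_iff_exists_fun _).1 hz
    obtain ⟨b, hb⟩ := IsLocalization.exist_integer_multiples
      (nonZeroDivisors (X.presheaf.stalk x)) Finset.univ c
    choose d hd using fun i => hb i (Finset.mem_univ i)
    refine ⟨b, nonZeroDivisors.ne_zero b.2, ∑ i, d i • V.presheaf.germ U x hx (e i), ?_⟩
    rw [map_sum, Finset.smul_sum]
    refine Finset.sum_congr rfl fun i _ => ?_
    rw [map_smulₛₗ, genericMap_germ, hd, smul_smul, Algebra.smul_def]

omit [IsIntegral X] in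
lemma exists_isBasisOf_stalk (hV : IsVectorBundle V) (x : X) :
    ∃ (n : ℕ) (g : Fin n → ↑(V.presheaf.stalk x)),
      IsBasisOf g (⊤ : Submodule (X.presheaf.stalk x) ↑(V.presheaf.stalk x)) := by
  obtain ⟨U, n, e, hx, he⟩ := hV x
  exact ⟨n, _, Subsheaf.stalk_top (V := V) x ▸ he.isBasisOf_germ hx⟩

omit [IsIntegral X] in
lemma free_stalk (hV : IsVectorBundle V) (x : X) :
    Module.Free (X.presheaf.stalk x) ↑(V.presheaf.stalk x) := by
  obtain ⟨n, g, hg⟩ := exists_isBasisOf_stalk hV x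
  exact .of_basis (Module.Basis.mk hg.1 hg.2.ge)

omit [IsIntegral X] in
lemma finite_stalk (hV : IsVectorBundle V) (x : X) :
    Module.Finite (X.presheaf.stalk x) ↑(V.presheaf.stalk x) := by
  obtain ⟨n, g, hg⟩ := exists_isBasisOf_stalk hV x
  exact .of_basis (Module.Basis.mk hg.1 hg.2.ge)

end GenericMap

/-! ### Saturated subsheaves attached to subspaces of the generic stalk. -/

namespace Subsheaf

variable {X : Scheme.{u}} [IsIntegral X] {V : X.Modules}

/-- The subsheaf of the sections whose germ at the generic point lies in `W`. -/
noncomputable def sat (W : Submodule X.functionField ↑(V.presheaf.stalk (genericPoint X))) :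
    Subsheaf V where
  sections U :=
    { carrier := {s | ∀ hη : genericPoint X ∈ U, V.presheaf.germ U (genericPoint X) hη s ∈ W}
      zero_mem' := fun hη => by
        rw [map_zero]
        exact W.zero_mem
      add_mem' := fun ha hb hη => by
        rw [map_add]
        exact W.add_mem (ha hη) (hb hη)
      smul_mem' := fun c a ha hη => by
        rw [germ_smul_section]
        exact W.smul_mem _ (ha hη) }
  map_mem h s hs hη := by
    rw [V.germ_map]
    exact hs (h hη)
  mem_of_local U s hs hη := by
    obtain ⟨W', h, hη', hs'⟩ := hs _ hη
    rw [← V.germ_map h hη']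
    exact hs' hη'

variable {W W' : Submodule X.functionField ↑(V.presheaf.stalk (genericPoint X))}

lemma mem_sat_sections {U : X.Opens} {s : Γ(V, U)} : s ∈ (sat W).sections U ↔
    ∀ hη : genericPoint X ∈ U, V.presheaf.germ U (genericPoint X) hη s ∈ W := Iff.rfl

lemma mem_sat_sections_of_mem {U : X.Opens} {x : X} (hx : x ∈ U) {s : Γ(V, U)} :
    s ∈ (sat W).sections U ↔ V.presheaf.germ U x hx s ∈ W.comap (genericMap V x) := by
  rw [mem_sat_sections, Submodule.mem_comap, genericMap_germ]
  exact ⟨fun h => h _, fun h _ => h⟩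

lemma sat_mono (h : W ≤ W') : sat W ≤ sat W' := fun _ _ hs hη => h (hs hη)

/-- This reduces local questions about `sat W` to saturated lattices over the local ring. -/
lemma stalk_sat (W : Submodule X.functionField ↑(V.presheaf.stalk (genericPoint X))) (x : X) :
    (sat W).stalk x = W.comap (genericMap V x) := by
  refine le_antisymm ?_ ?_
  · rw [stalk, Submodule.span_le]
    rintro _ ⟨U, hx, s, hs, rfl⟩
    exact (mem_sat_sections_of_mem hx).1 hs
  · intro v hv
    obtain ⟨U, -, hx, s, rfl⟩ := V.exists_germ_eq (U := ⊤) trivial v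
    exact germ_mem_stalk _ hx ((mem_sat_sections_of_mem hx).2 hv)

lemma genericMap_genericPoint (v : ↑(V.presheaf.stalk (genericPoint X))) :
    genericMap V (genericPoint X) v = v := by
  obtain ⟨U, -, hx, s, rfl⟩ := V.exists_germ_eq (U := ⊤) trivial v
  exact genericMap_germ V hx s

lemma stalk_sat_genericPoint
    (W : Submodule X.functionField ↑(V.presheaf.stalk (genericPoint X))) :
    (sat W).stalk (genericPoint X) = W := by
  rw [stalk_sat]
  ext v
  rw [Submodule.mem_comap, genericMap_genericPoint]

lemma rank_sat (W : Submodule X.functionField ↑(V.presheaf.stalk (genericPoint X))) :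
    (sat W).rank = Module.finrank X.functionField W := by
  rw [rank, stalk_sat_genericPoint]

lemma eq_zero_of_germ_eq_zero {U : X.Opens} (c : Γ(X, U))
    (hc : ∀ hη : genericPoint X ∈ U, X.presheaf.germ U (genericPoint X) hη c = 0) : c = 0 := by
  by_cases hU : Nonempty U
  · obtain ⟨x, hx⟩ := hU
    have hη := genericPoint_mem hx
    apply germ_injective_of_isIntegral X (genericPoint X) hη
    rw [hc hη, map_zero]
  · have : Subsingleton Γ(X, U) := by
      have hU' : U = ⊥ := by
        ext x
        simp only [SetLike.mem_coe]
        exact ⟨fun hx => (hU ⟨x, hx⟩).elim, fun hx => hx.elim⟩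
      subst hU'
      infer_instance
    exact Subsingleton.elim _ _

/-- A frame of a vector bundle is adapted to a subsheaf `sat W` if a part of it is generically a
basis of `W`. -/
lemma IsFrame.sat_inl {U : X.Opens} {ι κ : Type} [Fintype ι] [Fintype κ] {e : ι ⊕ κ → Γ(V, U)}
    (he : (⊤ : Subsheaf V).IsFrame U e)
    (hW : ∀ hη : genericPoint X ∈ U,
      IsBasisOf (fun i => V.presheaf.germ U (genericPoint X) hη (e (Sum.inl i))) W) :
    (sat W).IsFrame U (fun i => e (Sum.inl i)) := by
  intro U' h
  refine ⟨(he U' h).1.comp Sum.inl Sum.inl_injective, le_antisymm ?_ ?_⟩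
  · rw [Submodule.span_le]
    rintro _ ⟨i, rfl⟩ hη
    simp only [V.germ_map]
    exact (hW (h hη)).mem i
  · intro s hs
    have hs' : s ∈ Submodule.span Γ(X, U')
        (Set.range fun i => V.presheaf.map (homOfLE h).op (e i)) := by
      rw [(he U' h).2]
      trivial
    obtain ⟨c, rfl⟩ := (Submodule.mem_span_range_iff_exists_fun _).1 hs'
    -- At the generic point the section is also a combination of the `Sum.inl` part of the frame;
    -- comparing coordinates kills the other coefficients, and functions embed in the function
    -- field.
    have hc : ∀ i, c (Sum.inr i) = 0 := by
      intro i
      apply eq_zero_of_germ_eq_zero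
      intro hη
      have h1 := hs hη
      have hb := he.isBasisOf_germ (h hη)
      rw [map_sum] at h1
      simp_rw [germ_smul_section, V.germ_map] at h1
      rw [← (hW (h hη)).span_eq, Submodule.mem_span_range_iff_exists_fun] at h1
      obtain ⟨d, hd⟩ := h1
      have h2 := Fintype.linearIndependent_iff.1 hb.1
        (fun j => X.presheaf.germ U' (genericPoint X) hη (c j) - Sum.elim d 0 j) (by
          simp_rw [sub_smul, Finset.sum_sub_distrib]
          rw [sub_eq_zero]
          refine hd.symm.trans ?_
          rw [Fintype.sum_sum_type]
          simp) (Sum.inr i)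
      simpa using h2
    rw [Fintype.sum_sum_type]
    simp_rw [hc, zero_smul, Finset.sum_const_zero, add_zero]
    exact Submodule.sum_mem _ fun i _ => Submodule.smul_mem _ _ (Submodule.subset_span ⟨i, rfl⟩)

/-- A local frame of `F` that is part of a frame of `V` is also a frame of the saturation, so the
two agree locally. -/
lemma IsSubbundle.eq_sat {F : Subsheaf V} (hF : F.IsSubbundle) :
    F = sat (F.stalk (genericPoint X)) := by
  refine le_antisymm (fun U s hs hη => F.germ_mem_stalk hη hs) fun U s hs => ?_
  refine F.mem_of_local U s fun x hx => ?_
  obtain ⟨U', r, m, e, hx', he, heF⟩ := hF x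
  refine ⟨U ⊓ U', inf_le_left, ⟨hx, hx'⟩, ?_⟩
  have h1 := he.sat_inl fun hη => heF.isBasisOf_germ hη
  rw [← (heF (U ⊓ U') inf_le_right).2, (h1 (U ⊓ U') inf_le_right).2]
  exact (sat _).map_mem inf_le_left s hs

/-- The subsheaf `sat W` has a frame near `x` with prescribed germs, and it is locally a direct
summand. -/
lemma exists_isFrame_sat (hV : IsVectorBundle V) (x : X)
    [IsPrincipalIdealRing (X.presheaf.stalk x)]
    (W : Submodule X.functionField ↑(V.presheaf.stalk (genericPoint X))) {ι : Type} [Fintype ι]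
    {g : ι → ↑(V.presheaf.stalk x)} (hg : IsBasisOf g (W.comap (genericMap V x))) :
    ∃ (U : X.Opens) (m : ℕ) (e : ι ⊕ Fin m → Γ(V, U)) (hx : x ∈ U),
      (∀ i, V.presheaf.germ U x hx (e (Sum.inl i)) = g i) ∧ (⊤ : Subsheaf V).IsFrame U e ∧
        (sat W).IsFrame U (fun i => e (Sum.inl i)) := by
  have := free_stalk hV x
  have := finite_stalk hV x
  obtain ⟨m, h, hh⟩ := exists_isBasisOf_top W hg
  obtain ⟨U₀, n, e₀, hx₀, he₀⟩ := hV x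
  obtain ⟨U, -, hx, e, he, heF⟩ := exists_isFrame_of_isBasisOf hx₀ he₀ (g := Sum.elim g h)
    (by rwa [stalk_top])
  refine ⟨U, m, e, hx, fun i => he (Sum.inl i), heF, heF.sat_inl fun hη => ?_⟩
  have h1 := (isLatticeMap_genericMap hV x).isBasisOf hg
  have h2 : (fun i => genericMap V x (g i)) =
      fun i => V.presheaf.germ U (genericPoint X) hη (e (Sum.inl i)) := by
    funext i
    rw [← genericMap_germ V hx]
    exact congrArg _ (he (Sum.inl i)).symm
  rwa [h2] at h1

lemma isSubbundle_sat (hV : IsVectorBundle V) [∀ x, IsPrincipalIdealRing (X.presheaf.stalk x)]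
    (W : Submodule X.functionField ↑(V.presheaf.stalk (genericPoint X))) :
    (sat W).IsSubbundle := by
  intro x
  have := free_stalk hV x
  have := finite_stalk hV x
  obtain ⟨g, hg⟩ := exists_isBasisOf_comap (isLatticeMap_genericMap hV x) (W := W)
    (ι := Fin (Module.finrank X.functionField W)) (by simp)
  obtain ⟨U, m, e, hx, -, he, heW⟩ := exists_isFrame_sat hV x W hg
  exact ⟨U, _, m, e, hx, he, heW⟩

lemma finrank_fiber_sat (hV : IsVectorBundle V) (x : X) [IsPrincipalIdealRing (X.presheaf.stalk x)]
    (W : Submodule X.functionField ↑(V.presheaf.stalk (genericPoint X))) :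
    Module.finrank (residueFieldAt X x) ((sat W).fiber x) = Module.finrank X.functionField W := by
  have := free_stalk hV x
  have := finite_stalk hV x
  rw [← finrank_baseChange (residueFieldAt X x) (isLatticeMap_genericMap hV x) W, ← stalk_sat]
  rfl

lemma nonzero_sat_iff (hV : IsVectorBundle V) : (sat W).Nonzero ↔ W ≠ ⊥ := by
  constructor
  · rintro ⟨U, hU⟩ rfl
    obtain ⟨s, hs, hs0⟩ := (Submodule.ne_bot_iff _).1 hU
    refine hs0 (TopCat.Presheaf.section_ext ⟨V.presheaf, V.isSheaf⟩ U s 0 fun x hx => ?_)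
    refine (isLatticeMap_genericMap hV x).injective ?_
    refine Eq.trans ?_ ((genericMap V x).map_zero.symm.trans (congrArg _ (map_zero _).symm))
    have h := (mem_sat_sections_of_mem hx).1 hs
    exact (Submodule.mem_bot X.functionField).1 h
  · intro hW
    obtain ⟨w, hw, hw0⟩ := W.ne_bot_iff.1 hW
    obtain ⟨U, -, hη, s, rfl⟩ := V.exists_germ_eq (U := ⊤) trivial w
    refine ⟨U, (Submodule.ne_bot_iff _).2 ⟨s, fun _ => hw, ?_⟩⟩
    rintro rfl
    exact hw0 (map_zero _)

end Subsheaf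

section Reindex

variable {O K M E : Type*} [CommRing O] [Field K] [Algebra O K] [AddCommGroup M] [Module O M]
  [AddCommGroup E] [Module K E] {φ : M →ₛₗ[algebraMap O K] E} {ord : K → ℤ}

lemma HasLatticeOrd.comp_equiv {ι κ : Type*} [Fintype ι] [DecidableEq ι] [Fintype κ]
    [DecidableEq κ] {L : Submodule O M} {b : ι → E} {n : ℤ} (h : HasLatticeOrd φ ord L b n)
    (σ : κ ≃ ι) : HasLatticeOrd φ ord L (b ∘ σ) n := by
  obtain ⟨g, A, hg, hA, rfl⟩ := h
  refine ⟨g ∘ σ, A.submatrix σ σ, hg.comp_equiv σ, fun j => ?_, by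
    rw [Matrix.det_submatrix_equiv_self]⟩
  exact (hA (σ j)).trans (σ.sum_comp _).symm

lemma baseChange_sup (κ : Type*) [CommRing κ] [Algebra O κ] (P Q : Submodule O M) :
    (P ⊔ Q).baseChange κ = P.baseChange κ ⊔ Q.baseChange κ := by
  rw [← Submodule.span_eq P, ← Submodule.span_eq Q, ← Submodule.span_union,
    Submodule.baseChange_span, Submodule.baseChange_span, Submodule.baseChange_span,
    Set.image_union, Submodule.span_union]

end Reindex

namespace SmoothProjectiveCurve

variable {k : Type u} [Field k] [IsAlgClosed k] (C : SmoothProjectiveCurve k)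

instance (x : C.X) : IsPrincipalIdealRing (C.X.presheaf.stalk x) := by
  rcases C.eq_genericPoint_or_isClosed x with rfl | hx
  · have : IsPrincipalIdealRing C.X.functionField := inferInstance
    exact this
  · have := C.isDiscreteValuationRing_stalk x hx
    infer_instance

/-- The complement has finitely many irreducible components; the generic point of each differs from
that of the curve and is therefore closed. -/
lemma finite_compl_of_mem {U : C.X.Opens} (hη : genericPoint C.X ∈ U) :
    ((U : Set C.X)ᶜ).Finite := by
  have : CompactSpace C.X := QuasiCompact.compactSpace_of_compactSpace C.hom
  have : IsNoetherian C.X := {}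
  obtain ⟨S, hS, hSc, hSi, hSU⟩ :=
    NoetherianSpace.exists_finite_set_isClosed_irreducible U.2.isClosed_compl
  rw [show (U : Set C.X)ᶜ = ⋃₀ S from hSU]
  refine hS.sUnion fun t ht => ?_
  obtain ⟨z, hz⟩ := QuasiSober.sober (hSi t ht) (hSc t ht)
  have hzU : z ∈ (U : Set C.X)ᶜ := hSU ▸ ⟨t, ht, hz.mem⟩
  rcases C.eq_genericPoint_or_isClosed z with rfl | hz'
  · exact (hzU hη).elim
  · rw [← hz.def, hz'.closure_eq]
    exact Set.finite_singleton z

end SmoothProjectiveCurve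

/-! ### Degrees computed from divisors of determinants. -/

section Degree

variable {k : Type u} [Field k] [IsAlgClosed k] {C : SmoothProjectiveCurve k} {V : C.X.Modules}
  {W : Submodule C.X.functionField ↑(V.presheaf.stalk (genericPoint C.X))}

/-- `n` is the divisor of the rational section `⋀ b` of the determinant of `sat W`. -/
def IsDivisorOf {ι : Type*} [Fintype ι] [DecidableEq ι]
    (W : Submodule C.X.functionField ↑(V.presheaf.stalk (genericPoint C.X)))
    (b : ι → ↑(V.presheaf.stalk (genericPoint C.X))) (n : C.X → ℤ) : Prop :=
  ∀ x : C.X, IsClosed ({x} : Set C.X) →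
    HasLatticeOrd (genericMap V x) (fun f => Scheme.ord f x) (W.comap (genericMap V x)) b (n x)

lemma exists_isDivisorOf (hV : IsVectorBundle V) {ι : Type*} [Fintype ι] [DecidableEq ι]
    {b : ι → ↑(V.presheaf.stalk (genericPoint C.X))} (hb : IsBasisOf b W) :
    ∃ n, IsDivisorOf W b n := by
  have (x : C.X) : ∃ n, HasLatticeOrd (genericMap V x) (fun f => Scheme.ord f x)
      (W.comap (genericMap V x)) b n := by
    have := free_stalk hV x
    have := finite_stalk hV x
    obtain ⟨g, hg⟩ := exists_isBasisOf_comap (isLatticeMap_genericMap hV x) hb.finrank_eq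
    obtain ⟨A, hA⟩ := exists_isMatrixOf (v := b) (w := fun i => genericMap V x (g i))
      (R := C.X.functionField) fun j => by
        rw [((isLatticeMap_genericMap hV x).isBasisOf hg).span_eq]
        exact hb.mem j
    exact ⟨_, g, A, hg, hA, rfl⟩
  choose n hn using this
  exact ⟨n, fun x _ => hn x⟩

/-- The basis `b` extends to a frame of `sat W` over a neighbourhood of the generic point; there the
matrix is the identity and the order is zero. -/
lemma IsDivisorOf.finite (hV : IsVectorBundle V) {ι : Type} [Fintype ι] [DecidableEq ι]
    {b : ι → ↑(V.presheaf.stalk (genericPoint C.X))} (hb : IsBasisOf b W) {n : C.X → ℤ}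
    (hn : IsDivisorOf W b n) : {x : C.X | IsClosed ({x} : Set C.X) ∧ n x ≠ 0}.Finite := by
  have hη : W.comap (genericMap V (genericPoint C.X)) = W := by
    rw [← Subsheaf.stalk_sat, Subsheaf.stalk_sat_genericPoint]
  obtain ⟨U, m, e, hηU, he, -, heW⟩ := Subsheaf.exists_isFrame_sat hV (genericPoint C.X) W
    (g := b) (by rwa [hη])
  refine (C.finite_compl_of_mem hηU).subset ?_
  rintro x ⟨hx, hnx⟩ hxU
  refine hnx ?_
  have := C.isDiscreteValuationRing_stalk x hx
  have hg := heW.isBasisOf_germ hxU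
  rw [Subsheaf.stalk_sat] at hg
  have hA : IsMatrixOf (1 : Matrix ι ι C.X.functionField) b (fun i => genericMap V x
      (V.presheaf.germ U x hxU (e (Sum.inl i)))) := by
    have : (fun i => genericMap V x (V.presheaf.germ U x hxU (e (Sum.inl i)))) = b := by
      funext i
      rw [genericMap_germ]
      exact he i
    rw [this]
    exact isMatrixOf_one b
  rw [(hn x hx).eq_of_isBasisOf (isLatticeMap_genericMap hV x) (isOrder_ord x) hb hg hA,
    Matrix.det_one]
  have := (isOrder_ord x).of_isUnit (isUnit_one (M := C.X.presheaf.stalk x))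
  simpa using this

/-- A change of basis `T` alters the divisor by that of the function `det T`, which has degree zero.
-/
lemma IsDivisorOf.finsum_eq [CharZero k] (hV : IsVectorBundle V) {ι : Type} [Fintype ι]
    [DecidableEq ι] {b c : ι → ↑(V.presheaf.stalk (genericPoint C.X))} (hb : IsBasisOf b W)
    (hc : IsBasisOf c W) {n m : C.X → ℤ} (hn : IsDivisorOf W b n) (hm : IsDivisorOf W c m) :
    ∑ᶠ x ∈ {x : C.X | IsClosed ({x} : Set C.X)}, m x =
      ∑ᶠ x ∈ {x : C.X | IsClosed ({x} : Set C.X)}, n x := by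
  obtain ⟨T, hT⟩ := exists_isMatrixOf (v := c) (w := b) (R := C.X.functionField) fun j => by
    rw [hb.span_eq]
    exact hc.mem j
  obtain ⟨h1, h2⟩ := C.finsum_ord_eq_zero (ne_zero_det_of_isMatrixOf hc hb hT)
  rw [← add_zero (∑ᶠ x ∈ {x : C.X | IsClosed ({x} : Set C.X)}, n x), ← h2]
  refine Eq.trans ?_ (finsum_mem_add_distrib' (hn.finite hV hb) h1)
  refine finsum_mem_congr rfl fun x hx => ?_
  have := C.isDiscreteValuationRing_stalk x hx
  exact (hn x hx).of_isMatrixOf (isLatticeMap_genericMap hV x) (isOrder_ord x) hb hc hT (hm x hx)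

omit [IsAlgClosed k] in
lemma Subsheaf.HasDegree.exists_isDivisorOf {d : ℤ} (h : (sat W).HasDegree d) :
    ∃ (r : ℕ) (b : Fin r → ↑(V.presheaf.stalk (genericPoint C.X))) (n : C.X → ℤ),
      IsBasisOf b W ∧ IsDivisorOf W b n ∧ d = ∑ᶠ x ∈ {x : C.X | IsClosed ({x} : Set C.X)}, n x := by
  obtain ⟨r, b, n, h, hd⟩ := h
  refine ⟨r, fun i => b i, n, ?_, fun x hx => ?_, hd⟩
  · exact (stalk_sat_genericPoint W).subst (motive := IsBasisOf fun i =>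
      (b i : ↑(V.presheaf.stalk (genericPoint C.X)))) (IsBasisOf.of_basis b)
  · obtain ⟨U, hxU, hη, g, A, hg, hA, hn⟩ := h x hx
    refine ⟨fun i => V.presheaf.germ U x hxU (g i), A, ?_, fun j => ?_, hn⟩
    · rw [← stalk_sat]
      exact hg.isBasisOf_germ hxU
    · simp_rw [genericMap_germ]
      exact hA j

lemma IsDivisorOf.hasDegree (hV : IsVectorBundle V) {r : ℕ}
    {b : Fin r → ↑(V.presheaf.stalk (genericPoint C.X))} (hb : IsBasisOf b W) {n : C.X → ℤ}
    (hn : IsDivisorOf W b n) :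
    (Subsheaf.sat W).HasDegree (∑ᶠ x ∈ {x : C.X | IsClosed ({x} : Set C.X)}, n x) := by
  have hb' : IsBasisOf b ((Subsheaf.sat W).stalk (genericPoint C.X)) := by
    rwa [Subsheaf.stalk_sat_genericPoint]
  refine ⟨r, hb'.basis, n, fun x hx => ?_, rfl⟩
  obtain ⟨g, A, hg, hA, hnx⟩ := hn x hx
  obtain ⟨U, m, e, hxU, he, -, heW⟩ := Subsheaf.exists_isFrame_sat hV x W hg
  refine ⟨U, hxU, genericPoint_mem hxU, fun i => e (Sum.inl i), A, heW, fun j => ?_, hnx⟩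
  rw [hb'.coe_basis, hA j]
  refine Finset.sum_congr rfl fun i _ => ?_
  exact congrArg (A i j • ·) ((congrArg _ (he i).symm).trans (genericMap_germ V hxU _))

lemma IsDivisorOf.degree_eq [CharZero k] (hV : IsVectorBundle V) {ι : Type} [Fintype ι]
    [DecidableEq ι] {b : ι → ↑(V.presheaf.stalk (genericPoint C.X))} (hb : IsBasisOf b W)
    {n : C.X → ℤ} (hn : IsDivisorOf W b n) :
    (Subsheaf.sat W).degree = ∑ᶠ x ∈ {x : C.X | IsClosed ({x} : Set C.X)}, n x := by
  let σ := (Fintype.equivFin ι).symm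
  have hb' := hb.comp_equiv σ
  have hn' : IsDivisorOf W (b ∘ σ) n := fun x hx => (hn x hx).comp_equiv σ
  have hd : ∃ d, (Subsheaf.sat W).HasDegree d := ⟨_, hn'.hasDegree hV hb'⟩
  rw [Subsheaf.degree, dif_pos hd]
  obtain ⟨r, c, m, hc, hm, hdm⟩ := hd.choose_spec.exists_isDivisorOf
  obtain rfl : Fintype.card ι = r := by
    rw [← hb.finrank_eq, hc.finrank_eq, Fintype.card_fin]
  rw [hdm]
  exact hn'.finsum_eq hV hb' hc hm

/-- The degrees of the saturated intersection and sum of two subbundles. The number `l x` bounds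
the failure of the sum of the two subbundles to be saturated at `x`. -/
theorem exists_degree_sup_add_degree_inf [CharZero k] (hV : IsVectorBundle V)
    (W₁ W₂ : Submodule C.X.functionField ↑(V.presheaf.stalk (genericPoint C.X))) :
    ∃ l : C.X → ℤ, {x : C.X | l x ≠ 0}.Finite ∧ (∀ x, 0 ≤ l x) ∧
      (Subsheaf.sat (W₁ ⊔ W₂)).degree + (Subsheaf.sat (W₁ ⊓ W₂)).degree =
        (Subsheaf.sat W₁).degree + (Subsheaf.sat W₂).degree + ∑ᶠ x, l x ∧
      ∀ x, IsClosed ({x} : Set C.X) →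
        ((Module.finrank (residueFieldAt C.X x) ((Subsheaf.sat (W₁ ⊔ W₂)).fiber x) : ℤ) ≤
          Module.finrank (residueFieldAt C.X x)
            ↥((Subsheaf.sat W₁).fiber x ⊔ (Subsheaf.sat W₂).fiber x) + l x) ∧
        (l x = 0 → (Subsheaf.sat W₁).stalk x ⊔ (Subsheaf.sat W₂).stalk x =
          (Subsheaf.sat (W₁ ⊔ W₂)).stalk x) := by
  classical
  have := finite_stalk hV (genericPoint C.X)
  have : Module.Finite C.X.functionField ↑(V.presheaf.stalk (genericPoint C.X)) := this
  have hs (P Q : Submodule C.X.functionField ↑(V.presheaf.stalk (genericPoint C.X)))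
      (hPQ : P ≤ Q) {ι : Type} [Fintype ι] {f : ι → ↑(V.presheaf.stalk (genericPoint C.X))}
      (hf : IsBasisOf f P) :
      ∃ (m : ℕ) (c : Fin m → ↑(V.presheaf.stalk (genericPoint C.X))),
        IsBasisOf (Sum.elim f c) Q := by
    have h1 := Submodule.finrank_mono hPQ
    obtain ⟨c, hc⟩ := exists_isBasisOf_extension (κ := Fin (Module.finrank C.X.functionField Q -
      Fintype.card ι)) hPQ (fun a m ha h => (P.smul_mem_iff ha).1 h) hf
      (by rw [Fintype.card_fin, ← hf.finrank_eq]; omega)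
    exact ⟨_, c, hc⟩
  have hf := IsBasisOf.of_basis (Module.finBasis C.X.functionField ↥(W₁ ⊓ W₂))
  set f := fun i => (Module.finBasis C.X.functionField ↥(W₁ ⊓ W₂) i :
    ↑(V.presheaf.stalk (genericPoint C.X)))
  obtain ⟨m₁, c₁, h₁⟩ := hs _ _ inf_le_left hf
  obtain ⟨m₂, c₂, h₂⟩ := hs _ _ inf_le_right hf
  have hS : IsBasisOf (Sum.elim (Sum.elim f c₁) c₂) (W₁ ⊔ W₂) :=
    ⟨linearIndependent_elim_elim h₁ h₂ hf, IsBasisOf.elim_sup h₁.2 h₂.2⟩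
  have key (x : {x : C.X // IsClosed ({x} : Set C.X)}) := by
    have := free_stalk hV x.1
    have := finite_stalk hV x.1
    have := C.isDiscreteValuationRing_stalk x.1 x.2
    exact exists_latticeOrd_sup_inf (isLatticeMap_genericMap hV x.1) (isOrder_ord x.1)
      W₁ W₂ h₁ h₂ hf (residueFieldAt C.X x.1)
  choose nI' n₁' n₂' nS' l' hnI hn₁ hn₂ hnS hl hadd hfib hl0 using key
  -- Extension by zero to the generic point lets the four divisors be summed over all points at
  -- once.
  let ext (n : {x : C.X // IsClosed ({x} : Set C.X)} → ℤ) (x : C.X) : ℤ :=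
    if hx : IsClosed ({x} : Set C.X) then n ⟨x, hx⟩ else 0
  have hext (n) (x : C.X) (hx : IsClosed ({x} : Set C.X)) : ext n x = n ⟨x, hx⟩ := dif_pos hx
  have hext' (n) (x : C.X) (hx : ¬ IsClosed ({x} : Set C.X)) : ext n x = 0 := dif_neg hx
  have dI : IsDivisorOf (W₁ ⊓ W₂) f (ext nI') := fun x hx => by
    rw [hext _ x hx]; exact hnI ⟨x, hx⟩
  have d₁ : IsDivisorOf W₁ _ (ext n₁') := fun x hx => by
    rw [hext _ x hx]; exact hn₁ ⟨x, hx⟩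
  have d₂ : IsDivisorOf W₂ _ (ext n₂') := fun x hx => by
    rw [hext _ x hx]; exact hn₂ ⟨x, hx⟩
  have dS : IsDivisorOf (W₁ ⊔ W₂) _ (ext nS') := fun x hx => by
    rw [hext _ x hx]; exact hnS ⟨x, hx⟩
  have fin (n) (h : {x : C.X | IsClosed ({x} : Set C.X) ∧ ext n x ≠ 0}.Finite) :
      (Function.support (ext n)).Finite := by
    refine h.subset fun x hx => ⟨?_, hx⟩
    by_contra hx'
    exact hx (hext' _ x hx')
  have sum (n) : ∑ᶠ x ∈ {x : C.X | IsClosed ({x} : Set C.X)}, ext n x = ∑ᶠ x, ext n x := by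
    refine finsum_congr fun x => ?_
    by_cases hx : IsClosed ({x} : Set C.X)
    · simp [hx]
    · simp [hx, hext']
  have fI := fin _ (dI.finite hV hf)
  have f₁ := fin _ (d₁.finite hV h₁)
  have f₂ := fin _ (d₂.finite hV h₂)
  have fS := fin _ (dS.finite hV hS)
  have hadd' (x : C.X) : ext nS' x + ext nI' x = ext n₁' x + ext n₂' x + ext l' x := by
    by_cases hx : IsClosed ({x} : Set C.X)
    · simp only [hext _ x hx]
      exact hadd ⟨x, hx⟩
    · simp [hext' _ x hx]
  have fl : (Function.support (ext l')).Finite := by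
    refine (((fS.union fI).union f₁).union f₂).subset fun x hx => ?_
    by_contra h
    simp only [Set.mem_union, Function.mem_support, not_or, not_not] at h
    have := hadd' x
    rw [h.1.1.1, h.1.1.2, h.1.2, h.2] at this
    exact hx (by linarith)
  refine ⟨ext l', fl, fun x => ?_, ?_, fun x hx => ⟨?_, fun h => ?_⟩⟩
  · by_cases hx : IsClosed ({x} : Set C.X)
    · rw [hext _ x hx]
      exact hl _
    · rw [hext' _ x hx]
  · rw [dS.degree_eq hV hS, dI.degree_eq hV hf, d₁.degree_eq hV h₁, d₂.degree_eq hV h₂,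
      sum, sum, sum, sum, ← finsum_add_distrib fS fI, ← finsum_add_distrib f₁ f₂,
      ← finsum_add_distrib ((f₁.union f₂).subset (Function.support_add _ _)) fl]
    exact finsum_congr hadd'
  · have h := hfib ⟨x, hx⟩
    rw [hext _ x hx]
    rw [← Subsheaf.stalk_sat, ← Subsheaf.stalk_sat, ← Subsheaf.stalk_sat,
      baseChange_sup] at h
    exact h
  · rw [hext _ x hx] at h
    simp_rw [Subsheaf.stalk_sat]
    exact hl0 ⟨x, hx⟩ h

end Degree

namespace Subsheaf

variable {X : Scheme.{u}} {V : X.Modules}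

lemma fiber_top (x : X) : (⊤ : Subsheaf V).fiber x = ⊤ := by
  rw [fiber, stalk_top]
  exact Submodule.baseChange_top _

lemma finite_bundleFiber (hV : IsVectorBundle V) (x : X) :
    FiniteDimensional (residueFieldAt X x) (bundleFiber V x) := by
  have := finite_stalk hV x
  exact inferInstanceAs (Module.Finite (residueFieldAt X x)
    (residueFieldAt X x ⊗[X.presheaf.stalk x] ↑(V.presheaf.stalk x)))

/-- A subsheaf is determined by its stalks. -/
lemma add_eq_of_stalk_sup_eq {F G H : Subsheaf V} (hF : F ≤ H) (hG : G ≤ H)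
    (h : ∀ x, F.stalk x ⊔ G.stalk x = H.stalk x) : F + G = H := by
  refine le_antisymm (fun U s hs => H.mem_of_local U s fun x hx => ?_) fun U s hs x hx => ?_
  · obtain ⟨W, hW, hxW, hm⟩ := hs x hx
    exact ⟨W, hW, hxW, sup_le (hF W) (hG W) hm⟩
  · have h1 := H.germ_mem_stalk hx hs
    rw [← h x, Submodule.mem_sup] at h1
    obtain ⟨a, ha, b, hb, hab⟩ := h1
    obtain ⟨W₁, hW₁, hx₁, y, hy, rfl⟩ := F.exists_mem_sections_of_mem_stalk hx ha
    obtain ⟨W₂, hW₂, hx₂, z, hz, rfl⟩ := G.exists_mem_sections_of_mem_stalk hx₁ hb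
    -- The decomposition of the germ at `x` holds for sections on a neighbourhood.
    obtain ⟨W, hW, hxW, e⟩ := V.exists_map_eq hx₂
      (V.presheaf.map (homOfLE (hW₂.trans hW₁)).op s)
      (V.presheaf.map (homOfLE hW₂).op y + z) (by
        rw [map_add, V.germ_map, V.germ_map]
        exact hab.symm)
    refine ⟨W, hW.trans (hW₂.trans hW₁), hxW, ?_⟩
    rw [V.map_map] at e
    rw [e, map_add]
    exact Submodule.add_mem_sup (F.map_mem _ _ (F.map_mem _ _ hy)) (G.map_mem _ _ hz)

end Subsheaf

/-! ### Parabolic degrees of sums and intersections. -/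

namespace ParabolicStructure

variable {k : Type u} [Field k] [IsAlgClosed k] {C : SmoothProjectiveCurve k}
  {V : C.X.Modules} {D : Finset C.X} (P : ParabolicStructure (⊤ : Subsheaf V) D)
  {W W₁ W₂ : Submodule C.X.functionField ↑(V.presheaf.stalk (genericPoint C.X))}

omit [IsAlgClosed k] in
lemma parDeg_induced (F : Subsheaf V) : (P.induced F).parDeg =
    F.degree + ∑ t : D, flagWeight (P.flag t) (P.weight t) (F.fiber t) := rfl

omit [IsAlgClosed k] in
-- Needed since semistability speaks only of proper subbundles, whereas a saturated sum may be all
-- of `V`.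
lemma induced_top : P.induced ⊤ = P := by
  have h : (P.induced ⊤).flag = P.flag := by
    funext t j
    refine inf_eq_right.2 ?_
    rw [← P.flag_zero t]
    exact P.flag_antitone t (Fin.zero_le _)
  cases P
  simp only [induced] at h ⊢
  congr

/-- Covers subbundles with zero intersection, to which semistability does not apply. -/
lemma parDeg_induced_sat_bot [CharZero k] (hV : IsVectorBundle V) :
    (P.induced (Subsheaf.sat ⊥)).parDeg = 0 := by
  have hb : IsBasisOf (fun i : Fin 0 => i.elim0)
      (⊥ : Submodule C.X.functionField ↑(V.presheaf.stalk (genericPoint C.X))) :=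
    ⟨linearIndependent_empty_type, by simp⟩
  obtain ⟨n, hn⟩ := exists_isDivisorOf hV hb
  have h1 : (Subsheaf.sat (⊥ : Submodule C.X.functionField
      ↑(V.presheaf.stalk (genericPoint C.X)))).degree = 0 := by
    rw [hn.degree_eq hV hb]
    refine finsum_mem_eq_zero_of_forall_eq_zero fun x hx => ?_
    obtain ⟨g, A, -, -, h⟩ := hn x hx
    have := C.isDiscreteValuationRing_stalk x hx
    have h2 := (isOrder_ord x).of_isUnit (isUnit_one (M := C.X.presheaf.stalk x))
    rw [h, Matrix.det_isEmpty]
    simpa using h2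
  rw [parDeg_induced, h1, Int.cast_zero, zero_add]
  refine Finset.sum_eq_zero fun t _ => ?_
  have := Subsheaf.finite_bundleFiber hV t.1
  have h2 (G : Submodule (residueFieldAt C.X t) (bundleFiber V t)) :
      Module.finrank (residueFieldAt C.X t) ↥((Subsheaf.sat (⊥ : Submodule C.X.functionField
        ↑(V.presheaf.stalk (genericPoint C.X)))).fiber t ⊓ G) = 0 := by
    have h3 := Submodule.finrank_mono (inf_le_left (a := (Subsheaf.sat (⊥ : Submodule
      C.X.functionField ↑(V.presheaf.stalk (genericPoint C.X)))).fiber t) (b := G))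
    rwa [Subsheaf.finrank_fiber_sat hV, finrank_bot, Nat.le_zero] at h3
  rw [flagWeight_eq (P.flag_antitone t)]
  refine Finset.sum_eq_zero fun j _ => ?_
  rw [h2, h2, sub_self, mul_zero]

omit [IsAlgClosed k] in
-- Only an inclusion: at a point where the sum fails to be saturated the two fibres meet in more
-- than the fibre of the intersection.
lemma fiber_sat_inf_le
    (W₁ W₂ : Submodule C.X.functionField ↑(V.presheaf.stalk (genericPoint C.X))) (x : C.X) :
    (Subsheaf.sat (W₁ ⊓ W₂)).fiber x ≤ (Subsheaf.sat W₁).fiber x ⊓ (Subsheaf.sat W₂).fiber x :=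
  le_inf (Subsheaf.fiber_mono (Subsheaf.sat_mono inf_le_left) x)
    (Subsheaf.fiber_mono (Subsheaf.sat_mono inf_le_right) x)

lemma flagWeight_fiber_add_le (hV : IsVectorBundle V)
    (W₁ W₂ : Submodule C.X.functionField ↑(V.presheaf.stalk (genericPoint C.X))) (t : D) {n : ℤ}
    (h : (Module.finrank (residueFieldAt C.X t) ((Subsheaf.sat (W₁ ⊔ W₂)).fiber t) : ℤ) ≤
      Module.finrank (residueFieldAt C.X t)
        ↥((Subsheaf.sat W₁).fiber t ⊔ (Subsheaf.sat W₂).fiber t) + n) :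
    flagWeight (P.flag t) (P.weight t) ((Subsheaf.sat W₁).fiber t) +
        flagWeight (P.flag t) (P.weight t) ((Subsheaf.sat W₂).fiber t) ≤
      flagWeight (P.flag t) (P.weight t) ((Subsheaf.sat (W₁ ⊓ W₂)).fiber t) +
        flagWeight (P.flag t) (P.weight t) ((Subsheaf.sat (W₁ ⊔ W₂)).fiber t) + n ∧
    (flagWeight (P.flag t) (P.weight t) ((Subsheaf.sat W₁).fiber t) +
        flagWeight (P.flag t) (P.weight t) ((Subsheaf.sat W₂).fiber t) =
      flagWeight (P.flag t) (P.weight t) ((Subsheaf.sat (W₁ ⊓ W₂)).fiber t) +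
        flagWeight (P.flag t) (P.weight t) ((Subsheaf.sat (W₁ ⊔ W₂)).fiber t) + n → n = 0 ∧
      ∀ j, Module.finrank (residueFieldAt C.X t)
            ↥((Subsheaf.sat (W₁ ⊓ W₂)).fiber t ⊓ P.flag t j) +
          Module.finrank (residueFieldAt C.X t)
            ↥((Subsheaf.sat (W₁ ⊔ W₂)).fiber t ⊓ P.flag t j) =
        Module.finrank (residueFieldAt C.X t) ↥((Subsheaf.sat W₁).fiber t ⊓ P.flag t j) +
          Module.finrank (residueFieldAt C.X t) ↥((Subsheaf.sat W₂).fiber t ⊓ P.flag t j)) := by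
  have := Subsheaf.finite_bundleFiber hV t.1
  have := finite_stalk hV (genericPoint C.X)
  have : Module.Finite C.X.functionField ↑(V.presheaf.stalk (genericPoint C.X)) := this
  have hrank := Submodule.finrank_sup_add_finrank_inf_eq W₁ W₂
  have hF0 : P.flag t 0 = ⊤ := (P.flag_zero t).trans (Subsheaf.fiber_top _)
  have hS : (Subsheaf.sat W₁).fiber t.1 ⊔ (Subsheaf.sat W₂).fiber t.1 ≤
      (Subsheaf.sat (W₁ ⊔ W₂)).fiber t.1 :=
    sup_le (Subsheaf.fiber_mono (Subsheaf.sat_mono le_sup_left) t.1)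
      (Subsheaf.fiber_mono (Subsheaf.sat_mono le_sup_right) t.1)
  have hdim : Module.finrank (residueFieldAt C.X t) ((Subsheaf.sat (W₁ ⊓ W₂)).fiber t) +
      Module.finrank (residueFieldAt C.X t) ((Subsheaf.sat (W₁ ⊔ W₂)).fiber t) =
      Module.finrank (residueFieldAt C.X t) ((Subsheaf.sat W₁).fiber t) +
      Module.finrank (residueFieldAt C.X t) ((Subsheaf.sat W₂).fiber t) := by
    rw [Subsheaf.finrank_fiber_sat hV, Subsheaf.finrank_fiber_sat hV,
      Subsheaf.finrank_fiber_sat hV, Subsheaf.finrank_fiber_sat hV]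
    omega
  exact flagWeight_add_le (P.flag_antitone t) hF0 (P.flag_last t) (P.weight_nonneg t)
    (P.weight_lt_one t) (P.weight_strictMono t) (fiber_sat_inf_le W₁ W₂ t.1) hS hdim h

variable {P}

/-- Multiplying the slope inequality by the rank makes it valid for the zero subspace too, and
additive in the rank. -/
lemma IsSemistable.parDeg_le [CharZero k] (hV : IsVectorBundle V) (hP : P.IsSemistable)
    (W : Submodule C.X.functionField ↑(V.presheaf.stalk (genericPoint C.X))) :
    (P.induced (Subsheaf.sat W)).parDeg ≤
      P.parSlope * Module.finrank C.X.functionField W := by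
  have := finite_stalk hV (genericPoint C.X)
  have : Module.Finite C.X.functionField ↑(V.presheaf.stalk (genericPoint C.X)) := this
  by_cases hW : W = ⊥
  · subst hW
    simp [parDeg_induced_sat_bot P hV]
  have hr : (0 : ℚ) < Module.finrank C.X.functionField W := by
    rw [Nat.cast_pos, Nat.pos_iff_ne_zero, Ne, Submodule.finrank_eq_zero]
    exact hW
  have h : (P.induced (Subsheaf.sat W)).parSlope ≤ P.parSlope := by
    by_cases hT : Subsheaf.sat W = ⊤
    · rw [hT, induced_top]
    · exact hP _ (Subsheaf.isSubbundle_sat hV W) ((Subsheaf.nonzero_sat_iff hV).2 hW) hT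
  rwa [parSlope, Subsheaf.rank_sat, div_le_iff₀ hr] at h

/-- Subbundles of a semistable parabolic bundle that have its slope are closed under sums. -/
theorem IsSemistable.sup [CharZero k] (hV : IsVectorBundle V)
    (hD : ∀ t ∈ D, IsClosed ({t} : Set C.X)) (hP : P.IsSemistable)
    (h₁ : (P.induced (Subsheaf.sat W₁)).parDeg =
      P.parSlope * Module.finrank C.X.functionField W₁)
    (h₂ : (P.induced (Subsheaf.sat W₂)).parDeg =
      P.parSlope * Module.finrank C.X.functionField W₂) :
    (P.induced (Subsheaf.sat (W₁ ⊔ W₂))).parDeg =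
      P.parSlope * Module.finrank C.X.functionField ↥(W₁ ⊔ W₂) ∧
    Subsheaf.sat W₁ + Subsheaf.sat W₂ = Subsheaf.sat (W₁ ⊔ W₂) ∧
    ∀ t : D, (P.induced (Subsheaf.sat (W₁ ⊔ W₂))).weights t ⊆
      (P.induced (Subsheaf.sat W₁)).weights t ∪ (P.induced (Subsheaf.sat W₂)).weights t := by
  classical
  have := finite_stalk hV (genericPoint C.X)
  have : Module.Finite C.X.functionField ↑(V.presheaf.stalk (genericPoint C.X)) := this
  have hrank := Submodule.finrank_sup_add_finrank_inf_eq W₁ W₂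
  obtain ⟨l, hl, hl0, hdeg, hx⟩ := exists_degree_sup_add_degree_inf hV W₁ W₂
  have hw (t : D) := flagWeight_fiber_add_le P hV W₁ W₂ t (hx t (hD t t.2)).1
  -- The weights can only offset the part of `l` over `D`; the part elsewhere is a pure gain in
  -- degree.
  have hlD : ∑ t : D, l t ≤ ∑ᶠ x, l x ∧ (∑ t : D, l t = ∑ᶠ x, l x → ∀ x ∉ D, l x = 0) := by
    rw [Finset.sum_coe_sort D l, finsum_eq_sum_of_support_subset (s := hl.toFinset ∪ D) l
      (fun x hx => by simpa using Or.inl hx)]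
    refine ⟨Finset.sum_le_sum_of_subset_of_nonneg Finset.subset_union_right fun x _ _ => hl0 x,
      fun h x hxD => ?_⟩
    by_contra h0
    refine (Finset.sum_lt_sum_of_subset (f := l) Finset.subset_union_right (i := x) ?_ hxD
      (lt_of_le_of_ne (hl0 x) (Ne.symm h0)) fun j _ _ => hl0 j).ne h
    simpa using Or.inl h0
  have hsum := Finset.sum_le_sum fun t (_ : t ∈ Finset.univ) => (hw t).1
  have hS := hP.parDeg_le hV (W₁ ⊔ W₂)
  have hI' := hP.parDeg_le hV (W₁ ⊓ W₂)
  have hS' := hS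
  have hI'' := hI'
  rw [parDeg_induced] at h₁ h₂ hS' hI''
  have hlD' : (∑ t : D, (l t : ℚ)) ≤ ((∑ᶠ x, l x : ℤ) : ℚ) := by exact_mod_cast hlD.1
  have hdeg' : ((Subsheaf.sat (W₁ ⊔ W₂)).degree : ℚ) + (Subsheaf.sat (W₁ ⊓ W₂)).degree =
      (Subsheaf.sat W₁).degree + (Subsheaf.sat W₂).degree + ((∑ᶠ x, l x : ℤ) : ℚ) := by
    exact_mod_cast hdeg
  have hr : P.parSlope * Module.finrank C.X.functionField ↥(W₁ ⊔ W₂) +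
      P.parSlope * Module.finrank C.X.functionField ↥(W₁ ⊓ W₂) =
      P.parSlope * Module.finrank C.X.functionField W₁ +
      P.parSlope * Module.finrank C.X.functionField W₂ := by
    rw [← mul_add, ← mul_add]
    congr 1
    exact_mod_cast hrank
  simp only [Finset.sum_add_distrib] at hsum
  -- The upper bounds from semistability add up to exactly the parabolic degrees of the two given
  -- subbundles, so no inequality can be strict.
  have hl_eq : ∑ t : D, l t = ∑ᶠ x, l x := by
    have : (∑ t : D, (l t : ℚ)) = ((∑ᶠ x, l x : ℤ) : ℚ) := by linarith
    exact_mod_cast this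
  have hw_eq := (Finset.sum_eq_sum_iff_of_le fun t (_ : t ∈ Finset.univ) => (hw t).1).1 (by
    simp only [Finset.sum_add_distrib]
    linarith)
  have hw' (t : D) := (hw t).2 (hw_eq t (Finset.mem_univ t))
  have hlz (x : C.X) : l x = 0 := by
    by_cases h : x ∈ D
    · exact (hw' ⟨x, h⟩).1
    · exact hlD.2 hl_eq x h
  refine ⟨?_, Subsheaf.add_eq_of_stalk_sup_eq (Subsheaf.sat_mono le_sup_left)
    (Subsheaf.sat_mono le_sup_right) fun x => ?_, fun t => ?_⟩
  · rw [parDeg_induced]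
    linarith
  · rcases C.eq_genericPoint_or_isClosed x with rfl | hxc
    · simp_rw [Subsheaf.stalk_sat_genericPoint]
    · exact (hx x hxc).2 (hlz x)
  · rintro a ⟨j, hj, rfl⟩
    have := Subsheaf.finite_bundleFiber hV t.1
    by_contra h
    rw [Set.mem_union, not_or] at h
    refine hj (inf_eq_inf_of_finrank_eq (fiber_sat_inf_le W₁ W₂ t)
      (P.flag_antitone t Fin.castSucc_lt_succ.le)
      ((hw' t).2 _) ((hw' t).2 _) ?_ ?_)
    · by_contra h'
      exact h.1 ⟨j, h', rfl⟩
    · by_contra h'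
      exact h.2 ⟨j, h', rfl⟩

end ParabolicStructure

namespace ParabolicStructure

variable {k : Type u} [Field k] [IsAlgClosed k] {C : SmoothProjectiveCurve k}
  {V : C.X.Modules} {D : Finset C.X} {P : ParabolicStructure (⊤ : Subsheaf V) D} {N : D → ℕ}

lemma parDeg_eq_iff (hV : IsVectorBundle V)
    {W : Submodule C.X.functionField ↑(V.presheaf.stalk (genericPoint C.X))} (hW : W ≠ ⊥) :
    (P.induced (Subsheaf.sat W)).parSlope = P.parSlope ↔
      (P.induced (Subsheaf.sat W)).parDeg =
        P.parSlope * Module.finrank C.X.functionField W := by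
  have := finite_stalk hV (genericPoint C.X)
  have : Module.Finite C.X.functionField ↑(V.presheaf.stalk (genericPoint C.X)) := this
  have hr : (Module.finrank C.X.functionField W : ℚ) ≠ 0 := by
    rwa [Nat.cast_ne_zero, Ne, Submodule.finrank_eq_zero]
  rw [parSlope, Subsheaf.rank_sat, div_eq_iff hr]

lemma IsAdmissible.exists_eq_sat {F : Subsheaf V} (hV : IsVectorBundle V)
    (hF : P.IsAdmissible N F) :
    ∃ W : Submodule C.X.functionField ↑(V.presheaf.stalk (genericPoint C.X)),
      F = Subsheaf.sat W ∧ W ≠ ⊥ ∧ (P.induced (Subsheaf.sat W)).parDeg =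
        P.parSlope * Module.finrank C.X.functionField W := by
  have h := hF.isSubbundle.eq_sat
  have hne : F.stalk (genericPoint C.X) ≠ ⊥ :=
    (Subsheaf.nonzero_sat_iff hV).1 (by rw [← h]; exact hF.nonzero)
  refine ⟨_, h, hne, (parDeg_eq_iff hV hne).1 ?_⟩
  rw [← h]
  exact hF.parSlope_eq

lemma IsAdmissible.add [CharZero k] (hV : IsVectorBundle V)
    (hD : ∀ t ∈ D, IsClosed ({t} : Set C.X)) (hP : P.IsSemistable) {F₁ F₂ : Subsheaf V}
    (h₁ : P.IsAdmissible N F₁) (h₂ : P.IsAdmissible N F₂) : P.IsAdmissible N (F₁ + F₂) := by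
  obtain ⟨W₁, rfl, hW₁, hd₁⟩ := h₁.exists_eq_sat hV
  obtain ⟨W₂, rfl, hW₂, hd₂⟩ := h₂.exists_eq_sat hV
  obtain ⟨hd, hadd, hw⟩ := hP.sup hV hD hd₁ hd₂
  have hne : W₁ ⊔ W₂ ≠ ⊥ := fun h => hW₁ (sup_eq_bot_iff.1 h).1
  rw [hadd]
  exact
    { isSubbundle := Subsheaf.isSubbundle_sat hV _
      nonzero := (Subsheaf.nonzero_sat_iff hV).2 hne
      weights_integral := fun t a ha => (hw t ha).elim (h₁.weights_integral t a)
        (h₂.weights_integral t a)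
      parSlope_eq := (parDeg_eq_iff hV hne).2 hd }

end ParabolicStructure

lemma Subsheaf.le_self_add_right {X : Scheme.{u}} {V : X.Modules} (F G : Subsheaf V) :
    F ≤ F + G := by
  intro U s hs x hx
  exact ⟨U, le_rfl, hx, Submodule.mem_sup_left (F.map_mem le_rfl s hs)⟩

lemma Subsheaf.le_self_add_left {X : Scheme.{u}} {V : X.Modules} (F G : Subsheaf V) :
    G ≤ F + G := by
  intro U s hs x hx
  exact ⟨U, le_rfl, hx, Submodule.mem_sup_right (G.map_mem le_rfl s hs)⟩

/-- Both are saturations of their generic stalks, which coincide by dimension. -/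
lemma Subsheaf.IsSubbundle.eq_of_le_of_rank_le {X : Scheme.{u}} [IsIntegral X] {V : X.Modules}
    (hV : IsVectorBundle V) {F G : Subsheaf V} (hF : F.IsSubbundle) (hG : G.IsSubbundle)
    (h : F ≤ G) (hr : G.rank ≤ F.rank) : F = G := by
  have := finite_stalk hV (genericPoint X)
  have : Module.Finite X.functionField ↑(V.presheaf.stalk (genericPoint X)) := this
  rw [hF.eq_sat, hG.eq_sat]
  exact congrArg _ (Submodule.eq_of_le_of_finrank_le (Subsheaf.stalk_mono h _) hr)

theorem lemma3p1 {k : Type u} [Field k] [IsAlgClosed k] [CharZero k]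
    (C : SmoothProjectiveCurve k) (V : C.X.Modules) (hV : IsVectorBundle V)
    (D : Finset C.X) (hD : ∀ t ∈ D, IsClosed ({t} : Set C.X))
    (P : ParabolicStructure (⊤ : Subsheaf V) D) (hP : P.IsSemistable)
    (N : D → ℕ) (hN : ∀ t, 1 ≤ N t)
    (hF : ∃ F : Subsheaf V, P.IsAdmissible N F) :
    (∃ 𝓕 : Subsheaf V, IsGreatest {F | P.IsAdmissible N F} 𝓕 ∧
      ∀ G : Subsheaf V, Maximal (P.IsAdmissible N) G → G = 𝓕) ∧
    (∀ F₁ F₂ : Subsheaf V, P.IsAdmissible N F₁ → P.IsAdmissible N F₂ →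
      P.IsAdmissible N (F₁ + F₂)) := by
  have hadd (F₁ F₂ : Subsheaf V) (h₁ : P.IsAdmissible N F₁) (h₂ : P.IsAdmissible N F₂) :
      P.IsAdmissible N (F₁ + F₂) := h₁.add hV hD hP h₂
  refine ⟨?_, hadd⟩
  have hfin := finite_stalk hV (genericPoint C.X)
  have hfin : Module.Finite C.X.functionField ↑(V.presheaf.stalk (genericPoint C.X)) := hfin
  obtain ⟨𝓕, h𝓕, hmax⟩ : ∃ 𝓕, P.IsAdmissible N 𝓕 ∧
      ∀ G, P.IsAdmissible N G → G.rank ≤ 𝓕.rank := by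
    have hbdd : BddAbove (Subsheaf.rank '' {F | P.IsAdmissible N F}) := by
      refine ⟨Module.finrank C.X.functionField ↑(V.presheaf.stalk (genericPoint C.X)), ?_⟩
      rintro _ ⟨F, -, rfl⟩
      exact Submodule.finrank_le _
    obtain ⟨𝓕, h𝓕, h⟩ := Nat.sSup_mem (Set.Nonempty.image Subsheaf.rank hF) hbdd
    exact ⟨𝓕, h𝓕, fun G hG => h ▸ le_csSup hbdd ⟨G, hG, rfl⟩⟩
  have hgreatest (G : Subsheaf V) (hG : P.IsAdmissible N G) : G ≤ 𝓕 := by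
    -- The sum is an admissible subbundle containing `𝓕`; as its rank is not larger, it equals `𝓕`.
    have h := hadd 𝓕 G h𝓕 hG
    rw [h𝓕.isSubbundle.eq_of_le_of_rank_le hV h.isSubbundle (Subsheaf.le_self_add_right 𝓕 G)
      (hmax _ h)]
    exact Subsheaf.le_self_add_left 𝓕 G
  exact ⟨𝓕, ⟨h𝓕, fun G hG => hgreatest G hG⟩, fun G hG => hG.eq_of_le h𝓕 (hgreatest G hG.1)⟩
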